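/- Let $d\in\mathbb N$ and let $f:\mathbb R^d\to\mathbb R$ be non-negative and $L$-smooth (differentiable with $L$-Lipschitz gradient, $L\ge 0$). A stochastic oracle for $f$ is a probability distribution $\mathcal P$ on a measurable space $\mathcal Z$ together with a measurable map $O_f:\mathbb R^d\times\mathcal Z\to\mathbb R^d$ such that $\mathbb E_{z\sim\mathcal P}O_f(w,z)=\nabla f(w)$ for all $w$. It has variance bounded by $\sigma^2$ if $\mathbb E_{z}\|O_f(w,z)-\nabla f(w)\|^2\le\sigma^2$ for all $w$, and coordinate-wise affine variance with constants $(\sigma_0,\sigma_1)$ if $\mathbb E_z|O_f(w,z)_i|^2\le\sigma_0^2+\sigma_1^2\,\partial_if(w)^2$ for all $w$ and $i$ (the former implies the latter with $\sigma_0=\sigma$, $\sigma_1=1$). Adam with hyperparameters $(\eta,\beta_1,\beta_2)$, initial point $w_1\in\mathbb R^d$, initial conditioner $\nu_0\in(0,\infty)^d$, initial momentum $m_0\in\mathbb R^d$ and $T\ge 1$ iterations draws i.i.d. samples $z_1,\dots,z_T\sim\mathcal P$ and an independent $r$ uniform on $\{1,\dots,T\}$, performs for $t=1,\dots,T$ the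 coordinate-wise updates $$g_t=O_f(w_t,z_t),\quad \nu_t=\beta_2\nu_{t-1}+(1-\beta_2)g_t^{2},\quad m_t=\beta_1m_{t-1}+(1-\beta_1)g_t,\quad w_{t+1}=w_t-\eta\,\frac{m_t}{\sqrt{\nu_t}},$$ and outputs $w_r$. Let $a,b>0$, $0\le c<1$ be constants independent of $T$, and take $\eta=a/\sqrt T$, $\beta_2=1-b/T$, $\beta_1=c\sqrt{\beta_2}$. Suppose that the oracle has variance bounded by $\sigma^2$, $\sigma>0$, and put $\sigma_0=\sigma$, $\sigma_1=1$; or, more generally, that it has coordinate-wise affine variance with constants $\sigma_0>0$, $\sigma_1\ge0$. Put $$D_1=\frac{32La}{b}\frac{(1+c)^3}{(1-c)^3}+\frac{32\sigma_0}{\sqrt b(1-c)^3}+\frac{(1+\sigma_1^2)\sigma_1^2L^2da^2}{(1-c)^4\sigma_0\sqrt{b^3}},\qquad D_2=\frac8af(w_1)+D_1\Big(bd-\sum_{i=1}^d\ln\nu_{0,i}\Big),$$ $$R_T=\sum_{i=1}^d\frac{\partial_if(w_1)^2}{\sqrt{\beta_2\nu_{0,i}+(1-\beta_2)\sigma_0^2}},$$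 and, for $\tilde D\ge0$, $$A_T=2\sum_{i=1}^d\sqrt{\nu_{0,i}+3b\sigma_0^2}+\frac{4D_2\sigma_1^2b}{\sqrt T}+\frac{256\sigma_1^2b}{(1-c)^2T}R_T+\frac{16D_1\sigma_1^2b}{\sqrt T}\ln\Big(e+\frac{4\tilde D\sigma_1^2b}{\sqrt T}\Big).$$ Then there are $T_0$ and $K$, depending only on $d,L,\sigma_0,\sigma_1,a,b,c,\nu_0,m_0$ and $\Delta=f(w_1)$ (not on $T$, nor otherwise on $f$, the oracle and $w_1$), such that for all $T\ge T_0$ and all $\tilde D\ge0$ $$\mathbb E\|\nabla f(w_r)\|\le\sqrt{A_T}\;\sqrt{\frac{2D_1}{\sqrt T}\sum_{i=1}^d\ln A_T+\frac{64}{(1-c)^2T}R_T+\frac{D_2}{\sqrt T}}\qquad\text{and}\qquad\mathbb E\|\nabla f(w_r)\|\le\frac{K}{T^{1/4}}.$$ Consequently, for fixed $d,L,\Delta,\nu_0,m_0$ and $\sigma>0$, the iteration complexity of Adam $$\mathcal C_\varepsilon=\sup_{f,\,(\mathcal P,O_f)}\ \sup_{w_1:\,f(w_1)=\Delta}\ \inf_{(\eta,\beta_1,\beta_2)}\min\{T\ge1:\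 \mathbb E\|\nabla f(w_r)\|\le\varepsilon\text{ for Adam run for }T\text{ iterations}\}$$ (suprema over non-negative $L$-smooth $f$ and oracles for $f$ with variance bounded by $\sigma^2$, infimum over $\eta>0$, $0\le\beta_1<1$, $0<\beta_2<1$) satisfies $\mathcal C_\varepsilon=\mathcal O(1/\varepsilon^4)$: there is a constant $K'$ with $\mathcal C_\varepsilon\le K'/\varepsilon^4$ for all $0<\varepsilon\le1$. -/

import Mathlib

open MeasureTheory ProbabilityTheory

universe u

noncomputable section

/-- The class of objectives: `f : ℝᵈ → ℝ` is non-negative, differentiable, and its gradient is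
`L`-Lipschitz (for the Euclidean norm). -/
structure IsSmoothObjective {d : ℕ} (L : ℝ) (f : EuclideanSpace ℝ (Fin d) → ℝ) : Prop where
  nonneg : ∀ w, 0 ≤ f w
  differentiable : Differentiable ℝ f
  lipschitz : ∀ w v, ‖gradient f w - gradient f v‖ ≤ L * ‖w - v‖

/-- The pair `(P, O)` is an unbiased stochastic gradient oracle for `f`: `P` is a probability
distribution on a measurable space `Z`, `O : ℝᵈ × Z → ℝᵈ` is measurable, and
`𝔼_{z ∼ P} O(w, z) = ∇ f(w)` for every `w`. -/
structure IsUnbiasedOracle {d : ℕ} {Z : Type u} [MeasurableSpace Z] (P : Measure Z)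
    (f : EuclideanSpace ℝ (Fin d) → ℝ)
    (O : EuclideanSpace ℝ (Fin d) → Z → EuclideanSpace ℝ (Fin d)) : Prop where
  isProbability : IsProbabilityMeasure P
  measurable : Measurable (fun p : EuclideanSpace ℝ (Fin d) × Z => O p.1 p.2)
  integrable : ∀ w, Integrable (fun z => O w z) P
  unbiased : ∀ w, ∫ z, O w z ∂P = gradient f w

/-- Unbiased oracle with variance bounded by `σ ^ 2`. -/
structure IsBoundedVarianceOracle {d : ℕ} {Z : Type u} [MeasurableSpace Z] (σ : ℝ)
    (P : Measure Z) (f : EuclideanSpace ℝ (Fin d) → ℝ)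
    (O : EuclideanSpace ℝ (Fin d) → Z → EuclideanSpace ℝ (Fin d)) : Prop
    extends IsUnbiasedOracle P f O where
  sq_integrable : ∀ w, Integrable (fun z => ‖O w z - gradient f w‖ ^ 2) P
  variance_le : ∀ w, ∫ z, ‖O w z - gradient f w‖ ^ 2 ∂P ≤ σ ^ 2

/-- Unbiased oracle with coordinate-wise affine second moment:
`𝔼 |O(w, z)ᵢ|² ≤ σ₀² + σ₁² (∂ᵢ f(w))²`. -/
structure IsAffineVarianceOracle {d : ℕ} {Z : Type u} [MeasurableSpace Z] (σ₀ σ₁ : ℝ)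
    (P : Measure Z) (f : EuclideanSpace ℝ (Fin d) → ℝ)
    (O : EuclideanSpace ℝ (Fin d) → Z → EuclideanSpace ℝ (Fin d)) : Prop
    extends IsUnbiasedOracle P f O where
  sq_integrable : ∀ w i, Integrable (fun z => (O w z i) ^ 2) P
  second_moment_le : ∀ w i,
    ∫ z, (O w z i) ^ 2 ∂P ≤ σ₀ ^ 2 + σ₁ ^ 2 * (gradient f w i) ^ 2

/-- The memory of Adam: current point, momentum, conditioner. -/
structure AdamState (d : ℕ) where
  w : EuclideanSpace ℝ (Fin d)
  m : Fin d → ℝ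
  ν : Fin d → ℝ

/-- One iteration of Adam with stochastic gradient `g`:
`ν ← β₂ ν + (1 - β₂) g²`, `m ← β₁ m + (1 - β₁) g`, `w ← w - η m / √ν` (coordinate-wise, with the
updated `m` and `ν`). -/
def adamStep {d : ℕ} (η β₁ β₂ : ℝ) (s : AdamState d) (g : EuclideanSpace ℝ (Fin d)) :
    AdamState d where
  ν := fun i => β₂ * s.ν i + (1 - β₂) * (g i) ^ 2
  m := fun i => β₁ * s.m i + (1 - β₁) * g i
  w := WithLp.toLp 2 fun i =>
    s.w i - η * ((β₁ * s.m i + (1 - β₁) * g i) /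
      Real.sqrt (β₂ * s.ν i + (1 - β₂) * (g i) ^ 2))

/-- The state after `t` iterations, i.e. `(w_{t+1}, m_t, ν_t)`. Iteration `t` queries the oracle at
`w_t` with the sample `z t` (so `z 0` is not used). -/
def adamState {d : ℕ} {Z : Type u} (O : EuclideanSpace ℝ (Fin d) → Z → EuclideanSpace ℝ (Fin d))
    (η β₁ β₂ : ℝ) (w₁ : EuclideanSpace ℝ (Fin d)) (m₀ ν₀ : Fin d → ℝ) (z : ℕ → Z) :
    ℕ → AdamState d
  | 0 => ⟨w₁, m₀, ν₀⟩
  | t + 1 =>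
      adamStep η β₁ β₂ (adamState O η β₁ β₂ w₁ m₀ ν₀ z t)
        (O (adamState O η β₁ β₂ w₁ m₀ ν₀ z t).w (z (t + 1)))

/-- The iterate `w_t`, for `t ≥ 1`. -/
def adamIterate {d : ℕ} {Z : Type u}
    (O : EuclideanSpace ℝ (Fin d) → Z → EuclideanSpace ℝ (Fin d))
    (η β₁ β₂ : ℝ) (w₁ : EuclideanSpace ℝ (Fin d)) (m₀ ν₀ : Fin d → ℝ) (z : ℕ → Z) (t : ℕ) :
    EuclideanSpace ℝ (Fin d) :=
  (adamState O η β₁ β₂ w₁ m₀ ν₀ z (t - 1)).w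

/-- `𝔼 ‖∇ f(w_r)‖` for the output `w_r` of a run of Adam with `T` iterations: the samples are i.i.d.
with law `P`, and `r` is uniform on `{1, …, T}` and independent of the samples. The expectation of
this non-negative quantity is taken with values in `[0, ∞]`. -/
def adamExpectedGradNorm {d : ℕ} {Z : Type u} [MeasurableSpace Z] (P : Measure Z)
    [IsProbabilityMeasure P] (f : EuclideanSpace ℝ (Fin d) → ℝ)
    (O : EuclideanSpace ℝ (Fin d) → Z → EuclideanSpace ℝ (Fin d))
    (η β₁ β₂ : ℝ) (w₁ : EuclideanSpace ℝ (Fin d)) (m₀ ν₀ : Fin d → ℝ) (T : ℕ) : ENNReal :=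
  ∫⁻ p : (ℕ → Z) × ℕ, ‖gradient f (adamIterate O η β₁ β₂ w₁ m₀ ν₀ p.1 p.2)‖ₑ
    ∂((Measure.infinitePi fun _ : ℕ => P).prod (uniformOn (Set.Icc 1 T)))

/-- The iteration complexity of Adam in dimension `d`, with initial momentum `m₀` and initial
conditioner `ν₀`, at accuracy `ε`: the supremum over all `L`-smooth objectives `f`, all stochastic
oracles for `f` with variance at most `σ ^ 2` and all initial points `w₁` with `f w₁ = Δ`, of the
least number `T ≥ 1` of iterations for which some hyperparameters `(η, β₁, β₂)` give
`𝔼 ‖∇ f(w_r)‖ ≤ ε`. -/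
def adamComplexity {d : ℕ} (m₀ ν₀ : Fin d → ℝ) (ε Δ L σ : ℝ) : ℕ∞ :=
  ⨆ (Z : Type u) (_ : MeasurableSpace Z) (P : Measure Z) (_ : IsProbabilityMeasure P)
    (f : EuclideanSpace ℝ (Fin d) → ℝ)
    (O : EuclideanSpace ℝ (Fin d) → Z → EuclideanSpace ℝ (Fin d))
    (w₁ : EuclideanSpace ℝ (Fin d))
    (_ : IsSmoothObjective L f) (_ : IsBoundedVarianceOracle σ P f O) (_ : f w₁ = Δ),
  ⨅ (T : ℕ) (η : ℝ) (β₁ : ℝ) (β₂ : ℝ)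
    (_ : 1 ≤ T ∧ 0 < η ∧ 0 ≤ β₁ ∧ β₁ < 1 ∧ 0 < β₂ ∧ β₂ < 1 ∧
      adamExpectedGradNorm P f O η β₁ β₂ w₁ m₀ ν₀ T ≤ ENNReal.ofReal ε), (T : ℕ∞)

/-- The constant `D₁`. -/
def adamD₁ (d : ℕ) (L a b c σ₀ σ₁ : ℝ) : ℝ :=
  32 * L * a / b * ((1 + c) ^ 3 / (1 - c) ^ 3) + 32 * σ₀ / (Real.sqrt b * (1 - c) ^ 3)
    + (1 + σ₁ ^ 2) * σ₁ ^ 2 * L ^ 2 * d * a ^ 2 / ((1 - c) ^ 4 * σ₀ * Real.sqrt (b ^ 3))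

/-- The constant `D₂`; the argument `Δ` is the value of the objective at the initial point. -/
def adamD₂ {d : ℕ} (L a b c σ₀ σ₁ Δ : ℝ) (ν₀ : Fin d → ℝ) : ℝ :=
  8 / a * Δ + adamD₁ d L a b c σ₀ σ₁ * (b * d - ∑ i, Real.log (ν₀ i))

/-- `∑ᵢ G_{1,i}² / √ν̃_{1,i}`, where `G₁` is the gradient at the initial point and
`ν̃₁ = β₂ ν₀ + (1 - β₂) σ₀²` (both are deterministic) with `β₂ = 1 - b / T`. -/
def adamInitTerm {d : ℕ} (b σ₀ : ℝ) (ν₀ : Fin d → ℝ) (G₁ : EuclideanSpace ℝ (Fin d)) (T : ℕ) : ℝ :=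
  ∑ i, (G₁ i) ^ 2 / Real.sqrt ((1 - b / T) * ν₀ i + (1 - (1 - b / T)) * σ₀ ^ 2)

/-- The quantity under the first root of the bound; it also occurs inside a logarithm under the
second root. -/
def adamInner {d : ℕ} (L a b c σ₀ σ₁ Δ : ℝ) (ν₀ : Fin d → ℝ) (G₁ : EuclideanSpace ℝ (Fin d))
    (D : ℝ) (T : ℕ) : ℝ :=
  2 * ∑ i, Real.sqrt (ν₀ i + 3 * b * σ₀ ^ 2)
    + 4 * adamD₂ L a b c σ₀ σ₁ Δ ν₀ * σ₁ ^ 2 * b / Real.sqrt T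
    + 256 * σ₁ ^ 2 * b / ((1 - c) ^ 2 * T) * adamInitTerm b σ₀ ν₀ G₁ T
    + 16 * adamD₁ d L a b c σ₀ σ₁ * σ₁ ^ 2 * b / Real.sqrt T
      * Real.log (Real.exp 1 + 4 * D * σ₁ ^ 2 * b / Real.sqrt T)

/-- The explicit upper bound on `𝔼 ‖∇ f(w_r)‖`. -/
def adamBound {d : ℕ} (L a b c σ₀ σ₁ Δ : ℝ) (ν₀ : Fin d → ℝ) (G₁ : EuclideanSpace ℝ (Fin d))
    (D : ℝ) (T : ℕ) : ℝ :=
  Real.sqrt (adamInner L a b c σ₀ σ₁ Δ ν₀ G₁ D T) *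
    Real.sqrt
      (2 * adamD₁ d L a b c σ₀ σ₁ / Real.sqrt T
          * ∑ _i : Fin d, Real.log (adamInner L a b c σ₀ σ₁ Δ ν₀ G₁ D T)
        + 64 / ((1 - c) ^ 2 * T) * adamInitTerm b σ₀ ν₀ G₁ T
        + adamD₂ L a b c σ₀ σ₁ Δ ν₀ / Real.sqrt T)

end

noncomputable section

/-! ### One coordinate of Adam: deterministic inequalities -/

section Scalar

/-! Notation: `G` is the true gradient at the current iterate, `g` the stochastic one, `p = m/√ν`,
primes denote values after the step, and `r = 1/√(β₂ ν)` is the preconditioner that is known before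
the sample is drawn. Everything is governed by `S = ∑ₙ ∑ᵢ 𝔼 Gᵢ² rᵢ`.

Descent. Along `u = w - (c/(1-c)) η p` the increment is `-(η/(1-c)) (p' - c p)`, and the coupling
`β₁ = c √β₂` makes `p' - c p = (1-β₁) r g - m' (r - 1/√ν')` exactly. The first term is linear in `g`
with a predictable factor and produces `S`. The second is correlated with the sample. Young's
inequality weighted by `H = σ₀² + σ₁² G²`, the bound on the second moment of `g`, splits it in two
(`mul_inv_sqrt_sub_le`): a term `ε (G²/H) r g²`, of expectation at most `ε 𝔼 G² r`, and a multiple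
of `H (r - √β₂ r')`, which almost telescopes. Summation by parts (`sum_affine_mul_sub_le`) leaves a
small multiple of `S` and squared gradient increments, at most `L² η² ‖p'‖²`. Taking expectations
gives `expected_descent`.

Directions. A logarithmic potential bounds `∑ ‖p‖²` by `ln ν_T / (1-β₂)` plus simple terms. As `ln`
lies below its tangent in the variable `√ν`, only `𝔼 √ν_T` is needed, and concavity of the root
gives `√(ν₀ + b σ₀²)` plus `O(1/T) S` (`integral_sqrt_conditioner_le`).

Closing. With `η = a/√T` and `1-β₂ = b/T` these combine to `S ≤ const · √T + k₂ + (k₃/√T) S`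
(`exists_weightedSum_le`), hence `S = O(√T)` for large `T`. Cauchy–Schwarz, `‖G‖² ≤ (∑ Gᵢ² rᵢ)(∑
√νᵢ)`, turns this into the rate `T^(-1/4)` (`adamExpectedGradNorm_le`).

The explicit bound holds because its leading coefficients exceed what the argument yields: for large
`T`, and whatever `D ≥ 0` is, its two factors dominate `√(3A/4)` and `√(Ω/(2√T))`, with `A` and `Ω`
independent of `T` (`le_adamBound`), and the product of these already bounds the expected gradient
norm. -/

theorem inv_sqrt_sub_inv_sqrt_eq {v τ g ν' : ℝ} (hv : 0 < v) (hτ : 0 ≤ τ)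
    (h : ν' = v + τ * g ^ 2) :
    √ν' ^ 2 * (1 / √v - 1 / √ν') * (√ν' + √v) = √ν' * τ * g ^ 2 / √v := by
  have h1 : 0 < √v := Real.sqrt_pos.2 hv
  have hν' : 0 < ν' := by rw [h]; positivity
  have h2 : 0 < √ν' := Real.sqrt_pos.2 hν'
  have e1 := Real.sq_sqrt hv.le
  have e2 := Real.sq_sqrt hν'.le
  have : √ν' ^ 2 - √v ^ 2 = τ * g ^ 2 := by rw [e1, e2, h]; ring
  field_simp
  linear_combination this

/-- The error made when the conditioner is replaced by its predictable part. -/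
theorem mul_inv_sqrt_sub_le {v τ g ν' G m C H ε : ℝ} (hv : 0 < v) (hτ : 0 < τ)
    (h : ν' = v + τ * g ^ 2) (hH : 0 < H) (hε : 0 < ε) (hC : 0 < C)
    (hm : √τ * |m / √ν'| ≤ C) :
    G * m * (1 / √v - 1 / √ν') ≤
      ε * (G ^ 2 / H / √v) * g ^ 2 + C ^ 2 / (4 * ε) * (H * (1 / √v - 1 / √ν')) := by
  have h1 : 0 < √v := Real.sqrt_pos.2 hv
  have hν' : 0 < ν' := by rw [h]; positivity
  have h2 : 0 < √ν' := Real.sqrt_pos.2 hν'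
  set D := 1 / √v - 1 / √ν' with hD
  have hle : √v ≤ √ν' := Real.sqrt_le_sqrt (by rw [h]; nlinarith [sq_nonneg g])
  have hD0 : 0 ≤ D := sub_nonneg.2 (one_div_le_one_div_of_le h1 hle)
  have key := inv_sqrt_sub_inv_sqrt_eq hv hτ.le h
  have hm2 : τ * m ^ 2 ≤ C ^ 2 * √ν' ^ 2 := by
    have h3 : (√τ * |m / √ν'|) ^ 2 ≤ C ^ 2 := pow_le_pow_left₀ (by positivity) hm 2
    rw [mul_pow, sq_abs, Real.sq_sqrt hτ.le, div_pow, ← mul_div_assoc, div_le_iff₀ (by positivity)]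
      at h3
    exact h3
  -- The gap `D` carries a factor `τ g²` while `m²` may be as large as `C² ν' / τ`; the two powers
  -- of `τ` cancel.
  have hmD : m ^ 2 * D ≤ C ^ 2 * (g ^ 2 / √v) := by
    have h4 : √ν' ^ 2 * D ≤ τ * g ^ 2 / √v := by
      have : √ν' ^ 2 * D * (√ν' + √v) ≤ τ * g ^ 2 / √v * (√ν' + √v) := by
        rw [key]
        have : √ν' * τ * g ^ 2 / √v = τ * g ^ 2 / √v * √ν' := by ring
        rw [this]
        exact mul_le_mul_of_nonneg_left (by linarith) (by positivity)
      exact le_of_mul_le_mul_right this (by positivity)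
    have h5 : τ * (m ^ 2 * D) ≤ τ * (C ^ 2 * (g ^ 2 / √v)) := by
      calc τ * (m ^ 2 * D) = τ * m ^ 2 * D := by ring
        _ ≤ C ^ 2 * √ν' ^ 2 * D := by gcongr
        _ = C ^ 2 * (√ν' ^ 2 * D) := by ring
        _ ≤ C ^ 2 * (τ * g ^ 2 / √v) := by gcongr
        _ = _ := by ring
    exact le_of_mul_le_mul_left h5 hτ
  have amgm : G * m ≤ ε * (G ^ 2 / H) * (m ^ 2 / C ^ 2) + C ^ 2 / (4 * ε) * H := by
    have : ε * (G ^ 2 / H) * (m ^ 2 / C ^ 2) + C ^ 2 / (4 * ε) * H - G * m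
        = (2 * ε * G * m - C ^ 2 * H) ^ 2 / (4 * ε * H * C ^ 2) := by
      field_simp; ring
    have h6 : 0 ≤ (2 * ε * G * m - C ^ 2 * H) ^ 2 / (4 * ε * H * C ^ 2) := by positivity
    linarith
  calc G * m * D ≤ (ε * (G ^ 2 / H) * (m ^ 2 / C ^ 2) + C ^ 2 / (4 * ε) * H) * D := by gcongr
    _ = ε * (G ^ 2 / H) / C ^ 2 * (m ^ 2 * D) + C ^ 2 / (4 * ε) * (H * D) := by ring
    _ ≤ ε * (G ^ 2 / H) / C ^ 2 * (C ^ 2 * (g ^ 2 / √v)) + C ^ 2 / (4 * ε) * (H * D) := by gcongr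
    _ = _ := by field_simp

variable {β₂ c : ℝ} {ν m g : ℕ → ℝ}

theorem conditioner_pos (hβ : 0 < β₂) (hβ' : β₂ < 1) (h0 : 0 < ν 0)
    (hν : ∀ n, ν (n + 1) = β₂ * ν n + (1 - β₂) * g n ^ 2) (n : ℕ) : 0 < ν n := by
  induction n with
  | zero => exact h0
  | succ n ih =>
    rw [hν]
    have : 0 ≤ (1 - β₂) * g n ^ 2 := mul_nonneg (by linarith) (sq_nonneg _)
    positivity

theorem pow_mul_le_conditioner (hβ : 0 < β₂) (hβ' : β₂ < 1)
    (hν : ∀ n, ν (n + 1) = β₂ * ν n + (1 - β₂) * g n ^ 2) (n : ℕ) : β₂ ^ n * ν 0 ≤ ν n := by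
  induction n with
  | zero => simp
  | succ n ih =>
    rw [hν, pow_succ']
    have : 0 ≤ (1 - β₂) * g n ^ 2 := mul_nonneg (by linarith) (sq_nonneg _)
    nlinarith

/-- A momentum step in terms of the preconditioned direction. -/
theorem abs_momentum_div_le (hβ : 0 < β₂) (hβ' : β₂ < 1) (hc : 0 ≤ c) (hc' : c < 1) (h0 : 0 < ν 0)
    (hν : ∀ n, ν (n + 1) = β₂ * ν n + (1 - β₂) * g n ^ 2)
    (hm : ∀ n, m (n + 1) = c * √β₂ * m n + (1 - c * √β₂) * g n) (n : ℕ) :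
    |m (n + 1) / √(ν (n + 1))| ≤
      c * |m n / √(ν n)| + (1 - c * √β₂) * (|g n| / √(ν (n + 1))) := by
  have hp := conditioner_pos hβ hβ' h0 hν
  have h1 := Real.sqrt_pos.2 (hp n)
  have h2 := Real.sqrt_pos.2 (hp (n + 1))
  have hκ : 0 < √β₂ := Real.sqrt_pos.2 hβ
  have hκ1 : √β₂ ≤ 1 := Real.sqrt_le_one.2 hβ'.le
  -- The factor `√β₂` in the momentum parameter pays for passing from `ν (n + 1)` back to `ν n`.
  have hle : √β₂ * √(ν n) ≤ √(ν (n + 1)) := by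
    rw [← Real.sqrt_mul hβ.le]
    refine Real.sqrt_le_sqrt ?_
    rw [hν]
    have : 0 ≤ (1 - β₂) * g n ^ 2 := mul_nonneg (by linarith) (sq_nonneg _)
    linarith
  have hb : 0 ≤ 1 - c * √β₂ := by nlinarith
  rw [abs_div, abs_div, abs_of_pos h1, abs_of_pos h2, div_le_iff₀ h2, hm]
  calc |c * √β₂ * m n + (1 - c * √β₂) * g n|
      ≤ |c * √β₂ * m n| + |(1 - c * √β₂) * g n| := abs_add_le _ _
    _ = c * (|m n| / √(ν n)) * (√β₂ * √(ν n)) + (1 - c * √β₂) * |g n| := by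
        rw [abs_mul (c * √β₂), abs_mul (1 - c * √β₂), abs_of_nonneg hb,
          abs_of_nonneg (by positivity : 0 ≤ c * √β₂)]
        field_simp
    _ ≤ c * (|m n| / √(ν n)) * √(ν (n + 1)) + (1 - c * √β₂) * |g n| := by gcongr
    _ = _ := by field_simp

/-- Since `(1 - β₂) g² ≤ ν'`, a new gradient contributes at most 1 after scaling, and `C ↦ c C + 1`
does not exceed `C` once `C ≥ 1/(1-c)`. This sure bound also makes every trajectory quantity
integrable. -/
theorem sqrt_mul_abs_momentum_div_le {C : ℝ} (hβ : 0 < β₂) (hβ' : β₂ < 1) (hc : 0 ≤ c)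
    (hc' : c < 1) (h0 : 0 < ν 0)
    (hν : ∀ n, ν (n + 1) = β₂ * ν n + (1 - β₂) * g n ^ 2)
    (hm : ∀ n, m (n + 1) = c * √β₂ * m n + (1 - c * √β₂) * g n)
    (hC0 : |m 0 / √(ν 0)| ≤ C) (hC : 1 / (1 - c) ≤ C) (n : ℕ) :
    √(1 - β₂) * |m n / √(ν n)| ≤ C := by
  have hp := conditioner_pos hβ hβ' h0 hν
  have hκ1 : √β₂ ≤ 1 := Real.sqrt_le_one.2 hβ'.le
  have hκ0 : 0 ≤ √β₂ := Real.sqrt_nonneg _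
  have hs1 : √(1 - β₂) ≤ 1 := Real.sqrt_le_one.2 (by linarith)
  have hs0 : 0 ≤ √(1 - β₂) := Real.sqrt_nonneg _
  induction n with
  | zero => exact (mul_le_of_le_one_left (abs_nonneg _) hs1).trans hC0
  | succ n ih =>
    have h2 := Real.sqrt_pos.2 (hp (n + 1))
    have h3 : √(1 - β₂) * |g n| ≤ √(ν (n + 1)) := by
      refine Real.le_sqrt_of_sq_le ?_
      rw [mul_pow, Real.sq_sqrt (by linarith), sq_abs, hν]
      nlinarith [hp n]
    have h4 : √(1 - β₂) * (|g n| / √(ν (n + 1))) ≤ 1 := by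
      rw [← mul_div_assoc, div_le_one h2]; exact h3
    have h5 := abs_momentum_div_le hβ hβ' hc hc' h0 hν hm n
    have hb : 0 ≤ 1 - c * √β₂ := by nlinarith
    have hb1 : 1 - c * √β₂ ≤ 1 := by nlinarith [mul_nonneg hc hκ0]
    rw [div_le_iff₀ (by linarith)] at hC
    calc √(1 - β₂) * |m (n + 1) / √(ν (n + 1))|
        ≤ √(1 - β₂) * (c * |m n / √(ν n)| + (1 - c * √β₂) * (|g n| / √(ν (n + 1)))) := by gcongr
      _ = c * (√(1 - β₂) * |m n / √(ν n)|)
          + (1 - c * √β₂) * (√(1 - β₂) * (|g n| / √(ν (n + 1)))) := by ring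
      _ ≤ c * C + 1 * 1 := by gcongr
      _ ≤ C := by linarith

/-- Each summand equals `1 - x` with `x = β₂ ν N / ν (N + 1)`, and `1 - x ≤ -log x` telescopes. -/
theorem sum_sq_div_conditioner_le (hβ : 0 < β₂) (hβ' : β₂ < 1) (h0 : 0 < ν 0)
    (hν : ∀ n, ν (n + 1) = β₂ * ν n + (1 - β₂) * g n ^ 2) (N : ℕ) :
    (1 - β₂) * ∑ n ∈ Finset.range N, g n ^ 2 / ν (n + 1) ≤
      Real.log (ν N) - Real.log (ν 0) - N * Real.log β₂ := by
  have hp := conditioner_pos hβ hβ' h0 hν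
  induction N with
  | zero => simp
  | succ N ih =>
    rw [Finset.sum_range_succ, mul_add]
    have h1 : (1 - β₂) * (g N ^ 2 / ν (N + 1)) ≤
        Real.log (ν (N + 1)) - Real.log (ν N) - Real.log β₂ := by
      have h2 : (1 - β₂) * (g N ^ 2 / ν (N + 1)) = 1 - β₂ * ν N / ν (N + 1) := by
        have := (hp (N + 1)).ne'
        field_simp
        rw [hν]; ring
      have h3 := Real.log_le_sub_one_of_pos (div_pos (mul_pos hβ (hp N)) (hp (N + 1)))
      rw [Real.log_div (mul_pos hβ (hp N)).ne' (hp _).ne', Real.log_mul hβ.ne' (hp N).ne'] at h3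
      linarith
    push_cast
    linarith

theorem sum_sq_momentum_div_le (hβ : 0 < β₂) (hβ' : β₂ < 1) (hc : 0 ≤ c) (hc' : c < 1)
    (h0 : 0 < ν 0)
    (hν : ∀ n, ν (n + 1) = β₂ * ν n + (1 - β₂) * g n ^ 2)
    (hm : ∀ n, m (n + 1) = c * √β₂ * m n + (1 - c * √β₂) * g n) (N : ℕ) :
    ∑ n ∈ Finset.range (N + 1), (m n / √(ν n)) ^ 2 ≤
      (m 0 / √(ν 0)) ^ 2 / (1 - c) + ((1 - c * √β₂) / (1 - c)) ^ 2 / (1 - β₂) *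
        (Real.log (ν N) - Real.log (ν 0) - N * Real.log β₂) := by
  have hp := conditioner_pos hβ hβ' h0 hν
  set q := 1 - c * √β₂ with hq
  have hstep : ∀ n, (m (n + 1) / √(ν (n + 1))) ^ 2 ≤
      c * (m n / √(ν n)) ^ 2 + q ^ 2 / (1 - c) * (g n ^ 2 / ν (n + 1)) := by
    intro n
    have h1 := abs_momentum_div_le hβ hβ' hc hc' h0 hν hm n
    set x := |m n / √(ν n)|
    have e : g n ^ 2 / ν (n + 1) = (|g n| / √(ν (n + 1))) ^ 2 := by
      rw [div_pow, sq_abs, Real.sq_sqrt (hp _).le]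
    rw [e, ← sq_abs, ← sq_abs (m n / √(ν n))]
    set y := |g n| / √(ν (n + 1))
    have h2 : |m (n + 1) / √(ν (n + 1))| ^ 2 ≤ (c * x + q * y) ^ 2 :=
      pow_le_pow_left₀ (abs_nonneg _) h1 2
    refine h2.trans ?_
    have h3 : 0 < 1 - c := by linarith
    -- Convexity of the square for the weights `c` and `1 - c`, with its defect written out.
    have : c * x ^ 2 + q ^ 2 / (1 - c) * y ^ 2 - (c * x + q * y) ^ 2
        = c * ((1 - c) * x - q * y) ^ 2 / (1 - c) := by
      field_simp; ring
    have h4 : 0 ≤ c * ((1 - c) * x - q * y) ^ 2 / (1 - c) := by positivity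
    linarith
  have h3 : 0 < 1 - c := by linarith
  have hsum : ∑ n ∈ Finset.range N, (m (n + 1) / √(ν (n + 1))) ^ 2 ≤
      c * ∑ n ∈ Finset.range (N + 1), (m n / √(ν n)) ^ 2
        + q ^ 2 / (1 - c) * ∑ n ∈ Finset.range N, g n ^ 2 / ν (n + 1) := by
    calc _ ≤ ∑ n ∈ Finset.range N, (c * (m n / √(ν n)) ^ 2
            + q ^ 2 / (1 - c) * (g n ^ 2 / ν (n + 1))) := Finset.sum_le_sum fun n _ => hstep n
      _ = c * ∑ n ∈ Finset.range N, (m n / √(ν n)) ^ 2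
        + q ^ 2 / (1 - c) * ∑ n ∈ Finset.range N, g n ^ 2 / ν (n + 1) := by
          rw [Finset.sum_add_distrib, Finset.mul_sum, Finset.mul_sum]
      _ ≤ _ := by
          have := Finset.sum_le_sum_of_subset_of_nonneg (f := fun n => (m n / √(ν n)) ^ 2)
            (Finset.range_mono (Nat.le_succ N)) fun _ _ _ => sq_nonneg _
          gcongr
  have hlog := sum_sq_div_conditioner_le hβ hβ' h0 hν N
  have hX := Finset.sum_range_succ' (fun n => (m n / √(ν n)) ^ 2) N
  set X := ∑ n ∈ Finset.range (N + 1), (m n / √(ν n)) ^ 2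
  set Y := ∑ n ∈ Finset.range N, g n ^ 2 / ν (n + 1)
  have hY : Y ≤ (Real.log (ν N) - Real.log (ν 0) - N * Real.log β₂) / (1 - β₂) := by
    rw [le_div_iff₀ (by linarith)]; linarith
  have h6 : (1 - c) * X ≤ (m 0 / √(ν 0)) ^ 2 + q ^ 2 / (1 - c) *
      ((Real.log (ν N) - Real.log (ν 0) - N * Real.log β₂) / (1 - β₂)) := by
    have : q ^ 2 / (1 - c) * Y ≤ q ^ 2 / (1 - c) *
      ((Real.log (ν N) - Real.log (ν 0) - N * Real.log β₂) / (1 - β₂)) := by gcongr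
    linarith
  have h7 : X ≤ ((m 0 / √(ν 0)) ^ 2 + q ^ 2 / (1 - c) *
      ((Real.log (ν N) - Real.log (ν 0) - N * Real.log β₂) / (1 - β₂))) / (1 - c) := by
    rw [le_div_iff₀ h3]; linarith
  refine h7.trans (le_of_eq ?_)
  have : (1 - β₂) ≠ 0 := by linarith
  field_simp

theorem sqrt_le_tangent {x y : ℝ} (hx : 0 ≤ x) (hy : 0 < y) : √x ≤ √y + (x - y) / (2 * √y) := by
  have h1 := Real.sqrt_pos.2 hy
  have e1 := Real.sq_sqrt hy.le
  have e2 := Real.sq_sqrt hx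
  have : √y + (x - y) / (2 * √y) - √x = (√x - √y) ^ 2 / (2 * √y) := by
    field_simp
    nlinarith
  have : 0 ≤ (√x - √y) ^ 2 / (2 * √y) := by positivity
  linarith

/-- Interpolates between `√(ν N)` and its noise-level value by replacing the squared gradients still
to come with `σ₀²`. Exchanging one of them costs a tangent of the root taken at a predictable point,
so the correction is linear in `g²` with a predictable coefficient and can be averaged. -/
theorem sqrt_conditioner_le {σ₀ : ℝ} (hβ : 0 < β₂) (hβ' : β₂ < 1) (h0 : 0 < ν 0)
    (hν : ∀ n, ν (n + 1) = β₂ * ν n + (1 - β₂) * g n ^ 2) (N : ℕ) :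
    √(ν N) ≤ √(ν 0 + N * (1 - β₂) * σ₀ ^ 2) + ∑ n ∈ Finset.range N,
      (1 - β₂) / 2 * ((1 / √(β₂ * ν n + ((N - n : ℕ) : ℝ) * (1 - β₂) * σ₀ ^ 2)) * g n ^ 2
        - (1 / √(β₂ * ν n + ((N - n : ℕ) : ℝ) * (1 - β₂) * σ₀ ^ 2)) * σ₀ ^ 2) := by
  have hp := conditioner_pos hβ hβ' h0 hν
  have hb : 0 < 1 - β₂ := by linarith
  have key : ∀ k ≤ N, √(ν k + ((N - k : ℕ) : ℝ) * (1 - β₂) * σ₀ ^ 2) ≤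
      √(ν 0 + N * (1 - β₂) * σ₀ ^ 2) + ∑ n ∈ Finset.range k,
      (1 - β₂) / 2 * ((1 / √(β₂ * ν n + ((N - n : ℕ) : ℝ) * (1 - β₂) * σ₀ ^ 2)) * g n ^ 2
        - (1 / √(β₂ * ν n + ((N - n : ℕ) : ℝ) * (1 - β₂) * σ₀ ^ 2)) * σ₀ ^ 2) := by
    intro k hk
    induction k with
    | zero => simp
    | succ k ih =>
      rw [Finset.sum_range_succ]
      have ih := ih (by omega)
      have e : ((N - k : ℕ) : ℝ) = ((N - (k + 1) : ℕ) : ℝ) + 1 := by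
        rw [← Nat.cast_add_one]; congr 1; omega
      -- The point of tangency has `N - k` noise terms, one more than the interpolant at `k + 1`:
      -- the extra one stands for the sample of step `k`.
      set y := β₂ * ν k + ((N - k : ℕ) : ℝ) * (1 - β₂) * σ₀ ^ 2 with hy
      have hy0 : 0 < y := by have := hp k; positivity
      have h1 := sqrt_le_tangent
        (x := ν (k + 1) + ((N - (k + 1) : ℕ) : ℝ) * (1 - β₂) * σ₀ ^ 2) (y := y)
        (by have := hp (k + 1); positivity) hy0
      have h2 : √y ≤ √(ν k + ((N - k : ℕ) : ℝ) * (1 - β₂) * σ₀ ^ 2) := by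
        refine Real.sqrt_le_sqrt ?_
        rw [hy]; nlinarith [hp k]
      have h3 : (ν (k + 1) + ((N - (k + 1) : ℕ) : ℝ) * (1 - β₂) * σ₀ ^ 2 - y) / (2 * √y)
          = (1 - β₂) / 2 * (1 / √y * g k ^ 2 - 1 / √y * σ₀ ^ 2) := by
        have := (Real.sqrt_pos.2 hy0).ne'
        field_simp
        rw [hy, hν, e]; ring
      linarith
  have := key N le_rfl
  simpa using this

theorem sum_mul_inv_sqrt_sub_eq (H r : ℕ → ℝ) (κ : ℝ) (N : ℕ) :
    ∑ n ∈ Finset.range N, H n * (r n - κ * r (n + 1)) + H N * r N =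
      H 0 * r 0 + ∑ n ∈ Finset.range N, (H (n + 1) - κ * H n) * r (n + 1) := by
  induction N with
  | zero => simp
  | succ N ih => rw [Finset.sum_range_succ, Finset.sum_range_succ]; linarith

/-- Summation by parts for the weights `r n - κ r (n + 1)`. -/
theorem sum_affine_mul_sub_le {G r : ℕ → ℝ} {σ₀ σ₁ κ δ ρ : ℝ} {N : ℕ} (hκ : 0 ≤ κ) (hκ1 : κ ≤ 1)
    (hδ : 0 < δ) (hδ1 : 2 * δ ≤ 1) (hκδ : 1 - κ ≤ δ) (hr0 : ∀ n, 0 ≤ r n)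
    (hr : ∀ n ≤ N, r n ≤ ρ) :
    ∑ n ∈ Finset.range N, (σ₀ ^ 2 + σ₁ ^ 2 * G n ^ 2) * (r n - κ * r (n + 1)) ≤
      ρ * (σ₀ ^ 2 + σ₁ ^ 2 * G 0 ^ 2) + N * (1 - κ) * σ₀ ^ 2 * ρ
        + 2 * δ * σ₁ ^ 2 * ∑ n ∈ Finset.range N, G n ^ 2 * r n
        + σ₁ ^ 2 / δ * ρ * ∑ n ∈ Finset.range N, (G (n + 1) - G n) ^ 2 := by
  have h1 := sum_mul_inv_sqrt_sub_eq (fun n => σ₀ ^ 2 + σ₁ ^ 2 * G n ^ 2) r κ N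
  have h2 : ∀ n ∈ Finset.range N,
      ((σ₀ ^ 2 + σ₁ ^ 2 * G (n + 1) ^ 2) - κ * (σ₀ ^ 2 + σ₁ ^ 2 * G n ^ 2)) * r (n + 1) ≤
        (1 - κ) * σ₀ ^ 2 * ρ + (2 * δ * σ₁ ^ 2 * (G (n + 1) ^ 2 * r (n + 1))
          + σ₁ ^ 2 / δ * ρ * (G (n + 1) - G n) ^ 2) := by
    intro n hn
    have hrn := hr0 (n + 1)
    have hrn' := hr (n + 1) (Finset.mem_range.1 hn)
    -- Young's inequality for the increment of `G`; the identity below shows the defect as a sum of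
    -- nonnegative terms.
    have h3 : G (n + 1) ^ 2 - κ * G n ^ 2 ≤
        2 * δ * G (n + 1) ^ 2 + 1 / δ * (G (n + 1) - G n) ^ 2 := by
      set A := G (n + 1)
      set D := A - G n with hD
      have : G n = A - D := by rw [hD]; ring
      rw [this]
      have e : 2 * δ * A ^ 2 + 1 / δ * D ^ 2 - (A ^ 2 - κ * (A - D) ^ 2)
          = (2 * δ - (1 - κ) - κ * δ) * A ^ 2 + (1 / δ - (1 / δ - 1) * κ) * D ^ 2
            + κ / δ * (δ * A - D) ^ 2 := by field_simp; ring
      have h4 : 0 ≤ 2 * δ - (1 - κ) - κ * δ := by nlinarith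
      have h5 : 0 ≤ 1 / δ - (1 / δ - 1) * κ := by
        have : 0 < 1 / δ := by positivity
        nlinarith
      have : 0 ≤ (2 * δ - (1 - κ) - κ * δ) * A ^ 2 + (1 / δ - (1 / δ - 1) * κ) * D ^ 2
            + κ / δ * (δ * A - D) ^ 2 := by positivity
      linarith
    calc _ = (1 - κ) * σ₀ ^ 2 * r (n + 1)
          + σ₁ ^ 2 * (G (n + 1) ^ 2 - κ * G n ^ 2) * r (n + 1) := by ring
      _ ≤ (1 - κ) * σ₀ ^ 2 * r (n + 1)
          + σ₁ ^ 2 * (2 * δ * G (n + 1) ^ 2 + 1 / δ * (G (n + 1) - G n) ^ 2) * r (n + 1) := by gcongr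
      _ = (1 - κ) * σ₀ ^ 2 * r (n + 1) + (2 * δ * σ₁ ^ 2 * (G (n + 1) ^ 2 * r (n + 1))
          + σ₁ ^ 2 / δ * r (n + 1) * (G (n + 1) - G n) ^ 2) := by ring
      _ ≤ _ := by
        have : 0 ≤ 1 - κ := by linarith
        gcongr
  have h6 := Finset.sum_le_sum h2
  rw [Finset.sum_add_distrib, Finset.sum_add_distrib, Finset.sum_const, Finset.card_range,
    nsmul_eq_mul, ← Finset.mul_sum, ← Finset.mul_sum] at h6
  have h7 : ∑ n ∈ Finset.range N, G (n + 1) ^ 2 * r (n + 1) ≤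
      ∑ n ∈ Finset.range N, G n ^ 2 * r n + G N ^ 2 * r N := by
    have a1 := Finset.sum_range_succ (fun n => G n ^ 2 * r n) N
    have a2 := Finset.sum_range_succ' (fun n => G n ^ 2 * r n) N
    have : 0 ≤ G 0 ^ 2 * r 0 := mul_nonneg (sq_nonneg _) (hr0 0)
    linarith
  have h8 : 2 * δ * σ₁ ^ 2 * ∑ n ∈ Finset.range N, G (n + 1) ^ 2 * r (n + 1) ≤
      2 * δ * σ₁ ^ 2 * (∑ n ∈ Finset.range N, G n ^ 2 * r n + G N ^ 2 * r N) := by gcongr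
  -- The index shift costs a boundary term at `N`; the boundary term on the left of the Abel
  -- identity absorbs it because `2 δ ≤ 1`.
  have h9 : 2 * δ * σ₁ ^ 2 * (G N ^ 2 * r N) ≤ (σ₀ ^ 2 + σ₁ ^ 2 * G N ^ 2) * r N := by
    have := hr0 N
    have a3 : 0 ≤ σ₁ ^ 2 * (G N ^ 2 * r N) := by positivity
    have a4 : 0 ≤ σ₀ ^ 2 * r N := by positivity
    nlinarith
  have h10 : (σ₀ ^ 2 + σ₁ ^ 2 * G 0 ^ 2) * r 0 ≤ ρ * (σ₀ ^ 2 + σ₁ ^ 2 * G 0 ^ 2) := by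
    rw [mul_comm]
    exact mul_le_mul_of_nonneg_right (hr 0 (Nat.zero_le _)) (by positivity)
  linarith

end Scalar

/-! ### Smooth non-negative objectives -/

section Smooth

variable {d : ℕ} {L : ℝ} {f : EuclideanSpace ℝ (Fin d) → ℝ}

/-- On the segment from `x` to `y` both sides agree at time 0, and the Lipschitz gradient orders
their derivatives. -/
theorem IsSmoothObjective.le_quadratic (hf : IsSmoothObjective L f)
    (x y : EuclideanSpace ℝ (Fin d)) :
    f y ≤ f x + inner ℝ (gradient f x) (y - x) + L / 2 * ‖y - x‖ ^ 2 := by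
  have hderiv : ∀ t : ℝ, HasDerivAt (fun t : ℝ => f (x + t • (y - x)))
      (inner ℝ (gradient f (x + t • (y - x))) (y - x)) t := by
    intro t
    have h1 := (hf.differentiable (x + t • (y - x))).hasFDerivAt
    have h2 : HasDerivAt (fun t : ℝ => x + t • (y - x)) (y - x) t := by
      simpa using ((hasDerivAt_id t).smul_const (y - x)).const_add x
    have h3 := h1.comp_hasDerivAt t h2
    rw [inner_gradient_left]
    exact h3
  have hB : ∀ t : ℝ, HasDerivAt
      (fun t : ℝ => f x + t * inner ℝ (gradient f x) (y - x) + L / 2 * t ^ 2 * ‖y - x‖ ^ 2)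
      (inner ℝ (gradient f x) (y - x) + L * t * ‖y - x‖ ^ 2) t := by
    intro t
    have h1 := ((hasDerivAt_id t).mul_const (inner ℝ (gradient f x) (y - x))).const_add (f x)
    have h2 := (((hasDerivAt_id t).pow 2).const_mul (L / 2)).mul_const (‖y - x‖ ^ 2)
    refine (h1.add h2).congr_deriv ?_
    change 1 * _ + L / 2 * (((2 : ℕ) : ℝ) * t ^ 1 * 1) * _ = _
    push_cast
    ring
  have key := image_le_of_deriv_right_le_deriv_boundary (a := 0) (b := 1)
    (f := fun t : ℝ => f (x + t • (y - x)))
    (B := fun t : ℝ => f x + t * inner ℝ (gradient f x) (y - x) + L / 2 * t ^ 2 * ‖y - x‖ ^ 2)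
    (fun t _ => (hderiv t).continuousAt.continuousWithinAt)
    (fun t _ => (hderiv t).hasDerivWithinAt) (by simp)
    (fun t _ => (hB t).continuousAt.continuousWithinAt)
    (fun t _ => (hB t).hasDerivWithinAt) (fun t ht => by
      have h1 : inner ℝ (gradient f (x + t • (y - x)) - gradient f x) (y - x) ≤
          L * t * ‖y - x‖ ^ 2 := by
        refine (real_inner_le_norm _ _).trans ?_
        have h2 := hf.lipschitz (x + t • (y - x)) x
        rw [add_sub_cancel_left, norm_smul, Real.norm_of_nonneg ht.1] at h2
        calc _ ≤ L * (t * ‖y - x‖) * ‖y - x‖ := by gcongr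
          _ = _ := by ring
      rw [inner_sub_left] at h1
      linarith) (x := 1) (by simp)
  simpa using key

/-- A gradient step cannot push `f` below 0. The step length `1/(L+1)` in place of `1/L` covers `L =
0`. It keeps the final constants independent of `w₁`: the initial gradient is controlled by `Δ`. -/
theorem IsSmoothObjective.norm_gradient_sq_le (hf : IsSmoothObjective L f) (hL : 0 ≤ L)
    (x : EuclideanSpace ℝ (Fin d)) : ‖gradient f x‖ ^ 2 ≤ 2 * (L + 1) * f x := by
  have h := hf.le_quadratic x (x - (1 / (L + 1)) • gradient f x)
  have h0 := hf.nonneg (x - (1 / (L + 1)) • gradient f x)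
  have e : x - (1 / (L + 1)) • gradient f x - x = -((1 / (L + 1)) • gradient f x) := by abel
  rw [e, inner_neg_right, inner_smul_right, real_inner_self_eq_norm_sq, norm_neg, norm_smul,
    Real.norm_of_nonneg (by positivity)] at h
  set N := ‖gradient f x‖
  have h1 : 1 / (L + 1) * N ^ 2 - L / 2 * (1 / (L + 1) * N) ^ 2
      = (L + 2) / (2 * (L + 1) ^ 2) * N ^ 2 := by
    field_simp; ring
  have h2 : (L + 2) / (2 * (L + 1) ^ 2) * N ^ 2 ≤ f x := by linarith
  have h3 : N ^ 2 / (2 * (L + 1)) ≤ (L + 2) / (2 * (L + 1) ^ 2) * N ^ 2 := by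
    rw [div_mul_eq_mul_div, div_le_div_iff₀ (by positivity) (by positivity)]
    have : 0 ≤ N ^ 2 * (L + 1) := by positivity
    nlinarith
  have h4 := h3.trans h2
  rwa [div_le_iff₀ (by positivity), mul_comm] at h4

theorem IsSmoothObjective.continuous_gradient (hf : IsSmoothObjective L f) :
    Continuous (gradient f) := by
  have : LipschitzWith L.toNNReal (gradient f) := LipschitzWith.of_dist_le_mul fun x y => by
    rw [dist_eq_norm, dist_eq_norm]
    exact (hf.lipschitz x y).trans
      (mul_le_mul_of_nonneg_right (Real.le_coe_toNNReal L) (norm_nonneg _))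
  exact this.continuous

end Smooth

/-! ### Pathwise descent along a run -/

section Run

variable {d : ℕ}

/-- The preconditioned direction `m / √ν`. -/
def AdamState.dir (s : AdamState d) : EuclideanSpace ℝ (Fin d) :=
  WithLp.toLp 2 fun i => s.m i / √(s.ν i)

@[simp] theorem AdamState.dir_apply (s : AdamState d) (i : Fin d) :
    s.dir i = s.m i / √(s.ν i) := rfl

/-- The shifted iterate along which the objective decreases. -/
def AdamState.shifted (η c : ℝ) (s : AdamState d) : EuclideanSpace ℝ (Fin d) :=
  s.w - (c / (1 - c) * η) • s.dir

theorem adamStep_w (η β₁ β₂ : ℝ) (s : AdamState d) (g : EuclideanSpace ℝ (Fin d)) :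
    (adamStep η β₁ β₂ s g).w = s.w - η • (adamStep η β₁ β₂ s g).dir := by
  ext i; simp [adamStep]

/-- The shift `c/(1-c)` is the one for which `1 + c/(1-c) = 1/(1-c)`, so that the old direction
enters with relative weight exactly `-c` and the momentum can be cancelled. -/
theorem shifted_adamStep_sub {η c : ℝ} (hc' : c < 1) (β₁ β₂ : ℝ) (s : AdamState d)
    (g : EuclideanSpace ℝ (Fin d)) :
    (adamStep η β₁ β₂ s g).shifted η c - s.shifted η c =
      -(η / (1 - c)) • ((adamStep η β₁ β₂ s g).dir - c • s.dir) := by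
  rw [AdamState.shifted, AdamState.shifted, adamStep_w]
  have : 1 - c ≠ 0 := by linarith
  ext i
  simp only [PiLp.sub_apply, PiLp.smul_apply, smul_eq_mul]
  field_simp
  ring

variable {L η c β₂ : ℝ} {f : EuclideanSpace ℝ (Fin d) → ℝ}
  {s : ℕ → AdamState d} {g : ℕ → EuclideanSpace ℝ (Fin d)}

/-- The quadratic upper bound between consecutive shifted points, with the gradient moved from the
shifted point to the actual iterate, where the oracle is unbiased. The move costs `L` times the
shift, which is of second order in `η`. -/
theorem inner_descent_step (hf : IsSmoothObjective L f) (hL : 0 ≤ L) (hη : 0 < η) (hc : 0 ≤ c)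
    (hc' : c < 1) {β₁ β₂ : ℝ} (s : AdamState d) (g : EuclideanSpace ℝ (Fin d)) :
    inner ℝ (gradient f s.w) ((adamStep η β₁ β₂ s g).dir - c • s.dir) ≤
      (1 - c) / η * (f (s.shifted η c) - f ((adamStep η β₁ β₂ s g).shifted η c))
        + L * η * (1 + c) ^ 2 / (1 - c) * (‖s.dir‖ ^ 2 + ‖(adamStep η β₁ β₂ s g).dir‖ ^ 2) := by
  set s' := adamStep η β₁ β₂ s g with hs'
  have h1 := hf.le_quadratic (s.shifted η c) (s'.shifted η c)
  rw [hs', shifted_adamStep_sub hc', ← hs'] at h1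
  have hc1 : 0 < 1 - c := by linarith
  set p := s'.dir - c • s.dir
  have hp : ‖p‖ ≤ ‖s'.dir‖ + c * ‖s.dir‖ := by
    refine (norm_sub_le _ _).trans ?_
    rw [norm_smul, Real.norm_of_nonneg hc]
  have h2 : ‖gradient f (s.shifted η c) - gradient f s.w‖ ≤ L * (c / (1 - c) * η * ‖s.dir‖) := by
    refine (hf.lipschitz _ _).trans ?_
    have : s.shifted η c - s.w = -((c / (1 - c) * η) • s.dir) := by
      rw [AdamState.shifted]; abel
    rw [this, norm_neg, norm_smul, Real.norm_of_nonneg (by positivity)]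
  have h3 : -inner ℝ (gradient f (s.shifted η c)) p ≤
      -inner ℝ (gradient f s.w) p + L * (c / (1 - c) * η * ‖s.dir‖) * ‖p‖ := by
    have a1 : inner ℝ (gradient f s.w - gradient f (s.shifted η c)) p ≤
        ‖gradient f (s.shifted η c) - gradient f s.w‖ * ‖p‖ := by
      rw [norm_sub_rev]; exact real_inner_le_norm _ _
    rw [inner_sub_left] at a1
    have a2 : ‖gradient f (s.shifted η c) - gradient f s.w‖ * ‖p‖ ≤
        L * (c / (1 - c) * η * ‖s.dir‖) * ‖p‖ := by gcongr
    linarith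
  rw [neg_smul, inner_neg_right, inner_smul_right, norm_neg, norm_smul,
    Real.norm_of_nonneg (by positivity)] at h1
  set X := ‖s.dir‖
  set X' := ‖s'.dir‖
  have hX : 0 ≤ X := norm_nonneg _
  have hX' : 0 ≤ X' := norm_nonneg _
  have h4 : inner ℝ (gradient f s.w) p ≤ (1 - c) / η * (f (s.shifted η c) - f (s'.shifted η c))
      + L * (c / (1 - c) * η * X) * ‖p‖ + L * η / (2 * (1 - c)) * ‖p‖ ^ 2 := by
    have a3 : η / (1 - c) * inner ℝ (gradient f s.w) p ≤
        f (s.shifted η c) - f (s'.shifted η c)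
          + η / (1 - c) * (L * (c / (1 - c) * η * X) * ‖p‖)
          + L / 2 * (η / (1 - c) * ‖p‖) ^ 2 := by
      have : η / (1 - c) * (-inner ℝ (gradient f (s.shifted η c)) p) ≤ η / (1 - c) *
        (-inner ℝ (gradient f s.w) p + L * (c / (1 - c) * η * X) * ‖p‖) := by gcongr
      linarith
    have a4 : inner ℝ (gradient f s.w) p =
        (1 - c) / η * (η / (1 - c) * inner ℝ (gradient f s.w) p) := by field_simp
    rw [a4]
    refine (mul_le_mul_of_nonneg_left a3 (by positivity)).trans (le_of_eq ?_)
    field_simp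
  have h5 : L * (c / (1 - c) * η * X) * ‖p‖ + L * η / (2 * (1 - c)) * ‖p‖ ^ 2 ≤
      L * (c / (1 - c) * η * X) * (X' + c * X) + L * η / (2 * (1 - c)) * (X' + c * X) ^ 2 := by
    gcongr
  have h6 : L * (c / (1 - c) * η * X) * (X' + c * X) + L * η / (2 * (1 - c)) * (X' + c * X) ^ 2
      = L * η / (1 - c) * (c * X * (X' + c * X) + (X' + c * X) ^ 2 / 2) := by
    field_simp
  have h7 : c * X * (X' + c * X) + (X' + c * X) ^ 2 / 2 ≤ (1 + c) ^ 2 * (X ^ 2 + X' ^ 2) := by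
    nlinarith [mul_nonneg hc (sq_nonneg (X - X')), sq_nonneg X, sq_nonneg X',
      mul_nonneg hc (sq_nonneg X), mul_nonneg hc (sq_nonneg X'),
      mul_nonneg (mul_nonneg hc hc1.le) (sq_nonneg X), mul_nonneg (sq_nonneg c) (sq_nonneg X')]
  have h8 : L * η / (1 - c) * (c * X * (X' + c * X) + (X' + c * X) ^ 2 / 2) ≤
      L * η / (1 - c) * ((1 + c) ^ 2 * (X ^ 2 + X' ^ 2)) := by gcongr
  have h9 : L * η / (1 - c) * ((1 + c) ^ 2 * (X ^ 2 + X' ^ 2)) =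
    L * η * (1 + c) ^ 2 / (1 - c) * (X ^ 2 + X' ^ 2) := by ring
  linarith

theorem sum_inner_descent (hf : IsSmoothObjective L f) (hL : 0 ≤ L) (hη : 0 < η) (hc : 0 ≤ c)
    (hc' : c < 1) {β₁ : ℝ} (hs : ∀ n, s (n + 1) = adamStep η β₁ β₂ (s n) (g n)) (N : ℕ) :
    ∑ n ∈ Finset.range N, inner ℝ (gradient f (s n).w) ((s (n + 1)).dir - c • (s n).dir) ≤
      (1 - c) / η * f ((s 0).shifted η c)
        + 2 * (L * η * (1 + c) ^ 2 / (1 - c)) * ∑ n ∈ Finset.range (N + 1), ‖(s n).dir‖ ^ 2 := by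
  have hc1 : 0 < 1 - c := by linarith
  have h1 : ∀ n ∈ Finset.range N,
      inner ℝ (gradient f (s n).w) ((s (n + 1)).dir - c • (s n).dir) ≤
      (1 - c) / η * (f ((s n).shifted η c) - f ((s (n + 1)).shifted η c))
        + L * η * (1 + c) ^ 2 / (1 - c) * (‖(s n).dir‖ ^ 2 + ‖(s (n + 1)).dir‖ ^ 2) :=
    fun n _ => by rw [hs]; exact inner_descent_step hf hL hη hc hc' _ _
  refine (Finset.sum_le_sum h1).trans ?_
  rw [Finset.sum_add_distrib, ← Finset.mul_sum, ← Finset.mul_sum, Finset.sum_range_sub',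
    Finset.sum_add_distrib]
  have h2 := Finset.sum_range_succ (fun n => ‖(s n).dir‖ ^ 2) N
  have h3 := Finset.sum_range_succ' (fun n => ‖(s n).dir‖ ^ 2) N
  have h4 : 0 ≤ (1 - c) / η * f ((s N).shifted η c) := mul_nonneg (by positivity) (hf.nonneg _)
  -- Each direction is met in at most two consecutive steps.
  have h5 : L * η * (1 + c) ^ 2 / (1 - c) * (∑ n ∈ Finset.range N, ‖(s n).dir‖ ^ 2 +
      ∑ n ∈ Finset.range N, ‖(s (n + 1)).dir‖ ^ 2) ≤ L * η * (1 + c) ^ 2 / (1 - c) *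
      (2 * ∑ n ∈ Finset.range (N + 1), ‖(s n).dir‖ ^ 2) := by
    gcongr
    nlinarith [sq_nonneg ‖(s N).dir‖, sq_nonneg ‖(s 0).dir‖]
  nlinarith

/-- The reciprocal root of the predictable part of the conditioner. -/
def AdamState.weight (β₂ : ℝ) (s : AdamState d) (i : Fin d) : ℝ := 1 / √(β₂ * s.ν i)

/-- The pathwise bound behind the convergence of Adam: it is linear in the stochastic gradients and
in their squares, with predictable coefficients. -/
theorem pathwise_bound {σ₀ σ₁ C ε δ ρ : ℝ} (hf : IsSmoothObjective L f) (hL : 0 ≤ L) (hη : 0 < η)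
    (hc : 0 ≤ c) (hc' : c < 1) (hβ : 0 < β₂) (hβ' : β₂ < 1) (hσ₀ : 0 < σ₀)
    (hs : ∀ n, s (n + 1) = adamStep η (c * √β₂) β₂ (s n) (g n)) (h0 : ∀ i, 0 < (s 0).ν i)
    (hC0 : ∀ i, |(s 0).m i / √((s 0).ν i)| ≤ C) (hC : 1 / (1 - c) ≤ C) (hε : 0 < ε)
    (hδ : 0 < δ) (hδ1 : 2 * δ ≤ 1) (hκδ : 1 - √β₂ ≤ δ) {N : ℕ}
    (hρ : ∀ n ≤ N, ∀ i, (s n).weight β₂ i ≤ ρ) :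
    ∑ n ∈ Finset.range N, ∑ i, (1 - c * √β₂) *
        ((gradient f (s n).w i * (s n).weight β₂ i) * g n i) ≤
      (1 - c) / η * f ((s 0).shifted η c)
      + ∑ n ∈ Finset.range N, ∑ i, ε * ((gradient f (s n).w i) ^ 2 /
          (σ₀ ^ 2 + σ₁ ^ 2 * (gradient f (s n).w i) ^ 2) * (s n).weight β₂ i) * g n i ^ 2
      + C ^ 2 / (4 * ε) * (ρ * (d * σ₀ ^ 2 + σ₁ ^ 2 * ‖gradient f (s 0).w‖ ^ 2)
        + d * (N * (1 - √β₂) * σ₀ ^ 2 * ρ)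
        + 2 * δ * σ₁ ^ 2 * ∑ n ∈ Finset.range N, ∑ i,
            (gradient f (s n).w i) ^ 2 * (s n).weight β₂ i
        + σ₁ ^ 2 / δ * ρ * (L ^ 2 * η ^ 2) * ∑ n ∈ Finset.range (N + 1), ‖(s n).dir‖ ^ 2)
      + 2 * (L * η * (1 + c) ^ 2 / (1 - c)) * ∑ n ∈ Finset.range (N + 1), ‖(s n).dir‖ ^ 2 := by
  have hc1 : 0 < 1 - c := by linarith
  have hCpos : 0 < C := lt_of_lt_of_le (by positivity) hC
  have hν : ∀ i n, (s (n + 1)).ν i = β₂ * (s n).ν i + (1 - β₂) * g n i ^ 2 := fun i n => by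
    rw [hs]; rfl
  have hm : ∀ i n, (s (n + 1)).m i = c * √β₂ * (s n).m i + (1 - c * √β₂) * g n i := fun i n => by
    rw [hs]; rfl
  have hpos : ∀ i n, 0 < (s n).ν i := fun i n =>
    conditioner_pos (ν := fun n => (s n).ν i) hβ hβ' (h0 i) (hν i) n
  have hw0 : ∀ n i, 0 ≤ (s n).weight β₂ i := fun n i => by
    rw [AdamState.weight]; positivity
  have hκ : 0 < √β₂ := Real.sqrt_pos.2 hβ
  have hκ1 : √β₂ ≤ 1 := Real.sqrt_le_one.2 hβ'.le
  -- Up to `√β₂`, the reciprocal root after a step is the next predictable weight, so the gaps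
  -- almost telescope.
  have hnext : ∀ n i, 1 / √((s (n + 1)).ν i) = √β₂ * (s (n + 1)).weight β₂ i := fun n i => by
    have := Real.sqrt_pos.2 (hpos i (n + 1))
    rw [AdamState.weight, Real.sqrt_mul hβ.le]
    field_simp
  have hcoord : ∀ n i, (1 - c * √β₂) * ((gradient f (s n).w i * (s n).weight β₂ i) * g n i) ≤
      gradient f (s n).w i * ((s (n + 1)).dir i - c * (s n).dir i)
      + (ε * ((gradient f (s n).w i) ^ 2 /
          (σ₀ ^ 2 + σ₁ ^ 2 * (gradient f (s n).w i) ^ 2) * (s n).weight β₂ i) * g n i ^ 2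
        + C ^ 2 / (4 * ε) * ((σ₀ ^ 2 + σ₁ ^ 2 * (gradient f (s n).w i) ^ 2) *
          ((s n).weight β₂ i - √β₂ * (s (n + 1)).weight β₂ i))) := by
    intro n i
    -- `H` is the oracle's second-moment bound at this iterate, so that dividing by it neutralises
    -- the expectation of `g²`.
    have h1 := mul_inv_sqrt_sub_le (G := gradient f (s n).w i) (m := (s (n + 1)).m i)
      (H := σ₀ ^ 2 + σ₁ ^ 2 * (gradient f (s n).w i) ^ 2) (mul_pos hβ (hpos i n))
      (sub_pos.2 hβ') (hν i n) (by positivity) hε hCpos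
      (sqrt_mul_abs_momentum_div_le (ν := fun n => (s n).ν i) (m := fun n => (s n).m i)
        hβ hβ' hc hc' (h0 i) (hν i) (hm i) (hC0 i) hC (n + 1))
    -- Here `β₁ = c √β₂` is essential: `c m / √ν = c √β₂ m / √(β₂ ν)` cancels the old momentum
    -- inside the new one.
    have e1 : (s (n + 1)).dir i - c * (s n).dir i =
        (1 - c * √β₂) * ((s n).weight β₂ i * g n i)
          - (s (n + 1)).m i * (1 / √(β₂ * (s n).ν i) - 1 / √((s (n + 1)).ν i)) := by
      have a1 := Real.sqrt_pos.2 (hpos i (n + 1))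
      have a2 := Real.sqrt_pos.2 (hpos i n)
      rw [AdamState.dir_apply, AdamState.dir_apply, AdamState.weight, Real.sqrt_mul hβ.le]
      have : (s (n + 1)).m i / √((s (n + 1)).ν i) = (s (n + 1)).m i * (1 / √((s (n + 1)).ν i)) := by
        ring
      rw [this, mul_sub, sub_sub_eq_add_sub, hm]
      field_simp
      ring
    have e2 : (1 : ℝ) / √(β₂ * (s n).ν i) = (s n).weight β₂ i := rfl
    rw [hnext, e2] at h1 e1
    rw [e1]
    have e3 : (gradient f (s n).w i) ^ 2 / (σ₀ ^ 2 + σ₁ ^ 2 * (gradient f (s n).w i) ^ 2) /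
        √(β₂ * (s n).ν i) = (gradient f (s n).w i) ^ 2 /
          (σ₀ ^ 2 + σ₁ ^ 2 * (gradient f (s n).w i) ^ 2) * (s n).weight β₂ i := by
      rw [AdamState.weight]; ring
    rw [e3] at h1
    linarith
  have hsum : ∑ n ∈ Finset.range N, ∑ i, (1 - c * √β₂) *
        ((gradient f (s n).w i * (s n).weight β₂ i) * g n i) ≤ _ :=
    Finset.sum_le_sum fun n _ => Finset.sum_le_sum fun i _ => hcoord n i
  simp only [Finset.sum_add_distrib, ← Finset.mul_sum] at hsum
  have hinner : ∀ n, ∑ i, gradient f (s n).w i * ((s (n + 1)).dir i - c * (s n).dir i) =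
      inner ℝ (gradient f (s n).w) ((s (n + 1)).dir - c • (s n).dir) := fun n => by
    rw [PiLp.inner_apply]
    refine Finset.sum_congr rfl fun i _ => ?_
    simp [mul_comm]
  simp only [hinner] at hsum
  have hdesc := sum_inner_descent hf hL hη hc hc' hs N
  have htel : ∀ i, _ := fun i => sum_affine_mul_sub_le (G := fun n => gradient f (s n).w i)
    (r := fun n => (s n).weight β₂ i) (σ₀ := σ₀) (σ₁ := σ₁) (N := N) hκ.le hκ1 hδ hδ1 hκδ
    (fun n => hw0 n i) (fun n hn => hρ n hn i)
  have htel' := Finset.sum_le_sum fun i (_ : i ∈ Finset.univ) => htel i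
  rw [Finset.sum_comm] at htel'
  simp only [Finset.sum_add_distrib, ← Finset.mul_sum] at htel'
  rw [Finset.sum_comm (f := fun i n => (gradient f (s n).w i) ^ 2 * (s n).weight β₂ i),
    Finset.sum_comm (f := fun i n => (gradient f (s (n + 1)).w i - gradient f (s n).w i) ^ 2)]
    at htel'
  simp only [Finset.sum_const, Finset.card_univ, Fintype.card_fin, nsmul_eq_mul] at htel'
  have hnorm : ∑ i, gradient f (s 0).w i ^ 2 = ‖gradient f (s 0).w‖ ^ 2 := by
    rw [EuclideanSpace.norm_sq_eq]; simp
  rw [hnorm] at htel'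
  have hdiff : ∑ n ∈ Finset.range N, ∑ i, (gradient f (s (n + 1)).w i - gradient f (s n).w i) ^ 2 ≤
      L ^ 2 * η ^ 2 * ∑ n ∈ Finset.range (N + 1), ‖(s n).dir‖ ^ 2 := by
    rw [Finset.sum_range_succ', mul_add, Finset.mul_sum]
    have h1 : ∑ n ∈ Finset.range N,
        ∑ i, (gradient f (s (n + 1)).w i - gradient f (s n).w i) ^ 2 ≤
        ∑ n ∈ Finset.range N, L ^ 2 * η ^ 2 * ‖(s (n + 1)).dir‖ ^ 2 := by
      refine Finset.sum_le_sum fun n _ => ?_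
      have h2 := hf.lipschitz (s (n + 1)).w (s n).w
      have h3 : (s (n + 1)).w - (s n).w = -(η • (s (n + 1)).dir) := by
        rw [hs, adamStep_w]; abel
      rw [h3, norm_neg, norm_smul, Real.norm_of_nonneg hη.le] at h2
      have h4 : ∑ i, (gradient f (s (n + 1)).w i - gradient f (s n).w i) ^ 2 =
          ‖gradient f (s (n + 1)).w - gradient f (s n).w‖ ^ 2 := by
        rw [EuclideanSpace.norm_sq_eq]; simp
      rw [h4]
      refine (pow_le_pow_left₀ (norm_nonneg _) h2 2).trans (le_of_eq (by ring))
    have : 0 ≤ L ^ 2 * η ^ 2 * ‖(s 0).dir‖ ^ 2 := by positivity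
    linarith
  -- Without coordinates nothing forces `ρ ≥ 0`, so this case is separate.
  rcases Nat.eq_zero_or_pos d with rfl | hd
  · have hX : ∀ n, ‖(s n).dir‖ = 0 := fun n => by rw [Subsingleton.elim (s n).dir 0, norm_zero]
    have hG : ∀ n, ‖gradient f (s n).w‖ = 0 := fun n => by
      rw [Subsingleton.elim (gradient f (s n).w) 0, norm_zero]
    simp [hX, hG]
    exact mul_nonneg (by positivity) (hf.nonneg _)
  have hρ0 : 0 ≤ ρ := (hw0 0 ⟨0, hd⟩).trans (hρ 0 (Nat.zero_le _) _)
  have h5 : σ₁ ^ 2 / δ * ρ * ∑ n ∈ Finset.range N,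
      ∑ i, (gradient f (s (n + 1)).w i - gradient f (s n).w i) ^ 2 ≤
      σ₁ ^ 2 / δ * ρ * (L ^ 2 * η ^ 2 * ∑ n ∈ Finset.range (N + 1), ‖(s n).dir‖ ^ 2) := by gcongr
  have h6 : C ^ 2 / (4 * ε) * ∑ n ∈ Finset.range N, ∑ i,
      (σ₀ ^ 2 + σ₁ ^ 2 * gradient f (s n).w i ^ 2) *
        ((s n).weight β₂ i - √β₂ * (s (n + 1)).weight β₂ i) ≤ C ^ 2 / (4 * ε) *
      (ρ * (d * σ₀ ^ 2 + σ₁ ^ 2 * ‖gradient f (s 0).w‖ ^ 2)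
        + d * (N * (1 - √β₂) * σ₀ ^ 2 * ρ)
        + 2 * δ * σ₁ ^ 2 * ∑ n ∈ Finset.range N, ∑ i,
            (gradient f (s n).w i) ^ 2 * (s n).weight β₂ i
        + σ₁ ^ 2 / δ * ρ * (L ^ 2 * η ^ 2) * ∑ n ∈ Finset.range (N + 1), ‖(s n).dir‖ ^ 2) := by
    gcongr
    linarith
  simp only [← Finset.mul_sum] at *
  linarith

end Run

/-! ### Expectation over one sample by resampling -/

section Resampling

variable {Z : Type u} [MeasurableSpace Z] {P : Measure Z}

variable {d : ℕ} {σ₀ σ₁ : ℝ} {f : EuclideanSpace ℝ (Fin d) → ℝ}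
  {O : EuclideanSpace ℝ (Fin d) → Z → EuclideanSpace ℝ (Fin d)}
  {V : (ℕ → Z) → EuclideanSpace ℝ (Fin d)} {φ : (ℕ → Z) → ℝ} {k : ℕ}

theorem IsUnbiasedOracle.measurable_comp (hO : IsUnbiasedOracle P f O) (hV : Measurable V)
    (i : Fin d) : Measurable fun z => O (V z) (z k) i :=
  (EuclideanSpace.proj (𝕜 := ℝ) i).continuous.measurable.comp
    (hO.measurable.comp (hV.prodMk (measurable_pi_apply k)))

theorem IsUnbiasedOracle.measurable_prod (hO : IsUnbiasedOracle P f O) (hV : Measurable V)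
    (i : Fin d) : Measurable fun p : (ℕ → Z) × Z => O (V p.1) p.2 i :=
  (EuclideanSpace.proj (𝕜 := ℝ) i).continuous.measurable.comp
    (hO.measurable.comp ((hV.comp measurable_fst).prodMk measurable_snd))

variable [IsProbabilityMeasure P]

/-- Resampling one coordinate preserves an infinite product measure. -/
theorem measurePreserving_update_infinitePi (k : ℕ) :
    MeasurePreserving (fun p : (ℕ → Z) × Z => Function.update p.1 k p.2)
      ((Measure.infinitePi fun _ : ℕ => P).prod P) (Measure.infinitePi fun _ : ℕ => P) := by
  have hmeas : Measurable (fun p : (ℕ → Z) × Z => Function.update p.1 k p.2) := by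
    refine measurable_pi_iff.2 fun j => ?_
    by_cases h : j = k
    · subst h; simpa using measurable_snd
    · simpa [Function.update_of_ne h, Function.comp_def] using
        (measurable_pi_apply j).comp (measurable_fst (α := ℕ → Z) (β := Z))
  refine ⟨hmeas, Measure.eq_infinitePi _ fun s t ht => ?_⟩
  rw [Measure.map_apply hmeas (MeasurableSet.pi s.countable_toSet fun i _ => ht i)]
  -- The preimage of a box is a box: the constraint on coordinate `k`, if any, moves to the fresh
  -- sample.
  have hpre : (fun p : (ℕ → Z) × Z => Function.update p.1 k p.2) ⁻¹' (s : Set ℕ).pi t =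
      ((s.erase k : Finset ℕ) : Set ℕ).pi t ×ˢ (if k ∈ s then t k else Set.univ) := by
    ext p
    simp only [Set.mem_preimage, Set.mem_pi, Set.mem_prod, Finset.mem_coe, Finset.mem_erase]
    constructor
    · intro h
      refine ⟨fun i hi => by simpa [Function.update_of_ne hi.1] using h i hi.2, ?_⟩
      split_ifs with hk
      · simpa using h k hk
      · trivial
    · rintro ⟨h1, h2⟩ i hi
      by_cases hik : i = k
      · subst hik; simpa [hi] using h2
      · simpa [Function.update_of_ne hik] using h1 i ⟨hik, hi⟩
  rw [hpre, Measure.prod_prod, Measure.infinitePi_pi _ fun i _ => ht i]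
  split_ifs with hk
  · rw [Finset.prod_erase_mul s (fun i => P (t i)) hk]
  · rw [measure_univ, mul_one, Finset.erase_eq_of_notMem hk]

/-- After resampling coordinate `k`, the inner integral is a second moment at the fixed point `V z`,
bounded through `R`. -/
theorem integrable_oracle_sq (hO : IsAffineVarianceOracle σ₀ σ₁ P f O) (hV : Measurable V)
    (hVk : ∀ z ζ, V (Function.update z k ζ) = V z) {R : ℝ}
    (hR : ∀ z, ‖gradient f (V z)‖ ≤ R) (i : Fin d) :
    Integrable (fun z => O (V z) (z k) i ^ 2) (Measure.infinitePi fun _ : ℕ => P) := by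
  rw [← (measurePreserving_update_infinitePi (P := P) k).integrable_comp
    ((hO.measurable_comp hV i).pow_const 2).aestronglyMeasurable]
  have e : (fun z => O (V z) (z k) i ^ 2) ∘ (fun p : (ℕ → Z) × Z => Function.update p.1 k p.2) =
      fun p => O (V p.1) p.2 i ^ 2 := by
    funext p; simp [hVk]
  rw [e]
  have hmeas := ((hO.measurable_prod hV i).pow_const 2).aestronglyMeasurable
    (μ := (Measure.infinitePi fun _ : ℕ => P).prod P)
  rw [integrable_prod_iff hmeas]
  refine ⟨Filter.Eventually.of_forall fun z => hO.sq_integrable (V z) i, ?_⟩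
  refine Integrable.of_bound (C := σ₀ ^ 2 + σ₁ ^ 2 * R ^ 2)
    (hmeas.norm.integral_prod_right') (Filter.Eventually.of_forall fun z => ?_)
  have h1 : ∀ ζ, ‖O (V z) ζ i ^ 2‖ = O (V z) ζ i ^ 2 := fun ζ =>
    Real.norm_of_nonneg (sq_nonneg _)
  simp only [h1]
  rw [Real.norm_of_nonneg (integral_nonneg fun _ => sq_nonneg _)]
  refine (hO.second_moment_le (V z) i).trans ?_
  have h2 : gradient f (V z) i ^ 2 ≤ R ^ 2 := by
    rw [← sq_abs]
    exact pow_le_pow_left₀ (abs_nonneg _) ((PiLp.norm_apply_le (gradient f (V z)) i).trans (hR z)) 2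
  gcongr

theorem integrable_oracle (hO : IsAffineVarianceOracle σ₀ σ₁ P f O) (hV : Measurable V)
    (hVk : ∀ z ζ, V (Function.update z k ζ) = V z) {R : ℝ}
    (hR : ∀ z, ‖gradient f (V z)‖ ≤ R) (i : Fin d) :
    Integrable (fun z => O (V z) (z k) i) (Measure.infinitePi fun _ : ℕ => P) := by
  refine ((integrable_oracle_sq hO hV hVk hR i).add (integrable_const (1 : ℝ))).mono'
    (hO.measurable_comp hV i).aestronglyMeasurable (Filter.Eventually.of_forall fun z => ?_)
  simp only [Pi.add_apply, Real.norm_eq_abs]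
  rw [← sq_abs]
  nlinarith [sq_nonneg (|O (V z) (z k) i| - 1), abs_nonneg (O (V z) (z k) i)]

/-- Does the work of a conditional expectation: `V` and `φ` ignore coordinate `k`, so after
resampling it Fubini integrates the oracle alone, and unbiasedness applies. -/
theorem integral_mul_oracle (hO : IsAffineVarianceOracle σ₀ σ₁ P f O) (hV : Measurable V)
    (hVk : ∀ z ζ, V (Function.update z k ζ) = V z) {R B : ℝ}
    (hR : ∀ z, ‖gradient f (V z)‖ ≤ R) (hφ : Measurable φ)
    (hφk : ∀ z ζ, φ (Function.update z k ζ) = φ z) (hB : ∀ z, |φ z| ≤ B) (i : Fin d) :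
    ∫ z, φ z * O (V z) (z k) i ∂(Measure.infinitePi fun _ : ℕ => P) =
      ∫ z, φ z * gradient f (V z) i ∂(Measure.infinitePi fun _ : ℕ => P) := by
  have hmp := measurePreserving_update_infinitePi (P := P) k
  have hint : Integrable (fun z => φ z * O (V z) (z k) i) (Measure.infinitePi fun _ : ℕ => P) :=
    (integrable_oracle hO hV hVk hR i).bdd_mul hφ.aestronglyMeasurable
      (Filter.Eventually.of_forall hB)
  have e : (fun z => φ z * O (V z) (z k) i) ∘
      (fun p : (ℕ → Z) × Z => Function.update p.1 k p.2) =
      fun p => φ p.1 * O (V p.1) p.2 i := by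
    funext p; simp [hVk, hφk]
  have hint' := hmp.integrable_comp_of_integrable hint
  have h1 : ∫ z, φ z * O (V z) (z k) i ∂(Measure.infinitePi fun _ : ℕ => P) =
      ∫ p, ((fun z => φ z * O (V z) (z k) i) ∘
      (fun p : (ℕ → Z) × Z => Function.update p.1 k p.2)) p
        ∂((Measure.infinitePi fun _ : ℕ => P).prod P) := by
    conv_lhs => rw [← hmp.map_eq]
    rw [integral_map hmp.measurable.aemeasurable (by rw [hmp.map_eq]; exact hint.1)]
    rfl
  rw [h1, e]
  rw [e] at hint'
  rw [integral_prod _ hint']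
  refine integral_congr_ae (Filter.Eventually.of_forall fun z => ?_)
  simp only
  rw [integral_const_mul, ← hO.unbiased]
  congr 1
  exact ((EuclideanSpace.proj (𝕜 := ℝ) i).integral_comp_comm (hO.integrable (V z)))

theorem integral_mul_oracle_sq_le (hO : IsAffineVarianceOracle σ₀ σ₁ P f O) (hV : Measurable V)
    (hf : Continuous (gradient f))
    (hVk : ∀ z ζ, V (Function.update z k ζ) = V z) {R B : ℝ}
    (hR : ∀ z, ‖gradient f (V z)‖ ≤ R) (hφ : Measurable φ)
    (hφk : ∀ z ζ, φ (Function.update z k ζ) = φ z) (hφ0 : ∀ z, 0 ≤ φ z)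
    (hB : ∀ z, φ z ≤ B) (i : Fin d) :
    ∫ z, φ z * O (V z) (z k) i ^ 2 ∂(Measure.infinitePi fun _ : ℕ => P) ≤
      ∫ z, φ z * (σ₀ ^ 2 + σ₁ ^ 2 * gradient f (V z) i ^ 2)
        ∂(Measure.infinitePi fun _ : ℕ => P) := by
  have hmp := measurePreserving_update_infinitePi (P := P) k
  have hB' : ∀ z, ‖φ z‖ ≤ B := fun z => by rw [Real.norm_of_nonneg (hφ0 z)]; exact hB z
  have hint : Integrable (fun z => φ z * O (V z) (z k) i ^ 2)
      (Measure.infinitePi fun _ : ℕ => P) :=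
    (integrable_oracle_sq hO hV hVk hR i).bdd_mul hφ.aestronglyMeasurable
      (Filter.Eventually.of_forall hB')
  have e : (fun z => φ z * O (V z) (z k) i ^ 2) ∘
      (fun p : (ℕ → Z) × Z => Function.update p.1 k p.2) =
      fun p => φ p.1 * O (V p.1) p.2 i ^ 2 := by
    funext p; simp [hVk, hφk]
  have hint' := hmp.integrable_comp_of_integrable hint
  have h1 : ∫ z, φ z * O (V z) (z k) i ^ 2 ∂(Measure.infinitePi fun _ : ℕ => P) =
      ∫ p, ((fun z => φ z * O (V z) (z k) i ^ 2) ∘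
      (fun p : (ℕ → Z) × Z => Function.update p.1 k p.2)) p
        ∂((Measure.infinitePi fun _ : ℕ => P).prod P) := by
    conv_lhs => rw [← hmp.map_eq]
    rw [integral_map hmp.measurable.aemeasurable (by rw [hmp.map_eq]; exact hint.1)]
    rfl
  rw [h1, e]
  rw [e] at hint'
  rw [integral_prod _ hint']
  have hG : Measurable fun z => gradient f (V z) i :=
    (EuclideanSpace.proj (𝕜 := ℝ) i).continuous.measurable.comp (hf.measurable.comp hV)
  refine integral_mono hint'.integral_prod_left ?_ fun z => ?_
  · refine Integrable.of_bound (C := B * (σ₀ ^ 2 + σ₁ ^ 2 * R ^ 2))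
      (hφ.mul (((hG.pow_const 2).const_mul _).const_add _)).aestronglyMeasurable
      (Filter.Eventually.of_forall fun z => ?_)
    have h2 : gradient f (V z) i ^ 2 ≤ R ^ 2 := by
      rw [← sq_abs]
      exact pow_le_pow_left₀ (abs_nonneg _)
        ((PiLp.norm_apply_le (gradient f (V z)) i).trans (hR z)) 2
    rw [Real.norm_of_nonneg (mul_nonneg (hφ0 z) (by positivity))]
    have := (hφ0 z).trans (hB z)
    gcongr
    exact hB z
  · simp only
    rw [integral_const_mul]
    exact mul_le_mul_of_nonneg_left (hO.second_moment_le _ _) (hφ0 z)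

end Resampling

/-! ### Predictability, measurability and sure bounds of the iterates -/

section Trajectory

variable {d : ℕ} {Z : Type u} {f : EuclideanSpace ℝ (Fin d) → ℝ}
  {O : EuclideanSpace ℝ (Fin d) → Z → EuclideanSpace ℝ (Fin d)} {η β₁ β₂ c L : ℝ}
  {w₁ : EuclideanSpace ℝ (Fin d)} {m₀ ν₀ : Fin d → ℝ}

/-- Predictability: only the samples with index at most `n` have been used. -/
theorem adamState_update {n k : ℕ} (hnk : n < k) (z : ℕ → Z) (ζ : Z) :
    adamState O η β₁ β₂ w₁ m₀ ν₀ (Function.update z k ζ) n =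
      adamState O η β₁ β₂ w₁ m₀ ν₀ z n := by
  induction n with
  | zero => rfl
  | succ n ih =>
    rw [adamState, adamState, ih (by omega), Function.update_of_ne (by omega)]

theorem measurable_adamState [MeasurableSpace Z]
    (hO : Measurable fun p : EuclideanSpace ℝ (Fin d) × Z => O p.1 p.2) (n : ℕ) :
    (Measurable fun z => (adamState O η β₁ β₂ w₁ m₀ ν₀ z n).w) ∧
    (∀ i, Measurable fun z => (adamState O η β₁ β₂ w₁ m₀ ν₀ z n).m i) ∧
    (∀ i, Measurable fun z => (adamState O η β₁ β₂ w₁ m₀ ν₀ z n).ν i) := by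
  induction n with
  | zero => exact ⟨measurable_const, fun _ => measurable_const, fun _ => measurable_const⟩
  | succ n ih =>
    obtain ⟨hw, hm, hν⟩ := ih
    have hg : ∀ i, Measurable fun z : ℕ → Z =>
        O (adamState O η β₁ β₂ w₁ m₀ ν₀ z n).w (z (n + 1)) i := fun i =>
      (EuclideanSpace.proj (𝕜 := ℝ) i).continuous.measurable.comp
        (hO.comp (hw.prodMk (measurable_pi_apply (n + 1))))
    have hm' : ∀ i, Measurable fun z => (adamState O η β₁ β₂ w₁ m₀ ν₀ z (n + 1)).m i :=
      fun i => ((hm i).const_mul _).add ((hg i).const_mul _)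
    have hν' : ∀ i, Measurable fun z => (adamState O η β₁ β₂ w₁ m₀ ν₀ z (n + 1)).ν i :=
      fun i => ((hν i).const_mul _).add (((hg i).pow_const 2).const_mul _)
    refine ⟨?_, hm', hν'⟩
    have hwi : ∀ i, Measurable fun z => (adamState O η β₁ β₂ w₁ m₀ ν₀ z n).w i := fun i =>
      (EuclideanSpace.proj (𝕜 := ℝ) i).continuous.measurable.comp hw
    exact (PiLp.continuous_toLp 2 _).measurable.comp (measurable_pi_iff.2 fun i =>
      (hwi i).sub ((((hm' i).div (hν' i).sqrt)).const_mul _))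

theorem adamState_succ (z : ℕ → Z) (n : ℕ) :
    adamState O η β₁ β₂ w₁ m₀ ν₀ z (n + 1) = adamStep η β₁ β₂ (adamState O η β₁ β₂ w₁ m₀ ν₀ z n)
      (O (adamState O η β₁ β₂ w₁ m₀ ν₀ z n).w (z (n + 1))) := rfl

theorem adamState_nu_ge (hβ : 0 < β₂) (hβ' : β₂ < 1) (z : ℕ → Z) (n : ℕ) (i : Fin d) :
    β₂ ^ n * ν₀ i ≤ (adamState O η β₁ β₂ w₁ m₀ ν₀ z n).ν i :=
  pow_mul_le_conditioner (ν := fun n => (adamState O η β₁ β₂ w₁ m₀ ν₀ z n).ν i)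
    (g := fun n => O (adamState O η β₁ β₂ w₁ m₀ ν₀ z n).w (z (n + 1)) i) hβ hβ' (fun _ => rfl) n

theorem adamState_weight_le (hβ : 0 < β₂) (hβ' : β₂ < 1) (hν₀ : ∀ i, 0 < ν₀ i) (z : ℕ → Z)
    (n : ℕ) (i : Fin d) :
    (adamState O η β₁ β₂ w₁ m₀ ν₀ z n).weight β₂ i ≤ 1 / √(β₂ ^ (n + 1) * ν₀ i) := by
  have := hν₀ i
  refine one_div_le_one_div_of_le (by positivity) (Real.sqrt_le_sqrt ?_)
  rw [pow_succ', mul_assoc]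
  exact mul_le_mul_of_nonneg_left (adamState_nu_ge hβ hβ' z n i) hβ.le

theorem weight_nonneg (z : ℕ → Z) (n : ℕ) (i : Fin d) :
    0 ≤ (adamState O η β₁ β₂ w₁ m₀ ν₀ z n).weight β₂ i := by
  rw [AdamState.weight]; positivity

theorem sq_norm_dir_le {C : ℝ} (hβ : 0 < β₂) (hβ' : β₂ < 1) (hc : 0 ≤ c) (hc' : c < 1)
    (hν₀ : ∀ i, 0 < ν₀ i) (hC0 : ∀ i, |m₀ i / √(ν₀ i)| ≤ C) (hC : 1 / (1 - c) ≤ C) (z : ℕ → Z)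
    (n : ℕ) :
    ‖(adamState O η (c * √β₂) β₂ w₁ m₀ ν₀ z n).dir‖ ^ 2 ≤ d * (C ^ 2 / (1 - β₂)) := by
  have hb : 0 < 1 - β₂ := by linarith
  rw [EuclideanSpace.norm_sq_eq]
  calc _ ≤ ∑ _i : Fin d, C ^ 2 / (1 - β₂) := Finset.sum_le_sum fun i _ => by
        have h1 := sqrt_mul_abs_momentum_div_le
          (ν := fun n => (adamState O η (c * √β₂) β₂ w₁ m₀ ν₀ z n).ν i)
          (m := fun n => (adamState O η (c * √β₂) β₂ w₁ m₀ ν₀ z n).m i)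
          (g := fun n => O (adamState O η (c * √β₂) β₂ w₁ m₀ ν₀ z n).w (z (n + 1)) i)
          hβ hβ' hc hc' (hν₀ i) (fun _ => rfl) (fun _ => rfl) (hC0 i) hC n
        rw [le_div_iff₀ hb]
        have h2 := pow_le_pow_left₀ (by positivity) h1 2
        rw [mul_pow, Real.sq_sqrt hb.le] at h2
        rw [mul_comm]
        exact h2
    _ = _ := by simp

/-- Supplies a bound `C` for the scaled directions that depends on `c`, `m₀` and `ν₀` only, hence
not on `T`. -/
theorem abs_dir_le_of_sum (hc' : c < 1) :
    (∀ i, |m₀ i / √(ν₀ i)| ≤ 1 / (1 - c) + ∑ i, |m₀ i / √(ν₀ i)|) ∧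
      1 / (1 - c) ≤ 1 / (1 - c) + ∑ i, |m₀ i / √(ν₀ i)| := by
  have hc1 : 0 < 1 - c := by linarith
  refine ⟨fun i => ?_, le_add_of_nonneg_right (Finset.sum_nonneg fun _ _ => abs_nonneg _)⟩
  have := Finset.single_le_sum (f := fun i => |m₀ i / √(ν₀ i)|) (fun _ _ => abs_nonneg _)
    (Finset.mem_univ i)
  have : 0 < 1 / (1 - c) := by positivity
  linarith

/-- Steps have surely bounded length, so gradients along the run are bounded for each fixed `n`. The
bound grows with `n`; it serves integrability only and enters no final constant. -/
theorem exists_gradient_bound (hf : IsSmoothObjective L f) (hL : 0 ≤ L) (hη : 0 ≤ η)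
    (hβ : 0 < β₂) (hβ' : β₂ < 1) (hc : 0 ≤ c) (hc' : c < 1) (hν₀ : ∀ i, 0 < ν₀ i) (n : ℕ) :
    ∃ R, ∀ z : ℕ → Z, ‖gradient f (adamState O η (c * √β₂) β₂ w₁ m₀ ν₀ z n).w‖ ≤ R := by
  obtain ⟨hC0, hC⟩ := abs_dir_le_of_sum (m₀ := m₀) (ν₀ := ν₀) hc'
  set C := 1 / (1 - c) + ∑ i, |m₀ i / √(ν₀ i)|
  induction n with
  | zero => exact ⟨‖gradient f w₁‖, fun _ => le_rfl⟩
  | succ n ih =>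
    obtain ⟨R, hR⟩ := ih
    refine ⟨R + L * (η * √(d * (C ^ 2 / (1 - β₂)))), fun z => ?_⟩
    have h1 := hf.lipschitz (adamState O η (c * √β₂) β₂ w₁ m₀ ν₀ z (n + 1)).w
      (adamState O η (c * √β₂) β₂ w₁ m₀ ν₀ z n).w
    have h2 := Real.le_sqrt_of_sq_le (sq_norm_dir_le (O := O) (η := η) (w₁ := w₁)
      hβ hβ' hc hc' hν₀ hC0 hC z (n + 1))
    have h3 : (adamState O η (c * √β₂) β₂ w₁ m₀ ν₀ z (n + 1)).w -
        (adamState O η (c * √β₂) β₂ w₁ m₀ ν₀ z n).w =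
        -(η • (adamState O η (c * √β₂) β₂ w₁ m₀ ν₀ z (n + 1)).dir) := by
      rw [adamState_succ, adamStep_w]; abel
    rw [h3, norm_neg, norm_smul, Real.norm_of_nonneg hη] at h1
    have h4 : L * (η * ‖(adamState O η (c * √β₂) β₂ w₁ m₀ ν₀ z (n + 1)).dir‖) ≤
      L * (η * √(d * (C ^ 2 / (1 - β₂)))) := by gcongr
    have h5 := norm_le_norm_add_norm_sub (gradient f (adamState O η (c * √β₂) β₂ w₁ m₀ ν₀ z n).w)
      (gradient f (adamState O η (c * √β₂) β₂ w₁ m₀ ν₀ z (n + 1)).w)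
    rw [norm_sub_rev] at h5
    linarith [hR z]

end Trajectory

/-! ### The pathwise bounds in expectation -/

section Expectation

variable {d : ℕ} {Z : Type u} [MeasurableSpace Z] {P : Measure Z}
  {f : EuclideanSpace ℝ (Fin d) → ℝ} {O : EuclideanSpace ℝ (Fin d) → Z → EuclideanSpace ℝ (Fin d)}
  {η β₂ c L σ₀ σ₁ : ℝ} {w₁ : EuclideanSpace ℝ (Fin d)} {m₀ ν₀ : Fin d → ℝ}

local notation "St" => adamState O η (c * √β₂) β₂ w₁ m₀ ν₀
local notation "μ∞" => (Measure.infinitePi fun _ : ℕ => P)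

theorem measurable_weight (hO : IsAffineVarianceOracle σ₀ σ₁ P f O) (n : ℕ) (i : Fin d) :
    Measurable fun z => (St z n).weight β₂ i :=
  (((measurable_adamState hO.measurable n).2.2 i).const_mul β₂).sqrt.const_div 1

theorem measurable_gradient_iterate (hO : IsAffineVarianceOracle σ₀ σ₁ P f O)
    (hf : IsSmoothObjective L f) (n : ℕ) (i : Fin d) :
    Measurable fun z => gradient f (St z n).w i :=
  (EuclideanSpace.proj (𝕜 := ℝ) i).continuous.measurable.comp
    (hf.continuous_gradient.measurable.comp (measurable_adamState hO.measurable n).1)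

variable [IsProbabilityMeasure P]

theorem integrable_sq_mul_weight (hO : IsAffineVarianceOracle σ₀ σ₁ P f O)
    (hf : IsSmoothObjective L f) (hL : 0 ≤ L) (hη : 0 ≤ η)
    (hβ : 0 < β₂) (hβ' : β₂ < 1) (hc : 0 ≤ c) (hc' : c < 1) (hν₀ : ∀ i, 0 < ν₀ i) (n : ℕ)
    (i : Fin d) :
    Integrable (fun z => gradient f (St z n).w i ^ 2 * (St z n).weight β₂ i) μ∞ := by
  obtain ⟨R, hR⟩ := exists_gradient_bound (O := O) (w₁ := w₁) (m₀ := m₀) hf hL hη hβ hβ' hc hc' hν₀ n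
  refine Integrable.of_bound (C := R ^ 2 * (1 / √(β₂ ^ (n + 1) * ν₀ i)))
    (((measurable_gradient_iterate hO hf n i).pow_const 2).mul
      (measurable_weight hO n i)).aestronglyMeasurable (Filter.Eventually.of_forall fun z => ?_)
  have hw := weight_nonneg (O := O) (η := η) (β₁ := c * √β₂) (β₂ := β₂) (w₁ := w₁) (m₀ := m₀)
    (ν₀ := ν₀) z n i
  rw [Real.norm_of_nonneg (by positivity)]
  have h2 : gradient f (St z n).w i ^ 2 ≤ R ^ 2 := by
    rw [← sq_abs]
    exact pow_le_pow_left₀ (abs_nonneg _)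
      ((PiLp.norm_apply_le (gradient f (St z n).w) i).trans (hR z)) 2
  have := adamState_weight_le (O := O) (η := η) (β₁ := c * √β₂) (w₁ := w₁) (m₀ := m₀) hβ hβ' hν₀ z n i
  gcongr

/-- The expected square root of the conditioner. -/
theorem integral_sqrt_conditioner_le (hO : IsAffineVarianceOracle σ₀ σ₁ P f O)
    (hf : IsSmoothObjective L f) (hL : 0 ≤ L) (hη : 0 ≤ η)
    (hβ : 0 < β₂) (hβ' : β₂ < 1) (hc : 0 ≤ c) (hc' : c < 1) (hν₀ : ∀ i, 0 < ν₀ i) (N : ℕ)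
    (i : Fin d) :
    Integrable (fun z => √((St z N).ν i)) μ∞ ∧
    ∫ z, √((St z N).ν i) ∂μ∞ ≤ √(ν₀ i + N * (1 - β₂) * σ₀ ^ 2) + (1 - β₂) / 2 * σ₁ ^ 2 *
      ∑ n ∈ Finset.range N, ∫ z, gradient f (St z n).w i ^ 2 * (St z n).weight β₂ i ∂μ∞ := by
  have hb : 0 < 1 - β₂ := by linarith
  -- The predictable tangent coefficients of `sqrt_conditioner_le`; dropping their noise part bounds
  -- them by the weights.
  let φ : ℕ → (ℕ → Z) → ℝ := fun n z =>
    1 / √(β₂ * (St z n).ν i + ((N - n : ℕ) : ℝ) * (1 - β₂) * σ₀ ^ 2)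
  have hφm : ∀ n, Measurable (φ n) := fun n =>
    ((((measurable_adamState hO.measurable n).2.2 i).const_mul β₂).add_const _).sqrt.const_div 1
  have hφ0 : ∀ n z, 0 ≤ φ n z := fun n z => by positivity
  have hνpos : ∀ n z, 0 < (St z n).ν i := fun n z =>
    lt_of_lt_of_le (mul_pos (pow_pos hβ n) (hν₀ i)) (adamState_nu_ge hβ hβ' z n i)
  have hφw : ∀ n z, φ n z ≤ (St z n).weight β₂ i := fun n z => by
    have := hνpos n z
    refine one_div_le_one_div_of_le (by positivity) (Real.sqrt_le_sqrt ?_)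
    exact le_add_of_nonneg_right (by positivity)
  have hφB : ∀ n z, φ n z ≤ 1 / √(β₂ ^ (n + 1) * ν₀ i) := fun n z =>
    (hφw n z).trans (adamState_weight_le hβ hβ' hν₀ z n i)
  have hφk : ∀ n z ζ, φ n (Function.update z (n + 1) ζ) = φ n z := fun n z ζ => by
    simp only [φ]; rw [adamState_update (Nat.lt_succ_self n)]
  have hφi : ∀ n, Integrable (φ n) μ∞ := fun n =>
    Integrable.of_bound (C := 1 / √(β₂ ^ (n + 1) * ν₀ i)) (hφm n).aestronglyMeasurable
      (Filter.Eventually.of_forall fun z => by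
        rw [Real.norm_of_nonneg (hφ0 n z)]; exact hφB n z)
  have hVk : ∀ n z ζ, (St (Function.update z (n + 1) ζ) n).w = (St z n).w := fun n z ζ => by
    rw [adamState_update (Nat.lt_succ_self n)]
  have hV : ∀ n, Measurable fun z => (St z n).w := fun n =>
    (measurable_adamState hO.measurable n).1
  have hgi : ∀ n, Integrable (fun z => φ n z * O (St z n).w (z (n + 1)) i ^ 2) μ∞ := fun n => by
    obtain ⟨R, hR⟩ := exists_gradient_bound (O := O) (w₁ := w₁) (m₀ := m₀)
      hf hL hη hβ hβ' hc hc' hν₀ n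
    exact (integrable_oracle_sq hO (hV n) (hVk n) hR i).bdd_mul (hφm n).aestronglyMeasurable
      (Filter.Eventually.of_forall fun z => by
        rw [Real.norm_of_nonneg (hφ0 n z)]; exact hφB n z)
  have hpath : ∀ z, √((St z N).ν i) ≤ √(ν₀ i + N * (1 - β₂) * σ₀ ^ 2) +
      ∑ n ∈ Finset.range N, (1 - β₂) / 2 *
        (φ n z * O (St z n).w (z (n + 1)) i ^ 2 - φ n z * σ₀ ^ 2) := fun z =>
    sqrt_conditioner_le (σ₀ := σ₀) (ν := fun n => (St z n).ν i)
      (g := fun n => O (St z n).w (z (n + 1)) i) hβ hβ' (hν₀ i) (fun _ => rfl) N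
  have hterm : ∀ n ∈ Finset.range N, Integrable (fun z => (1 - β₂) / 2 *
        (φ n z * O (St z n).w (z (n + 1)) i ^ 2 - φ n z * σ₀ ^ 2)) μ∞ := fun n _ =>
    ((hgi n).sub ((hφi n).mul_const _)).const_mul _
  have hrhs : Integrable (fun z => √(ν₀ i + N * (1 - β₂) * σ₀ ^ 2) +
      ∑ n ∈ Finset.range N, (1 - β₂) / 2 *
        (φ n z * O (St z n).w (z (n + 1)) i ^ 2 - φ n z * σ₀ ^ 2)) μ∞ :=
    (integrable_const _).add (integrable_finsetSum _ hterm)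
  have hint : Integrable (fun z => √((St z N).ν i)) μ∞ :=
    hrhs.mono' ((measurable_adamState hO.measurable N).2.2 i).sqrt.aestronglyMeasurable
      (Filter.Eventually.of_forall fun z => by
        rw [Real.norm_of_nonneg (Real.sqrt_nonneg _)]; exact hpath z)
  refine ⟨hint, (integral_mono hint hrhs hpath).trans ?_⟩
  rw [integral_add (integrable_const _) (integrable_finsetSum _ hterm),
    integral_finsetSum _ hterm, Finset.mul_sum]
  simp only [integral_const, probReal_univ, smul_eq_mul, one_mul]
  gcongr with n hn
  -- The `σ₀²` part of the second moment is cancelled by the subtracted term; only the part with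
  -- `σ₁² G²` survives.
  rw [integral_const_mul, integral_sub (hgi n) ((hφi n).mul_const _), mul_assoc]
  refine mul_le_mul_of_nonneg_left ?_ (by positivity)
  obtain ⟨R, hR⟩ := exists_gradient_bound (O := O) (w₁ := w₁) (m₀ := m₀)
    hf hL hη hβ hβ' hc hc' hν₀ n
  have h1 := integral_mul_oracle_sq_le hO (hV n) hf.continuous_gradient (hVk n) hR (hφm n)
    (hφk n) (hφ0 n) (hφB n) i
  have hφG : Integrable (fun z => φ n z * (σ₁ ^ 2 * gradient f (St z n).w i ^ 2)) μ∞ := by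
    refine ((integrable_sq_mul_weight (w₁ := w₁) (m₀ := m₀)
      hO hf hL hη hβ hβ' hc hc' hν₀ n i).const_mul (σ₁ ^ 2)).mono'
      ((hφm n).mul (((measurable_gradient_iterate hO hf n i).pow_const 2).const_mul
        _)).aestronglyMeasurable (Filter.Eventually.of_forall fun z => ?_)
    have := hφ0 n z
    rw [Real.norm_of_nonneg (by positivity)]
    calc _ ≤ (St z n).weight β₂ i * (σ₁ ^ 2 * gradient f (St z n).w i ^ 2) := by
          gcongr; exact hφw n z
      _ = _ := by ring
  simp only [mul_add] at h1
  rw [integral_add ((hφi n).mul_const _) hφG] at h1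
  have h2 : ∫ z, φ n z * (σ₁ ^ 2 * gradient f (St z n).w i ^ 2) ∂μ∞ ≤
      σ₁ ^ 2 * ∫ z, gradient f (St z n).w i ^ 2 * (St z n).weight β₂ i ∂μ∞ := by
    rw [← integral_const_mul]
    refine integral_mono hφG ((integrable_sq_mul_weight (w₁ := w₁) (m₀ := m₀)
      hO hf hL hη hβ hβ' hc hc' hν₀ n i).const_mul (σ₁ ^ 2)) fun z => ?_
    calc _ ≤ (St z n).weight β₂ i * (σ₁ ^ 2 * gradient f (St z n).w i ^ 2) := by
          gcongr; exact hφw n z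
      _ = _ := by ring
  linarith

theorem integrable_sum_sq_dir (hO : IsAffineVarianceOracle σ₀ σ₁ P f O)
    (hβ : 0 < β₂) (hβ' : β₂ < 1) (hc : 0 ≤ c) (hc' : c < 1) (hν₀ : ∀ i, 0 < ν₀ i) (N : ℕ) :
    Integrable (fun z => ∑ n ∈ Finset.range (N + 1), ‖(St z n).dir‖ ^ 2) μ∞ := by
  refine integrable_finsetSum _ fun n _ => ?_
  obtain ⟨hC0, hC⟩ := abs_dir_le_of_sum (m₀ := m₀) (ν₀ := ν₀) hc'
  have hm : Measurable fun z => (St z n).dir :=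
    (PiLp.continuous_toLp 2 _).measurable.comp (measurable_pi_iff.2 fun i =>
      ((measurable_adamState hO.measurable n).2.1 i).div
        ((measurable_adamState hO.measurable n).2.2 i).sqrt)
  refine Integrable.of_bound (hm.norm.pow_const 2).aestronglyMeasurable
    (d * ((1 / (1 - c) + ∑ i, |m₀ i / √(ν₀ i)|) ^ 2 / (1 - β₂)))
    (Filter.Eventually.of_forall fun z => ?_)
  rw [Real.norm_of_nonneg (by positivity)]
  exact sq_norm_dir_le hβ hβ' hc hc' hν₀ hC0 hC z n

/-- A tangent in `√x`, not in `x`: the mean of `√ν` is controlled by the weighted sum `S`, whereas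
the mean of `ν` would bring in unweighted squared gradients. -/
theorem log_le_tangent_sqrt {x y : ℝ} (hx : 0 < x) (hy : 0 < y) :
    Real.log x ≤ Real.log y + 2 * (√x / √y - 1) := by
  have h1 := Real.sqrt_pos.2 hx
  have h2 := Real.sqrt_pos.2 hy
  have h := Real.log_le_sub_one_of_pos (div_pos h1 h2)
  rw [Real.log_div h1.ne' h2.ne', Real.log_sqrt hx.le, Real.log_sqrt hy.le] at h
  linarith

/-- The expected sum of squared directions. -/
theorem integral_sum_sq_dir_le (hO : IsAffineVarianceOracle σ₀ σ₁ P f O)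
    (hf : IsSmoothObjective L f) (hL : 0 ≤ L) (hη : 0 ≤ η)
    (hβ : 0 < β₂) (hβ' : β₂ < 1) (hc : 0 ≤ c) (hc' : c < 1) (hν₀ : ∀ i, 0 < ν₀ i) (N : ℕ) :
    ∫ z, ∑ n ∈ Finset.range (N + 1), ‖(St z n).dir‖ ^ 2 ∂μ∞ ≤
      (∑ i, (m₀ i / √(ν₀ i)) ^ 2) / (1 - c) + ((1 - c * √β₂) / (1 - c)) ^ 2 / (1 - β₂) *
        ∑ i, (Real.log (ν₀ i + N * (1 - β₂) * σ₀ ^ 2) - Real.log (ν₀ i) - N * Real.log β₂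
          + (1 - β₂) * σ₁ ^ 2 / √(ν₀ i + N * (1 - β₂) * σ₀ ^ 2) *
            ∑ n ∈ Finset.range N,
              ∫ z, gradient f (St z n).w i ^ 2 * (St z n).weight β₂ i ∂μ∞) := by
  have hb : 0 < 1 - β₂ := by linarith
  have hY : ∀ i, 0 < ν₀ i + N * (1 - β₂) * σ₀ ^ 2 := fun i => by have := hν₀ i; positivity
  set Y : Fin d → ℝ := fun i => ν₀ i + N * (1 - β₂) * σ₀ ^ 2 with hYdef
  set Q := ((1 - c * √β₂) / (1 - c)) ^ 2 / (1 - β₂) with hQ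
  have hQ0 : 0 ≤ Q := by positivity
  have hpath : ∀ z, ∑ n ∈ Finset.range (N + 1), ‖(St z n).dir‖ ^ 2 ≤
      (∑ i, (m₀ i / √(ν₀ i)) ^ 2) / (1 - c) + Q * ∑ i, ((Real.log (Y i) - Real.log (ν₀ i)
        - N * Real.log β₂) + 2 * (√((St z N).ν i) / √(Y i) - 1)) := by
    intro z
    have h1 : ∀ i, ∑ n ∈ Finset.range (N + 1), ((St z n).m i / √((St z n).ν i)) ^ 2 ≤
        (m₀ i / √(ν₀ i)) ^ 2 / (1 - c) + Q * ((Real.log (Y i) - Real.log (ν₀ i)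
        - N * Real.log β₂) + 2 * (√((St z N).ν i) / √(Y i) - 1)) := by
      intro i
      have h2 := sum_sq_momentum_div_le (ν := fun n => (St z n).ν i) (m := fun n => (St z n).m i)
        (g := fun n => O (St z n).w (z (n + 1)) i) hβ hβ' hc hc' (hν₀ i) (fun _ => rfl)
        (fun _ => rfl) N
      refine h2.trans ?_
      have hpos : 0 < (St z N).ν i :=
        lt_of_lt_of_le (mul_pos (pow_pos hβ N) (hν₀ i)) (adamState_nu_ge hβ hβ' z N i)
      have h3 := log_le_tangent_sqrt hpos (hY i)
      have e0 : (St z 0).ν i = ν₀ i := rfl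
      have e1 : (St z 0).m i = m₀ i := rfl
      rw [e0, e1, ← hQ]
      gcongr
      linarith
    calc _ = ∑ n ∈ Finset.range (N + 1), ∑ i, ((St z n).m i / √((St z n).ν i)) ^ 2 := by
          refine Finset.sum_congr rfl fun n _ => ?_
          rw [EuclideanSpace.norm_sq_eq]
          simp only [AdamState.dir_apply, Real.norm_eq_abs, sq_abs]
      _ = ∑ i, ∑ n ∈ Finset.range (N + 1), ((St z n).m i / √((St z n).ν i)) ^ 2 :=
          Finset.sum_comm
      _ ≤ _ := Finset.sum_le_sum fun i _ => h1 i
      _ = _ := by rw [Finset.sum_add_distrib, Finset.sum_div, Finset.mul_sum]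
  have hroot := fun i => integral_sqrt_conditioner_le (w₁ := w₁) (m₀ := m₀)
    hO hf hL hη hβ hβ' hc hc' hν₀ N i
  have hterm : ∀ i ∈ Finset.univ, Integrable (fun z => (Real.log (Y i) - Real.log (ν₀ i)
        - N * Real.log β₂) + 2 * (√((St z N).ν i) / √(Y i) - 1)) μ∞ := fun i _ =>
    (integrable_const _).add ((((hroot i).1.div_const _).sub (integrable_const _)).const_mul _)
  have hrhs : Integrable (fun z => (∑ i, (m₀ i / √(ν₀ i)) ^ 2) / (1 - c) + Q * ∑ i,
      ((Real.log (Y i) - Real.log (ν₀ i) - N * Real.log β₂)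
        + 2 * (√((St z N).ν i) / √(Y i) - 1))) μ∞ :=
    (integrable_const _).add ((integrable_finsetSum _ hterm).const_mul _)
  refine (integral_mono (integrable_sum_sq_dir hO hβ hβ' hc hc' hν₀ N) hrhs hpath).trans ?_
  rw [integral_add (integrable_const _) ((integrable_finsetSum _ hterm).const_mul _),
    integral_const_mul, integral_finsetSum _ hterm]
  simp only [integral_const, probReal_univ, smul_eq_mul, one_mul]
  gcongr with i hi
  have j1 : Integrable (fun z => √((St z N).ν i) / √(Y i)) μ∞ := (hroot i).1.div_const _
  have j2 : Integrable (fun z => √((St z N).ν i) / √(Y i) - 1) μ∞ := j1.sub (integrable_const _)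
  rw [integral_add (integrable_const _) (j2.const_mul _), integral_const_mul,
    integral_sub j1 (integrable_const _), integral_div]
  simp only [integral_const, probReal_univ, smul_eq_mul, one_mul]
  refine add_le_add le_rfl ?_
  have h4 := Real.sqrt_pos.2 (hY i)
  have h5 := (hroot i).2
  have h6 : (∫ z, √((St z N).ν i) ∂μ∞) / √(Y i) ≤ (√(Y i) + (1 - β₂) / 2 * σ₁ ^ 2 *
      ∑ n ∈ Finset.range N, ∫ z, gradient f (St z n).w i ^ 2 * (St z n).weight β₂ i ∂μ∞)
        / √(Y i) := by gcongr
  rw [add_div, div_self h4.ne'] at h6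
  refine (mul_le_mul_of_nonneg_left (sub_le_sub_right h6 1) (by norm_num)).trans (le_of_eq ?_)
  ring

/-- The pathwise bound in expectation. -/
theorem expected_descent {C ε δ ρ : ℝ} (hO : IsAffineVarianceOracle σ₀ σ₁ P f O)
    (hf : IsSmoothObjective L f) (hL : 0 ≤ L) (hη : 0 < η)
    (hc : 0 ≤ c) (hc' : c < 1) (hβ : 0 < β₂) (hβ' : β₂ < 1) (hσ₀ : 0 < σ₀)
    (hν₀ : ∀ i, 0 < ν₀ i)
    (hC0 : ∀ i, |m₀ i / √(ν₀ i)| ≤ C) (hC : 1 / (1 - c) ≤ C) (hε : 0 < ε)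
    (hδ : 0 < δ) (hδ1 : 2 * δ ≤ 1) (hκδ : 1 - √β₂ ≤ δ) {N : ℕ}
    (hρ : ∀ n ≤ N, ∀ i, 1 / √(β₂ ^ (n + 1) * ν₀ i) ≤ ρ) :
    (1 - c * √β₂ - ε - C ^ 2 / (4 * ε) * (2 * δ * σ₁ ^ 2)) * ∑ i, ∑ n ∈ Finset.range N,
        ∫ z, gradient f (St z n).w i ^ 2 * (St z n).weight β₂ i ∂μ∞ ≤
      (1 - c) / η * f ((⟨w₁, m₀, ν₀⟩ : AdamState d).shifted η c)
      + C ^ 2 / (4 * ε) * (ρ * (d * σ₀ ^ 2 + σ₁ ^ 2 * ‖gradient f w₁‖ ^ 2)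
        + d * (N * (1 - √β₂) * σ₀ ^ 2 * ρ))
      + (C ^ 2 / (4 * ε) * (σ₁ ^ 2 / δ * ρ * (L ^ 2 * η ^ 2))
          + 2 * (L * η * (1 + c) ^ 2 / (1 - c))) *
        ∫ z, ∑ n ∈ Finset.range (N + 1), ‖(St z n).dir‖ ^ 2 ∂μ∞ := by
  have hpath := fun z => pathwise_bound (s := St z) (g := fun n => O (St z n).w (z (n + 1)))
    (σ₁ := σ₁) (N := N) (ρ := ρ) hf hL hη hc hc' hβ hβ' hσ₀ (fun _ => rfl) hν₀ hC0 hC hε hδ hδ1 hκδ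
    (fun n hn i => (adamState_weight_le hβ hβ' hν₀ z n i).trans (hρ n hn i))
  have hV : ∀ n, Measurable fun z => (St z n).w := fun n =>
    (measurable_adamState hO.measurable n).1
  have hVk : ∀ n z ζ, (St (Function.update z (n + 1) ζ) n).w = (St z n).w := fun n z ζ => by
    rw [adamState_update (Nat.lt_succ_self n)]
  have hw0 : ∀ z n i, 0 ≤ (St z n).weight β₂ i := fun z n i => weight_nonneg z n i
  have hwB : ∀ z n i, (St z n).weight β₂ i ≤ 1 / √(β₂ ^ (n + 1) * ν₀ i) := fun z n i =>
    adamState_weight_le hβ hβ' hν₀ z n i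
  have hwm := fun n i => measurable_weight (η := η) (β₂ := β₂) (c := c) (w₁ := w₁) (m₀ := m₀)
    (ν₀ := ν₀) hO n i
  have hGm := fun n i => measurable_gradient_iterate (η := η) (β₂ := β₂) (c := c) (w₁ := w₁)
    (m₀ := m₀) (ν₀ := ν₀) hO hf n i
  have hS := fun n i => integrable_sq_mul_weight (w₁ := w₁) (m₀ := m₀)
    hO hf hL hη.le hβ hβ' hc hc' hν₀ n i
  have hX := integrable_sum_sq_dir (η := η) (w₁ := w₁) (m₀ := m₀) hO hβ hβ' hc hc' hν₀ N
  have hR := fun n => exists_gradient_bound (O := O) (w₁ := w₁) (m₀ := m₀)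
    hf hL hη.le hβ hβ' hc hc' hν₀ n
  -- the linear terms
  have hlin : ∀ n i, Integrable (fun z => gradient f (St z n).w i * (St z n).weight β₂ i *
        O (St z n).w (z (n + 1)) i) μ∞ ∧
      ∫ z, gradient f (St z n).w i * (St z n).weight β₂ i * O (St z n).w (z (n + 1)) i ∂μ∞ =
        ∫ z, gradient f (St z n).w i ^ 2 * (St z n).weight β₂ i ∂μ∞ := by
    intro n i
    obtain ⟨R, hR⟩ := hR n
    have hB : ∀ z, |gradient f (St z n).w i * (St z n).weight β₂ i| ≤
        R * (1 / √(β₂ ^ (n + 1) * ν₀ i)) := fun z => by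
      rw [abs_mul, abs_of_nonneg (hw0 z n i)]
      have h1 := (PiLp.norm_apply_le (gradient f (St z n).w) i).trans (hR z)
      rw [Real.norm_eq_abs] at h1
      have := (abs_nonneg _).trans h1
      have := hw0 z n i
      gcongr
      exact hwB z n i
    have hm : Measurable fun z => gradient f (St z n).w i * (St z n).weight β₂ i :=
      (hGm n i).mul (hwm n i)
    refine ⟨(integrable_oracle hO (hV n) (hVk n) hR i).bdd_mul hm.aestronglyMeasurable
      (Filter.Eventually.of_forall hB), ?_⟩
    rw [integral_mul_oracle hO (hV n) (hVk n) hR hm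
      (fun z ζ => by rw [adamState_update (Nat.lt_succ_self n)]) hB i]
    refine integral_congr_ae (Filter.Eventually.of_forall fun z => ?_)
    simp only
    ring
  -- the quadratic terms
  have hquad : ∀ n i, Integrable (fun z => gradient f (St z n).w i ^ 2 /
        (σ₀ ^ 2 + σ₁ ^ 2 * gradient f (St z n).w i ^ 2) * (St z n).weight β₂ i *
        O (St z n).w (z (n + 1)) i ^ 2) μ∞ ∧
      ∫ z, gradient f (St z n).w i ^ 2 /
        (σ₀ ^ 2 + σ₁ ^ 2 * gradient f (St z n).w i ^ 2) * (St z n).weight β₂ i *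
        O (St z n).w (z (n + 1)) i ^ 2 ∂μ∞ ≤
        ∫ z, gradient f (St z n).w i ^ 2 * (St z n).weight β₂ i ∂μ∞ := by
    intro n i
    obtain ⟨R, hR⟩ := hR n
    have h0 : ∀ z, 0 ≤ gradient f (St z n).w i ^ 2 /
        (σ₀ ^ 2 + σ₁ ^ 2 * gradient f (St z n).w i ^ 2) * (St z n).weight β₂ i := fun z =>
      mul_nonneg (by positivity) (hw0 z n i)
    have hB : ∀ z, gradient f (St z n).w i ^ 2 /
        (σ₀ ^ 2 + σ₁ ^ 2 * gradient f (St z n).w i ^ 2) * (St z n).weight β₂ i ≤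
        R ^ 2 / σ₀ ^ 2 * (1 / √(β₂ ^ (n + 1) * ν₀ i)) := fun z => by
      have h2 : gradient f (St z n).w i ^ 2 ≤ R ^ 2 := by
        rw [← sq_abs]
        exact pow_le_pow_left₀ (abs_nonneg _)
          ((PiLp.norm_apply_le (gradient f (St z n).w) i).trans (hR z)) 2
      have := hw0 z n i
      gcongr
      · exact le_add_of_nonneg_right (by positivity)
      · exact hwB z n i
    have hm : Measurable fun z => gradient f (St z n).w i ^ 2 /
        (σ₀ ^ 2 + σ₁ ^ 2 * gradient f (St z n).w i ^ 2) * (St z n).weight β₂ i :=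
      (((hGm n i).pow_const 2).div ((((hGm n i).pow_const 2).const_mul _).const_add _)).mul
        (hwm n i)
    refine ⟨(integrable_oracle_sq hO (hV n) (hVk n) hR i).bdd_mul hm.aestronglyMeasurable
      (Filter.Eventually.of_forall fun z => by
        rw [Real.norm_of_nonneg (h0 z)]; exact hB z), ?_⟩
    refine (integral_mul_oracle_sq_le hO (hV n) hf.continuous_gradient (hVk n) hR hm
      (fun z ζ => by rw [adamState_update (Nat.lt_succ_self n)]) h0 hB i).trans (le_of_eq ?_)
    refine integral_congr_ae (Filter.Eventually.of_forall fun z => ?_)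
    -- The second-moment bound cancels the denominator placed there by Young's inequality.
    have : 0 < σ₀ ^ 2 + σ₁ ^ 2 * gradient f (St z n).w i ^ 2 := by positivity
    simp only
    field_simp
  have i1 : Integrable (fun z => ∑ n ∈ Finset.range N, ∑ i, (1 - c * √β₂) *
      ((gradient f (St z n).w i * (St z n).weight β₂ i) * O (St z n).w (z (n + 1)) i)) μ∞ :=
    integrable_finsetSum _ fun n _ => integrable_finsetSum _ fun i _ =>
      (hlin n i).1.const_mul _
  have i2 : Integrable (fun z => ∑ n ∈ Finset.range N, ∑ i, ε * (gradient f (St z n).w i ^ 2 /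
        (σ₀ ^ 2 + σ₁ ^ 2 * gradient f (St z n).w i ^ 2) * (St z n).weight β₂ i) *
        O (St z n).w (z (n + 1)) i ^ 2) μ∞ :=
    integrable_finsetSum _ fun n _ => integrable_finsetSum _ fun i _ => by
      simp only [mul_assoc ε]
      exact (hquad n i).1.const_mul _
  have i3 : Integrable (fun z => ∑ n ∈ Finset.range N, ∑ i,
      gradient f (St z n).w i ^ 2 * (St z n).weight β₂ i) μ∞ :=
    integrable_finsetSum _ fun n _ => integrable_finsetSum _ fun i _ => hS n i
  have e1 : ∫ z, ∑ n ∈ Finset.range N, ∑ i, (1 - c * √β₂) *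
      ((gradient f (St z n).w i * (St z n).weight β₂ i) * O (St z n).w (z (n + 1)) i) ∂μ∞ =
      (1 - c * √β₂) * ∑ n ∈ Finset.range N, ∑ i,
        ∫ z, gradient f (St z n).w i ^ 2 * (St z n).weight β₂ i ∂μ∞ := by
    rw [integral_finsetSum _ fun n _ => integrable_finsetSum _ fun i _ =>
      (hlin n i).1.const_mul _, Finset.mul_sum]
    refine Finset.sum_congr rfl fun n _ => ?_
    rw [integral_finsetSum _ fun i _ => (hlin n i).1.const_mul _, Finset.mul_sum]
    refine Finset.sum_congr rfl fun i _ => ?_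
    rw [integral_const_mul, (hlin n i).2]
  have e2 : ∫ z, ∑ n ∈ Finset.range N, ∑ i, ε * (gradient f (St z n).w i ^ 2 /
        (σ₀ ^ 2 + σ₁ ^ 2 * gradient f (St z n).w i ^ 2) * (St z n).weight β₂ i) *
        O (St z n).w (z (n + 1)) i ^ 2 ∂μ∞ ≤ ε * ∑ n ∈ Finset.range N, ∑ i,
        ∫ z, gradient f (St z n).w i ^ 2 * (St z n).weight β₂ i ∂μ∞ := by
    simp only [mul_assoc ε]
    rw [integral_finsetSum _ fun n _ => integrable_finsetSum _ fun i _ =>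
      (hquad n i).1.const_mul _, Finset.mul_sum]
    refine Finset.sum_le_sum fun n _ => ?_
    rw [integral_finsetSum _ fun i _ => (hquad n i).1.const_mul _, Finset.mul_sum]
    refine Finset.sum_le_sum fun i _ => ?_
    rw [integral_const_mul]
    exact mul_le_mul_of_nonneg_left (hquad n i).2 hε.le
  have e3 : ∫ z, ∑ n ∈ Finset.range N, ∑ i,
      gradient f (St z n).w i ^ 2 * (St z n).weight β₂ i ∂μ∞ = ∑ n ∈ Finset.range N, ∑ i,
        ∫ z, gradient f (St z n).w i ^ 2 * (St z n).weight β₂ i ∂μ∞ := by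
    rw [integral_finsetSum _ fun n _ => integrable_finsetSum _ fun i _ => hS n i]
    exact Finset.sum_congr rfl fun n _ => integral_finsetSum _ fun i _ => hS n i
  have i4 := (integrable_const (μ := μ∞)
    ((1 - c) / η * f ((⟨w₁, m₀, ν₀⟩ : AdamState d).shifted η c)))
  set K₁ := ρ * (d * σ₀ ^ 2 + σ₁ ^ 2 * ‖gradient f w₁‖ ^ 2) + d * (N * (1 - √β₂) * σ₀ ^ 2 * ρ)
  set K₂ := 2 * (L * η * (1 + c) ^ 2 / (1 - c))
  set K₃ := σ₁ ^ 2 / δ * ρ * (L ^ 2 * η ^ 2)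
  have j1 : Integrable (fun z => (1 - c) / η * f ((⟨w₁, m₀, ν₀⟩ : AdamState d).shifted η c)
      + ∑ n ∈ Finset.range N, ∑ i, ε * (gradient f (St z n).w i ^ 2 /
        (σ₀ ^ 2 + σ₁ ^ 2 * gradient f (St z n).w i ^ 2) * (St z n).weight β₂ i) *
        O (St z n).w (z (n + 1)) i ^ 2) μ∞ := i4.add i2
  have j2 : Integrable (fun z => K₁ + 2 * δ * σ₁ ^ 2 * ∑ n ∈ Finset.range N, ∑ i,
      gradient f (St z n).w i ^ 2 * (St z n).weight β₂ i) μ∞ :=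
    (integrable_const _).add (i3.const_mul _)
  have j3 : Integrable (fun z => K₁ + 2 * δ * σ₁ ^ 2 * ∑ n ∈ Finset.range N, ∑ i,
      gradient f (St z n).w i ^ 2 * (St z n).weight β₂ i
      + K₃ * ∑ n ∈ Finset.range (N + 1), ‖(St z n).dir‖ ^ 2) μ∞ := j2.add (hX.const_mul _)
  have j4 := j1.add (j3.const_mul (C ^ 2 / (4 * ε)))
  have hmain := integral_mono i1 (j4.add (hX.const_mul K₂)) hpath
  rw [integral_add' j4 (hX.const_mul K₂), integral_add' j1 (j3.const_mul _), integral_add i4 i2,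
    integral_const_mul, integral_const_mul, integral_add j2 (hX.const_mul _),
    integral_add (integrable_const _) (i3.const_mul (2 * δ * σ₁ ^ 2)), integral_const_mul,
    integral_const_mul, integral_const_mul, e1, e3] at hmain
  simp only [integral_const, probReal_univ, smul_eq_mul, one_mul] at hmain
  rw [Finset.sum_comm]
  linarith

end Expectation

/-! ### From the weighted sum to the expected gradient norm -/

section GradNorm

variable {d : ℕ} {Z : Type u} [MeasurableSpace Z] {P : Measure Z} [IsProbabilityMeasure P]
  {f : EuclideanSpace ℝ (Fin d) → ℝ} {O : EuclideanSpace ℝ (Fin d) → Z → EuclideanSpace ℝ (Fin d)}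
  {η β₂ c L σ₀ σ₁ : ℝ} {w₁ : EuclideanSpace ℝ (Fin d)} {m₀ ν₀ : Fin d → ℝ}

local notation "St" => adamState O η (c * √β₂) β₂ w₁ m₀ ν₀
local notation "μ∞" => (Measure.infinitePi fun _ : ℕ => P)

theorem lintegral_uniformOn_Icc {T : ℕ} (F : ℕ → ENNReal) :
    ∫⁻ r, F r ∂(uniformOn (Set.Icc 1 T)) =
      (T : ENNReal)⁻¹ * ∑ n ∈ Finset.range T, F (n + 1) := by
  rw [uniformOn, ProbabilityTheory.cond, lintegral_smul_measure, ← Finset.coe_Icc,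
    lintegral_finset, Measure.count_apply_finset, Nat.card_Icc, smul_eq_mul]
  simp only [Measure.count_singleton, mul_one, Nat.add_sub_cancel]
  congr 1
  rw [Finset.range_eq_Ico, Finset.sum_Ico_add' F 0 T 1]
  congr 1

/-- Cauchy–Schwarz in the form with a free parameter `l`: it is linear in both sums, so expectations
and the average over the output index pass through. -/
theorem norm_le_weighted {d : ℕ} {G : EuclideanSpace ℝ (Fin d)} {s : AdamState d}
    (hβ : 0 < β₂) (hβ' : β₂ < 1) (hs : ∀ i, 0 < s.ν i) {l : ℝ} (hl : 0 < l) :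
    ‖G‖ ≤ l / 2 * ∑ i, G i ^ 2 * s.weight β₂ i + 1 / (2 * l) * ∑ i, √(s.ν i) := by
  set x := ∑ i, G i ^ 2 * s.weight β₂ i
  set y := ∑ i, √(s.ν i)
  have hw : ∀ i, 0 ≤ s.weight β₂ i := fun i => by rw [AdamState.weight]; positivity
  have hx : 0 ≤ x := Finset.sum_nonneg fun i _ => mul_nonneg (sq_nonneg _) (hw i)
  have hy : 0 ≤ y := Finset.sum_nonneg fun i _ => Real.sqrt_nonneg _
  have h1 : ‖G‖ ^ 2 ≤ x * y := by
    rw [EuclideanSpace.norm_sq_eq, Finset.sum_mul]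
    refine Finset.sum_le_sum fun i _ => ?_
    have h2 : √(β₂ * s.ν i) ≤ y := by
      have h3 : √(β₂ * s.ν i) ≤ √(s.ν i) := Real.sqrt_le_sqrt (by nlinarith [hs i])
      exact h3.trans (Finset.single_le_sum (f := fun i => √(s.ν i))
        (fun _ _ => Real.sqrt_nonneg _) (Finset.mem_univ i))
    have h4 : 0 < √(β₂ * s.ν i) := Real.sqrt_pos.2 (mul_pos hβ (hs i))
    calc ‖G i‖ ^ 2 = G i ^ 2 * s.weight β₂ i * √(β₂ * s.ν i) := by
          rw [AdamState.weight, Real.norm_eq_abs, sq_abs]; field_simp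
      _ ≤ _ := mul_le_mul_of_nonneg_left h2 (mul_nonneg (sq_nonneg _) (hw i))
  refine (sq_le_sq₀ (norm_nonneg _) (by positivity)).1 (h1.trans ?_)
  have : (l / 2 * x + 1 / (2 * l) * y) ^ 2 - x * y = (l / 2 * x - 1 / (2 * l) * y) ^ 2 := by
    field_simp; ring
  nlinarith [sq_nonneg (l / 2 * x - 1 / (2 * l) * y)]

theorem adamExpectedGradNorm_le (hO : IsAffineVarianceOracle σ₀ σ₁ P f O)
    (hf : IsSmoothObjective L f) (hL : 0 ≤ L) (hη : 0 ≤ η)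
    (hβ : 0 < β₂) (hβ' : β₂ < 1) (hc : 0 ≤ c) (hc' : c < 1) (hν₀ : ∀ i, 0 < ν₀ i) {T : ℕ}
    (hT : 1 ≤ T) {A V : ℝ} (hA : 0 < A) (hV : 0 < V)
    (hS : ∑ i, ∑ n ∈ Finset.range T,
      ∫ z, gradient f (St z n).w i ^ 2 * (St z n).weight β₂ i ∂μ∞ ≤ A * T)
    (hroot : ∀ n < T, ∑ i, ∫ z, √((St z n).ν i) ∂μ∞ ≤ V) :
    adamExpectedGradNorm P f O η (c * √β₂) β₂ w₁ m₀ ν₀ T ≤ ENNReal.ofReal (√V * √A) := by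
  have hA' := Real.sqrt_pos.2 hA
  have hV' := Real.sqrt_pos.2 hV
  have hGm : ∀ n, Measurable fun z => gradient f (St z n).w := fun n =>
    hf.continuous_gradient.measurable.comp (measurable_adamState hO.measurable n).1
  have hmeas : Measurable fun p : (ℕ → Z) × ℕ =>
      ‖gradient f (adamIterate O η (c * √β₂) β₂ w₁ m₀ ν₀ p.1 p.2)‖ₑ :=
    measurable_from_prod_countable_left fun t => (hGm (t - 1)).enorm
  rw [adamExpectedGradNorm, lintegral_prod_symm _ hmeas.aemeasurable, lintegral_uniformOn_Icc]
  -- The minimiser of `l A / 2 + V / (2 l)`, with value `√V √A`.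
  set l := √V / √A with hl
  have hl0 : 0 < l := by positivity
  have hSi := fun n i => integrable_sq_mul_weight (w₁ := w₁) (m₀ := m₀)
    hO hf hL hη hβ hβ' hc hc' hν₀ n i
  have hRi := fun n i => (integral_sqrt_conditioner_le (w₁ := w₁) (m₀ := m₀)
    hO hf hL hη hβ hβ' hc hc' hν₀ n i).1
  have hterm : ∀ n ∈ Finset.range T,
      ∫⁻ z, ‖gradient f (adamIterate O η (c * √β₂) β₂ w₁ m₀ ν₀ z (n + 1))‖ₑ ∂μ∞ ≤
      ENNReal.ofReal (l / 2 * ∑ i, ∫ z, gradient f (St z n).w i ^ 2 * (St z n).weight β₂ i ∂μ∞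
        + 1 / (2 * l) * V) := by
    intro n hn
    have i1 : Integrable (fun z => ∑ i, gradient f (St z n).w i ^ 2 * (St z n).weight β₂ i) μ∞ :=
      integrable_finsetSum _ fun i _ => hSi n i
    have i2 : Integrable (fun z => ∑ i, √((St z n).ν i)) μ∞ :=
      integrable_finsetSum _ fun i _ => hRi n i
    have i3 : Integrable (fun z =>
        l / 2 * ∑ i, gradient f (St z n).w i ^ 2 * (St z n).weight β₂ i
        + 1 / (2 * l) * ∑ i, √((St z n).ν i)) μ∞ := (i1.const_mul _).add (i2.const_mul _)
    have hpos : ∀ z i, 0 < (St z n).ν i := fun z i =>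
      lt_of_lt_of_le (mul_pos (pow_pos hβ n) (hν₀ i)) (adamState_nu_ge hβ hβ' z n i)
    have hle : ∀ z, ‖gradient f (St z n).w‖ ≤
        l / 2 * ∑ i, gradient f (St z n).w i ^ 2 * (St z n).weight β₂ i
        + 1 / (2 * l) * ∑ i, √((St z n).ν i) := fun z =>
      norm_le_weighted hβ hβ' (hpos z) hl0
    calc ∫⁻ z, ‖gradient f (adamIterate O η (c * √β₂) β₂ w₁ m₀ ν₀ z (n + 1))‖ₑ ∂μ∞
        = ∫⁻ z, ENNReal.ofReal ‖gradient f (St z n).w‖ ∂μ∞ := by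
          refine lintegral_congr fun z => ?_
          rw [ofReal_norm]; rfl
      _ ≤ ∫⁻ z, ENNReal.ofReal (l / 2 * ∑ i, gradient f (St z n).w i ^ 2 * (St z n).weight β₂ i
        + 1 / (2 * l) * ∑ i, √((St z n).ν i)) ∂μ∞ :=
          lintegral_mono fun z => ENNReal.ofReal_le_ofReal (hle z)
      _ = ENNReal.ofReal (∫ z, (l / 2 * ∑ i, gradient f (St z n).w i ^ 2 * (St z n).weight β₂ i
        + 1 / (2 * l) * ∑ i, √((St z n).ν i)) ∂μ∞) :=
          (ofReal_integral_eq_lintegral_ofReal i3 (Filter.Eventually.of_forall fun z =>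
            (norm_nonneg _).trans (hle z))).symm
      _ ≤ _ := by
          refine ENNReal.ofReal_le_ofReal ?_
          rw [integral_add (i1.const_mul _) (i2.const_mul _), integral_const_mul,
            integral_const_mul, integral_finsetSum _ fun i _ => hSi n i,
            integral_finsetSum _ fun i _ => hRi n i]
          have := hroot n (Finset.mem_range.1 hn)
          gcongr
  have hw0 : ∀ n, 0 ≤ l / 2 * ∑ i, ∫ z, gradient f (St z n).w i ^ 2 * (St z n).weight β₂ i ∂μ∞
      + 1 / (2 * l) * V := fun n => by
    have : 0 ≤ ∑ i, ∫ z, gradient f (St z n).w i ^ 2 * (St z n).weight β₂ i ∂μ∞ :=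
      Finset.sum_nonneg fun i _ => integral_nonneg fun z =>
        mul_nonneg (sq_nonneg _) (weight_nonneg z n i)
    positivity
  have hT0 : (0 : ℝ) < T := by exact_mod_cast hT
  calc _ ≤ (T : ENNReal)⁻¹ * ∑ n ∈ Finset.range T, ENNReal.ofReal
        (l / 2 * ∑ i, ∫ z, gradient f (St z n).w i ^ 2 * (St z n).weight β₂ i ∂μ∞
        + 1 / (2 * l) * V) := by gcongr with n hn; exact hterm n hn
    _ = ENNReal.ofReal ((T : ℝ)⁻¹ * ∑ n ∈ Finset.range T,
        (l / 2 * ∑ i, ∫ z, gradient f (St z n).w i ^ 2 * (St z n).weight β₂ i ∂μ∞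
        + 1 / (2 * l) * V)) := by
        rw [ENNReal.ofReal_mul (by positivity), ENNReal.ofReal_sum_of_nonneg fun n _ => hw0 n,
          ENNReal.ofReal_inv_of_pos hT0, ENNReal.ofReal_natCast]
    _ ≤ _ := by
        refine ENNReal.ofReal_le_ofReal ?_
        rw [Finset.sum_add_distrib, ← Finset.mul_sum, Finset.sum_const, Finset.card_range,
          nsmul_eq_mul, Finset.sum_comm, inv_mul_le_iff₀ hT0]
        have h1 : l / 2 * ∑ i, ∑ n ∈ Finset.range T,
            ∫ z, gradient f (St z n).w i ^ 2 * (St z n).weight β₂ i ∂μ∞ ≤ l / 2 * (A * T) := by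
          gcongr
        have h2 : l / 2 * (A * T) + T * (1 / (2 * l) * V) = T * (√V * √A) := by
          rw [hl]
          nth_rewrite 2 [← Real.sq_sqrt hA.le]
          nth_rewrite 3 [← Real.sq_sqrt hV.le]
          field_simp
          ring
        linarith

end GradNorm

/-! ### Estimates uniform in the number of iterations -/

section Elementary

theorem neg_log_one_sub_le {x : ℝ} (hx0 : 0 ≤ x) (hx1 : x ≤ 1 / 5) :
    -Real.log (1 - x) ≤ 5 / 4 * x := by
  have h1 : 0 < 1 - x := by linarith
  have h2 := Real.one_sub_inv_le_log_of_pos h1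
  have h3 : (1 - x)⁻¹ - 1 ≤ 5 / 4 * x := by
    rw [inv_eq_one_div, div_sub_one h1.ne', div_le_iff₀ h1]
    nlinarith
  linarith

/-- Bounds the weights independently of `T`. With `n + 1 ≤ 2 T` the exponent is at most `5 b / 2`;
the `4 b` is generous. -/
theorem exp_le_pow_one_sub_div {b : ℝ} {T n : ℕ} (hb : 0 < b) (hT : 5 * b ≤ T) (hT1 : 1 ≤ T)
    (hn : n ≤ T) : Real.exp (-(4 * b)) ≤ (1 - b / T) ^ (n + 1) := by
  have hT0 : (0 : ℝ) < T := by exact_mod_cast hT1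
  have hx0 : 0 < b / T := by positivity
  have hx : b / T ≤ 1 / 5 := by rw [div_le_div_iff₀ hT0 (by norm_num)]; linarith
  have h1 : 0 < 1 - b / T := by linarith
  have h2 : -Real.log (1 - b / T) ≤ 5 / 4 * (b / T) :=
    neg_log_one_sub_le hx0.le hx
  rw [← Real.exp_log h1, ← Real.exp_nat_mul, Real.exp_le_exp]
  have h3 : ((n + 1 : ℕ) : ℝ) ≤ 2 * T := by
    have : n + 1 ≤ 2 * T := by omega
    exact_mod_cast this
  have h4 : ((n + 1 : ℕ) : ℝ) * -Real.log (1 - b / T) ≤ 2 * T * (5 / 4 * (b / T)) := by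
    have : 0 ≤ -Real.log (1 - b / T) := by
      have := Real.log_nonpos h1.le (by linarith)
      linarith
    gcongr
  have h5 : 2 * T * (5 / 4 * (b / T)) = 5 / 2 * b := by field_simp; ring
  linarith

/-- The initial momentum moves the starting value by `O(η)` only, so after division by `η` it does
not affect the `√T` coefficient. -/
theorem IsSmoothObjective.shifted_le {d : ℕ} {L η a c : ℝ} {f : EuclideanSpace ℝ (Fin d) → ℝ}
    (hf : IsSmoothObjective L f) (hL : 0 ≤ L) (hη : 0 ≤ η) (hηa : η ≤ a)
    (s : AdamState d) :
    f (s.shifted η c) ≤ f s.w + η * ((2 * (L + 1) * f s.w + (c / (1 - c)) ^ 2 * ‖s.dir‖ ^ 2) / 2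
      + L / 2 * (c / (1 - c)) ^ 2 * a * ‖s.dir‖ ^ 2) := by
  have h1 := hf.le_quadratic s.w (s.shifted η c)
  have h2 := hf.norm_gradient_sq_le hL s.w
  set k := c / (1 - c)
  have e : s.shifted η c - s.w = -((k * η) • s.dir) := by
    rw [AdamState.shifted]; abel
  have h3 := abs_real_inner_le_norm (gradient f s.w) (-((k * η) • s.dir))
  rw [norm_neg, norm_smul, Real.norm_eq_abs, abs_mul, abs_of_nonneg hη] at h3
  rw [e, norm_neg, norm_smul, Real.norm_eq_abs, abs_mul, abs_of_nonneg hη] at h1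
  have h4 := (le_abs_self _).trans h3
  set x := ‖s.dir‖
  set N := ‖gradient f s.w‖
  have h5 : N * (|k| * η * x) ≤ η * ((2 * (L + 1) * f s.w + k ^ 2 * x ^ 2) / 2) := by
    have h7 : N * (|k| * x) ≤ (2 * (L + 1) * f s.w + k ^ 2 * x ^ 2) / 2 := by
      nlinarith [sq_nonneg (N - |k| * x), sq_abs k]
    calc N * (|k| * η * x) = η * (N * (|k| * x)) := by ring
      _ ≤ _ := mul_le_mul_of_nonneg_left h7 hη
  have h6 : L / 2 * (|k| * η * x) ^ 2 ≤ η * (L / 2 * k ^ 2 * a * x ^ 2) := by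
    calc L / 2 * (|k| * η * x) ^ 2 = L / 2 * k ^ 2 * x ^ 2 * η * η := by
          rw [mul_pow, mul_pow, sq_abs]; ring
      _ ≤ L / 2 * k ^ 2 * x ^ 2 * η * a := by gcongr
      _ = _ := by ring
  linarith

end Elementary

/-! ### The self-bounding inequality for the weighted sum -/

section Rate

/-- The weighted sum of squared gradients in expectation, for the step sizes of the theorem. -/
def adamWeightedSum {d : ℕ} {Z : Type u} [MeasurableSpace Z] (P : Measure Z)
    (f : EuclideanSpace ℝ (Fin d) → ℝ) (O : EuclideanSpace ℝ (Fin d) → Z → EuclideanSpace ℝ (Fin d))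
    (η c β₂ : ℝ) (w₁ : EuclideanSpace ℝ (Fin d)) (m₀ ν₀ : Fin d → ℝ) (N : ℕ) (i : Fin d) : ℝ :=
  ∑ n ∈ Finset.range N, ∫ z, gradient f (adamState O η (c * √β₂) β₂ w₁ m₀ ν₀ z n).w i ^ 2 *
    (adamState O η (c * √β₂) β₂ w₁ m₀ ν₀ z n).weight β₂ i ∂(Measure.infinitePi fun _ : ℕ => P)

theorem adamWeightedSum_nonneg {d : ℕ} {Z : Type u} [MeasurableSpace Z] (P : Measure Z)
    (f : EuclideanSpace ℝ (Fin d) → ℝ) (O : EuclideanSpace ℝ (Fin d) → Z → EuclideanSpace ℝ (Fin d))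
    (η c β₂ : ℝ) (w₁ : EuclideanSpace ℝ (Fin d)) (m₀ ν₀ : Fin d → ℝ) (N : ℕ) (i : Fin d) :
    0 ≤ adamWeightedSum P f O η c β₂ w₁ m₀ ν₀ N i :=
  Finset.sum_nonneg fun n _ => integral_nonneg fun z =>
    mul_nonneg (sq_nonneg _) (weight_nonneg z n i)

theorem adamWeightedSum_mono {d : ℕ} {Z : Type u} [MeasurableSpace Z] (P : Measure Z)
    (f : EuclideanSpace ℝ (Fin d) → ℝ) (O : EuclideanSpace ℝ (Fin d) → Z → EuclideanSpace ℝ (Fin d))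
    (η c β₂ : ℝ) (w₁ : EuclideanSpace ℝ (Fin d)) (m₀ ν₀ : Fin d → ℝ) {M N : ℕ} (h : M ≤ N)
    (i : Fin d) :
    adamWeightedSum P f O η c β₂ w₁ m₀ ν₀ M i ≤ adamWeightedSum P f O η c β₂ w₁ m₀ ν₀ N i :=
  Finset.sum_le_sum_of_subset_of_nonneg (Finset.range_mono h) fun n _ _ =>
    integral_nonneg fun z => mul_nonneg (sq_nonneg _) (weight_nonneg z n i)

/-- `∑ᵢ (ln (ν₀ᵢ + b σ₀²) - ln ν₀ᵢ)`. -/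
def adamLogSum {d : ℕ} (b σ₀ : ℝ) (ν₀ : Fin d → ℝ) : ℝ :=
  ∑ i, (Real.log (ν₀ i + b * σ₀ ^ 2) - Real.log (ν₀ i))

theorem momentum_ratio_sq_le {c κ x : ℝ} (hc : 0 ≤ c) (hc' : c < 1) (hκ1 : κ ≤ 1)
    (hκ : 1 - κ ≤ x) (hx : x ≤ 2 * (1 - c) / 5) : ((1 - c * κ) / (1 - c)) ^ 2 ≤ 2 := by
  have hc1 : 0 < 1 - c := by linarith
  have h1 : (1 - c * κ) / (1 - c) ≤ 7 / 5 := by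
    rw [div_le_iff₀ hc1]
    nlinarith [mul_nonneg hc (by linarith : 0 ≤ x - (1 - κ))]
  have h2 : 0 ≤ (1 - c * κ) / (1 - c) := by
    refine div_nonneg ?_ hc1.le
    nlinarith
  nlinarith

theorem smoothing_param_le {c C σ₁ : ℝ} (hc : 0 ≤ c) (hc' : c < 1) (hC : 1 ≤ C) :
    2 * ((1 - c) ^ 2 / (8 * C ^ 2 * (σ₁ ^ 2 + 1))) ≤ 1 := by
  rw [← mul_div_assoc, div_le_one (by positivity)]
  have h1 : (1 - c) ^ 2 ≤ 1 := by nlinarith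
  have h2 : 1 ≤ C ^ 2 := by nlinarith
  have h3 : 1 ≤ C ^ 2 * (σ₁ ^ 2 + 1) := by nlinarith [sq_nonneg σ₁]
  linarith

/-- For `ε = (1-c)/4` and this `δ`, the Young term and the summation-by-parts term each consume at
most a quarter of `1 - c`. -/
theorem half_le_descent_coeff {c C σ₁ κ : ℝ} (hc : 0 ≤ c) (hc' : c < 1) (hC : 1 ≤ C)
    (hκ : κ ≤ 1) :
    (1 - c) / 2 ≤ 1 - c * κ - (1 - c) / 4
      - C ^ 2 / (1 - c) * (2 * ((1 - c) ^ 2 / (8 * C ^ 2 * (σ₁ ^ 2 + 1))) * σ₁ ^ 2) := by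
  have hc1 : 0 < 1 - c := by linarith
  have h1 : c * κ ≤ c := mul_le_of_le_one_right hc hκ
  have h2 : C ^ 2 / (1 - c) * (2 * ((1 - c) ^ 2 / (8 * C ^ 2 * (σ₁ ^ 2 + 1))) * σ₁ ^ 2) =
      (1 - c) / 4 * (σ₁ ^ 2 / (σ₁ ^ 2 + 1)) := by
    field_simp; ring
  have h3 : σ₁ ^ 2 / (σ₁ ^ 2 + 1) ≤ 1 := by
    rw [div_le_one (by positivity)]; linarith
  rw [h2]
  nlinarith

/-- Collects the orders in `q = √T` of the descent inequality. -/
theorem collect_orders {a b c q L Δ K₁ K₂ K₅ W X X₀ y M S E : ℝ} (ha : 0 < a) (hb : 0 < b)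
    (hc' : c < 1) (hq1 : 1 ≤ q) (hL : 0 ≤ L) (hK₂ : 0 ≤ K₂) (hW : 0 ≤ W) (hX₀ : 0 ≤ X₀)
    (hy : 0 ≤ y) (hS : 0 ≤ S)
    (hX : X ≤ X₀ / (1 - c) + 2 * q ^ 2 / b * M + y * S)
    (hmain : (1 - c) / 2 * S ≤ (1 - c) / (a / q) * (Δ + a / q * K₅) + E * K₁
      + (K₂ * (a / q) ^ 2 + 2 * (L * (a / q) * W)) * X) :
    S ≤ q * (2 * Δ / a + 8 * (L * a / b * (W / (1 - c))) * M)
      + (2 * K₅ + 2 / (1 - c) * (E * K₁) + 4 * (K₂ * a ^ 2) / ((1 - c) * b) * M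
        + 2 / (1 - c) * (K₂ * a ^ 2 + 2 * (L * a * W)) * (X₀ / (1 - c)))
      + 2 / (1 - c) * (K₂ * a ^ 2 + 2 * (L * a * W)) * y / q * S := by
  have hc1 : 0 < 1 - c := by linarith
  have hq0 : 0 < q := by linarith
  set k₁ := 2 / (1 - c) * (K₂ * a ^ 2 + 2 * (L * a * W)) with hk₁
  have hk₁0 : 0 ≤ k₁ := by positivity
  set B := K₂ * (a / q) ^ 2 + 2 * (L * (a / q) * W) with hB
  have hB0 : 0 ≤ B := by positivity
  have h6 : B ≤ (1 - c) / 2 * (k₁ / q) := by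
    have h7 : (a / q) ^ 2 ≤ a ^ 2 / q := by
      rw [div_pow]
      exact div_le_div_of_nonneg_left (by positivity) hq0 (by nlinarith)
    calc B ≤ K₂ * (a ^ 2 / q) + 2 * (L * (a / q) * W) := by rw [hB]; gcongr
      _ = _ := by rw [hk₁]; field_simp
  have hXM : B * X ≤ (1 - c) / 2 * (k₁ * (X₀ / (1 - c)) + k₁ * y / q * S)
        + B * (2 * q ^ 2 / b * M) := by
    calc _ ≤ B * (X₀ / (1 - c) + 2 * q ^ 2 / b * M + y * S) := by gcongr
      _ = B * (X₀ / (1 - c) + y * S) + B * (2 * q ^ 2 / b * M) := by ring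
      _ ≤ (1 - c) / 2 * (k₁ / q) * (X₀ / (1 - c) + y * S) + B * (2 * q ^ 2 / b * M) := by gcongr
      _ = (1 - c) / 2 * (k₁ * (X₀ / (1 - c)) / q + k₁ * y / q * S)
          + B * (2 * q ^ 2 / b * M) := by ring
      _ ≤ _ := by
          gcongr
          exact div_le_self (by positivity) hq1
  -- The sum of directions has order `q² = T`: its `η²` share stays bounded and its `η` share gives
  -- the `√T` term.
  have h8 : B * (2 * q ^ 2 / b * M) =
      (1 - c) / 2 * (4 * (K₂ * a ^ 2) / ((1 - c) * b) * M
        + q * (8 * (L * a / b * (W / (1 - c))) * M)) := by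
    rw [hB]; field_simp; ring
  have h9 : (1 - c) / (a / q) * (Δ + a / q * K₅) =
      (1 - c) / 2 * (q * (2 * Δ / a) + 2 * K₅) := by
    field_simp
  have h11 : E * K₁ = (1 - c) / 2 * (2 / (1 - c) * (E * K₁)) := by
    field_simp
  refine le_of_mul_le_mul_left (a := (1 - c) / 2) ?_ (by positivity)
  linarith

set_option maxHeartbeats 1000000 in
-- Combines `expected_descent` with `integral_sum_sq_dir_le`. Only the coefficient of `√T` must be
-- explicit, as it is compared with the stated constants; `k₂` and `k₃` disappear for large `T`.
theorem exists_weightedSum_le (d : ℕ) (L σ₀ σ₁ a b c Δ : ℝ) (m₀ ν₀ : Fin d → ℝ)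
    (hL : 0 ≤ L) (hσ₀ : 0 < σ₀) (ha : 0 < a) (hb : 0 < b) (hc : 0 ≤ c) (hc' : c < 1)
    (hν₀ : ∀ i, 0 < ν₀ i) :
    ∃ (T₀ : ℕ) (k₂ k₃ : ℝ), ∀ T : ℕ, T₀ ≤ T → ∀ (Z : Type u) [MeasurableSpace Z] (P : Measure Z)
      [IsProbabilityMeasure P] (f : EuclideanSpace ℝ (Fin d) → ℝ)
      (O : EuclideanSpace ℝ (Fin d) → Z → EuclideanSpace ℝ (Fin d))
      (w₁ : EuclideanSpace ℝ (Fin d)),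
      IsSmoothObjective L f → IsAffineVarianceOracle σ₀ σ₁ P f O → f w₁ = Δ →
      ∑ i, adamWeightedSum P f O (a / √T) c (1 - b / T) w₁ m₀ ν₀ T i ≤
        √T * (2 * Δ / a + 8 * (L * a / b * ((1 + c) ^ 2 / (1 - c) ^ 2)) *
          (adamLogSum b σ₀ ν₀ + 5 / 4 * (d * b)))
        + k₂ + k₃ / √T * ∑ i, adamWeightedSum P f O (a / √T) c (1 - b / T) w₁ m₀ ν₀ T i := by
  have hc1 : 0 < 1 - c := by linarith
  set C := 1 / (1 - c) + ∑ i, |m₀ i / √(ν₀ i)| with hCdef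
  obtain ⟨hC0, hC⟩ := abs_dir_le_of_sum (m₀ := m₀) (ν₀ := ν₀) hc'
  rw [← hCdef] at hC
  simp only [← hCdef] at hC0
  have hCpos : 0 < C := lt_of_lt_of_le (by positivity) hC
  have hC1 : 1 ≤ C := le_trans (by rw [le_div_iff₀ hc1]; linarith) hC
  set δ := (1 - c) ^ 2 / (8 * C ^ 2 * (σ₁ ^ 2 + 1)) with hδdef
  have hδ : 0 < δ := by positivity
  have hδ1 : 2 * δ ≤ 1 := smoothing_param_le hc hc' hC1
  set ρ := ∑ i, 1 / √(Real.exp (-(4 * b)) * ν₀ i) with hρdef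
  have hρ0 : 0 ≤ ρ := Finset.sum_nonneg fun i _ => by positivity
  set X₀ := ∑ i, (m₀ i / √(ν₀ i)) ^ 2 with hX₀
  have hX₀0 : 0 ≤ X₀ := Finset.sum_nonneg fun i _ => sq_nonneg _
  set k := c / (1 - c) with hk
  set K₅ := (2 * (L + 1) * Δ + k ^ 2 * X₀) / 2 + L / 2 * k ^ 2 * a * X₀ with hK₅
  set K₁ := ρ * (d * σ₀ ^ 2 + σ₁ ^ 2 * (2 * (L + 1) * Δ)) + d * (b * σ₀ ^ 2 * ρ) with hK₁
  set K₂ := C ^ 2 / (1 - c) * (σ₁ ^ 2 / δ * ρ * L ^ 2) with hK₂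
  have hK₂0 : 0 ≤ K₂ := by positivity
  set y := ∑ i, 1 / √(ν₀ i + b * σ₀ ^ 2) with hy
  have hy0 : 0 ≤ y := Finset.sum_nonneg fun i _ => by positivity
  set M := adamLogSum b σ₀ ν₀ + 5 / 4 * (d * b) with hM
  have hM0 : 0 ≤ M := by
    refine add_nonneg (Finset.sum_nonneg fun i _ => ?_) (by positivity)
    have := Real.log_le_log (hν₀ i) (le_add_of_nonneg_right (a := ν₀ i)
      (by positivity : 0 ≤ b * σ₀ ^ 2))
    linarith
  set W := (1 + c) ^ 2 / (1 - c) with hW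
  -- The thresholds ensure, in turn, `T ≥ 1`, `b/T ≤ 1/5`, `1 - √β₂ ≤ δ`, and a momentum ratio of
  -- square at most 2.
  obtain ⟨T₀, hT₀⟩ := exists_nat_ge (max 1 (max (5 * b) (max (b / δ) (5 * b / (2 * (1 - c))))))
  refine ⟨T₀, 2 * K₅ + 2 / (1 - c) * (C ^ 2 / (1 - c) * K₁)
    + 4 * (K₂ * a ^ 2) / ((1 - c) * b) * M
    + 2 / (1 - c) * (K₂ * a ^ 2 + 2 * (L * a * W)) * (X₀ / (1 - c)),
    2 / (1 - c) * (K₂ * a ^ 2 + 2 * (L * a * W)) * (2 * σ₁ ^ 2 * y), ?_⟩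
  intro T hT Z _ P _ f O w₁ hf hO hΔ
  have hTr : (T₀ : ℝ) ≤ T := by exact_mod_cast hT
  have hbig := hT₀.trans hTr
  simp only [max_le_iff] at hbig
  obtain ⟨hT1, hT5, hTδ, hTc⟩ := hbig
  have hT1' : 1 ≤ T := by exact_mod_cast hT1
  have hT0 : (0 : ℝ) < T := by linarith
  have hq1 : 1 ≤ √(T : ℝ) := Real.one_le_sqrt.2 hT1
  set q := √(T : ℝ) with hq
  have hq0 : 0 < q := by linarith
  have hqq : q ^ 2 = T := Real.sq_sqrt hT0.le
  have hx0 : 0 < b / T := by positivity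
  have hx5 : b / T ≤ 1 / 5 := by rw [div_le_div_iff₀ hT0 (by norm_num)]; linarith
  have hxδ : b / T ≤ δ := by rw [div_le_iff₀ hT0]; rw [div_le_iff₀ hδ] at hTδ; linarith
  have hxc : b / T ≤ 2 * (1 - c) / 5 := by
    rw [div_le_iff₀ (by positivity)] at hTc
    rw [div_le_div_iff₀ hT0 (by norm_num)]; linarith
  set β₂ := 1 - b / (T : ℝ) with hβ₂
  have hβ : 0 < β₂ := by linarith
  have hβ' : β₂ < 1 := by linarith
  have hτ : 1 - β₂ = b / T := by rw [hβ₂]; ring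
  have hNτ : (T : ℝ) * (1 - β₂) = b := by rw [hτ]; field_simp
  have hκ : 1 - √β₂ ≤ b / T := by
    have : β₂ ≤ √β₂ := Real.le_sqrt_of_sq_le (by
      rw [sq]; exact mul_le_of_le_one_left hβ.le hβ'.le)
    linarith only [this, hτ]
  have hη : 0 < a / q := by positivity
  have hηa : a / q ≤ a := div_le_self ha.le hq1
  have hfw := hf.norm_gradient_sq_le hL w₁
  rw [hΔ] at hfw
  have hΔ0 : 0 ≤ Δ := by rw [← hΔ]; exact hf.nonneg _
  have hρT : ∀ n ≤ T, ∀ i, 1 / √(β₂ ^ (n + 1) * ν₀ i) ≤ ρ := by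
    intro n hn i
    have h1 := exp_le_pow_one_sub_div hb hT5 hT1' hn
    have := hν₀ i
    calc 1 / √(β₂ ^ (n + 1) * ν₀ i) ≤ 1 / √(Real.exp (-(4 * b)) * ν₀ i) := by gcongr
      _ ≤ ρ := Finset.single_le_sum (f := fun i => 1 / √(Real.exp (-(4 * b)) * ν₀ i))
        (fun i _ => by positivity) (Finset.mem_univ i)
  have hdesc := expected_descent (w₁ := w₁) (ε := (1 - c) / 4) hO hf hL hη hc hc' hβ hβ' hσ₀ hν₀
    hC0 hC (by positivity) hδ hδ1 (hκ.trans hxδ) hρT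
  have hX := integral_sum_sq_dir_le (w₁ := w₁) (m₀ := m₀) hO hf hL hη.le hβ hβ' hc hc' hν₀ T
  set X := ∫ z, ∑ n ∈ Finset.range (T + 1), ‖(adamState O (a / q) (c * √β₂) β₂ w₁ m₀ ν₀ z n).dir‖ ^ 2
    ∂(Measure.infinitePi fun _ : ℕ => P) with hXdef
  have hX0 : 0 ≤ X := integral_nonneg fun z => Finset.sum_nonneg fun n _ => sq_nonneg _
  change _ * ∑ i, adamWeightedSum P f O (a / q) c β₂ w₁ m₀ ν₀ T i ≤ _ at hdesc
  change X ≤ _ + _ * ∑ i, (_ + _ * adamWeightedSum P f O (a / q) c β₂ w₁ m₀ ν₀ T i) at hX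
  have hSi := adamWeightedSum_nonneg P f O (a / q) c β₂ w₁ m₀ ν₀ T
  set Si := adamWeightedSum P f O (a / q) c β₂ w₁ m₀ ν₀ T with hSidef
  set S := ∑ i, Si i with hS
  have hS0 : 0 ≤ S := Finset.sum_nonneg fun i _ => hSi i
  -- the directions
  have hXle : X ≤ X₀ / (1 - c) + 2 * T / b * M + 2 * σ₁ ^ 2 * y * S := by
    rw [hNτ, hτ] at hX
    refine hX.trans ?_
    have hp : ((1 - c * √β₂) / (1 - c)) ^ 2 ≤ 2 :=
      momentum_ratio_sq_le hc hc' (Real.sqrt_le_one.2 hβ'.le) hκ hxc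
    have hlog : -(T * Real.log β₂) ≤ 5 / 4 * b := by
      have h1 := neg_log_one_sub_le hx0.le hx5
      rw [← hβ₂] at h1
      have h2 := mul_le_mul_of_nonneg_left h1 hT0.le
      have h3 : (T : ℝ) * (5 / 4 * (b / T)) = 5 / 4 * b := by field_simp
      linarith
    have hsum : ∑ i, (Real.log (ν₀ i + b * σ₀ ^ 2) - Real.log (ν₀ i) - T * Real.log β₂
        + b / T * σ₁ ^ 2 / √(ν₀ i + b * σ₀ ^ 2) * Si i) ≤ M + b / T * σ₁ ^ 2 * y * S := by
      calc _ ≤ ∑ i, ((Real.log (ν₀ i + b * σ₀ ^ 2) - Real.log (ν₀ i)) + 5 / 4 * b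
            + b / T * σ₁ ^ 2 * S * (1 / √(ν₀ i + b * σ₀ ^ 2))) := by
            refine Finset.sum_le_sum fun i _ => ?_
            -- A crude decoupling of the coordinates; it affects only `k₃`.
            have h1 : Si i ≤ S := Finset.single_le_sum (fun i _ => hSi i) (Finset.mem_univ i)
            have h2 : b / T * σ₁ ^ 2 / √(ν₀ i + b * σ₀ ^ 2) * Si i ≤
              b / T * σ₁ ^ 2 / √(ν₀ i + b * σ₀ ^ 2) * S := by gcongr
            have h3 : b / T * σ₁ ^ 2 / √(ν₀ i + b * σ₀ ^ 2) * S =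
              b / T * σ₁ ^ 2 * S * (1 / √(ν₀ i + b * σ₀ ^ 2)) := by ring
            linarith
        _ = _ := by
            rw [Finset.sum_add_distrib, Finset.sum_add_distrib, Finset.sum_const, Finset.card_univ,
              Fintype.card_fin, nsmul_eq_mul, ← Finset.mul_sum, ← hy, hM, adamLogSum]
            ring
    have hM' : 0 ≤ M + b / T * σ₁ ^ 2 * y * S := by positivity
    calc _ ≤ X₀ / (1 - c) + ((1 - c * √β₂) / (1 - c)) ^ 2 / (b / T) *
          (M + b / T * σ₁ ^ 2 * y * S) := by gcongr
      _ ≤ X₀ / (1 - c) + 2 / (b / T) * (M + b / T * σ₁ ^ 2 * y * S) := by gcongr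
      _ = _ := by field_simp; ring
  -- the first-order terms
  have hcoef := half_le_descent_coeff (σ₁ := σ₁) hc hc' hC1 (Real.sqrt_le_one.2 hβ'.le)
  rw [← hδdef] at hcoef
  have hu := hf.shifted_le (c := c) hL hη.le hηa (⟨w₁, m₀, ν₀⟩ : AdamState d)
  have hdir : ‖(⟨w₁, m₀, ν₀⟩ : AdamState d).dir‖ ^ 2 = X₀ := by
    rw [EuclideanSpace.norm_sq_eq]
    simp only [AdamState.dir_apply, Real.norm_eq_abs, sq_abs, hX₀]
  rw [hdir] at hu
  simp only at hu
  rw [hΔ, ← hk, ← hK₅] at hu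
  have e4 : C ^ 2 / (4 * ((1 - c) / 4)) = C ^ 2 / (1 - c) := by congr 1; ring
  rw [e4] at hdesc
  have hmain : (1 - c) / 2 * S ≤ (1 - c) / (a / q) * (Δ + a / q * K₅) + C ^ 2 / (1 - c) * K₁
      + (K₂ * (a / q) ^ 2 + 2 * (L * (a / q) * W)) * X := by
    have h1 : (1 - c) / 2 * S ≤ (1 - c * √β₂ - (1 - c) / 4
      - C ^ 2 / (1 - c) * (2 * δ * σ₁ ^ 2)) * S := by gcongr
    have h2 : ρ * (d * σ₀ ^ 2 + σ₁ ^ 2 * ‖gradient f w₁‖ ^ 2)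
        + d * (T * (1 - √β₂) * σ₀ ^ 2 * ρ) ≤ K₁ := by
      have h3 : T * (1 - √β₂) ≤ b := by
        calc T * (1 - √β₂) ≤ T * (b / T) := by gcongr
          _ = b := by field_simp
      rw [hK₁]
      gcongr
    have h5 : C ^ 2 / (1 - c) * (σ₁ ^ 2 / δ * ρ * (L ^ 2 * (a / q) ^ 2))
        + 2 * (L * (a / q) * (1 + c) ^ 2 / (1 - c)) =
        K₂ * (a / q) ^ 2 + 2 * (L * (a / q) * W) := by
      rw [hK₂, hW]; ring
    rw [h5] at hdesc
    refine h1.trans (hdesc.trans ?_)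
    gcongr
  rw [← hqq] at hXle
  have hW' : (1 + c) ^ 2 / (1 - c) ^ 2 = W / (1 - c) := by
    rw [hW, div_div, ← sq]
  rw [hW']
  exact collect_orders ha hb hc' hq1 hL hK₂0 (by positivity) hX₀0 (by positivity) hS0 hXle hmain

end Rate

/-! ### Comparison with the explicit constants -/

section Constants

theorem le_adamD₁ {d : ℕ} {L a b c σ₀ σ₁ : ℝ} (hL : 0 ≤ L) (hσ₀ : 0 < σ₀) (ha : 0 < a) (hb : 0 < b)
    (hc : 0 ≤ c) (hc' : c < 1) :
    32 * (L * a / b * ((1 + c) ^ 2 / (1 - c) ^ 2)) + 32 * σ₀ / (√b * (1 - c) ^ 3) ≤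
      adamD₁ d L a b c σ₀ σ₁ := by
  have hc1 : 0 < 1 - c := by linarith
  have h1 : (1 + c) ^ 2 / (1 - c) ^ 2 ≤ (1 + c) ^ 3 / (1 - c) ^ 3 := by
    rw [← div_pow, ← div_pow]
    exact pow_le_pow_right₀ (by rw [le_div_iff₀ hc1]; linarith) (by norm_num)
  have h2 : 0 ≤ (1 + σ₁ ^ 2) * σ₁ ^ 2 * L ^ 2 * d * a ^ 2 / ((1 - c) ^ 4 * σ₀ * √(b ^ 3)) := by
    positivity
  have h3 : 32 * (L * a / b * ((1 + c) ^ 2 / (1 - c) ^ 2)) ≤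
      32 * L * a / b * ((1 + c) ^ 3 / (1 - c) ^ 3) := by
    calc _ = 32 * L * a / b * ((1 + c) ^ 2 / (1 - c) ^ 2) := by ring
      _ ≤ _ := by gcongr
  rw [adamD₁]
  linarith

theorem adamLogSum_nonneg {d : ℕ} {b σ₀ : ℝ} {ν₀ : Fin d → ℝ} (hb : 0 < b)
    (hν₀ : ∀ i, 0 < ν₀ i) : 0 ≤ adamLogSum b σ₀ ν₀ :=
  Finset.sum_nonneg fun i _ => sub_nonneg.2
    (Real.log_le_log (hν₀ i) (le_add_of_nonneg_right (by positivity)))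

/-- The limit of the coefficient of `1 / √T` under the second root of the bound. -/
theorem le_limit_coeff {d : ℕ} {L a b c σ₀ σ₁ Δ A : ℝ} {ν₀ : Fin d → ℝ} (hb : 0 < b)
    (hν₀ : ∀ i, 0 < ν₀ i) (hD : 0 ≤ adamD₁ d L a b c σ₀ σ₁)
    (hA : A = 2 * ∑ i, √(ν₀ i + 3 * b * σ₀ ^ 2)) :
    8 * Δ / a + adamD₁ d L a b c σ₀ σ₁ * (adamLogSum b σ₀ ν₀ + d * b + d * (2 * Real.log 2)) ≤
      2 * adamD₁ d L a b c σ₀ σ₁ * (d * Real.log A) + adamD₂ L a b c σ₀ σ₁ Δ ν₀ := by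
  have h1 : adamLogSum b σ₀ ν₀ + d * b + d * (2 * Real.log 2) ≤
      2 * (d * Real.log A) + (b * d - ∑ i, Real.log (ν₀ i)) := by
    -- The factor 2 in front of the sum of roots yields the surplus `2 log 2` per coordinate, which
    -- later absorbs lower-order terms.
    have h2 : ∀ i, Real.log (ν₀ i + b * σ₀ ^ 2) + 2 * Real.log 2 ≤ 2 * Real.log A := by
      intro i
      have hi := hν₀ i
      have h3 : 2 * √(ν₀ i + b * σ₀ ^ 2) ≤ A := by
        rw [hA]
        have h4 : √(ν₀ i + b * σ₀ ^ 2) ≤ √(ν₀ i + 3 * b * σ₀ ^ 2) :=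
          Real.sqrt_le_sqrt (by nlinarith [mul_nonneg hb.le (sq_nonneg σ₀)])
        have h5 := Finset.single_le_sum (f := fun i => √(ν₀ i + 3 * b * σ₀ ^ 2))
          (fun _ _ => Real.sqrt_nonneg _) (Finset.mem_univ i)
        linarith
      have h6 : 0 < √(ν₀ i + b * σ₀ ^ 2) := Real.sqrt_pos.2 (by positivity)
      have h7 := Real.log_le_log (by positivity) h3
      rw [Real.log_mul (by norm_num) h6.ne', Real.log_sqrt (by positivity)] at h7
      linarith
    have h8 := Finset.sum_le_sum fun i (_ : i ∈ Finset.univ) => h2 i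
    rw [Finset.sum_add_distrib, Finset.sum_const, Finset.sum_const, Finset.card_univ,
      Fintype.card_fin, nsmul_eq_mul, nsmul_eq_mul] at h8
    rw [adamLogSum, Finset.sum_sub_distrib]
    linarith
  have h9 := mul_le_mul_of_nonneg_left h1 hD
  rw [adamD₂]
  have : 8 * Δ / a = 8 / a * Δ := by ring
  linarith

/-- The self-referential term takes a quarter of `S`, hence the factor `4/3`; the constant `k₂` is
paid by `D'` times the logarithmic surplus `e`. -/
theorem absorb_lower_order {a q S Δ Z l B k₂ k₃ D D' Ω e : ℝ} (ha : 0 < a) (hq : 0 < q)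
    (hS : 0 ≤ S) (hΔ : 0 ≤ Δ) (hZ : 0 ≤ Z) (hl : 0 ≤ l) (hB : 0 ≤ B) (he : 0 ≤ e)
    (h : S ≤ q * (2 * Δ / a + 8 * Z * (l + 5 / 4 * B)) + k₂ + k₃ / q * S)
    (hk₃ : 4 * k₃ ≤ q) (hk₂ : 4 / 3 * k₂ ≤ q * (D' * e)) (hD' : 0 ≤ D') (hD : 32 * Z + D' ≤ D)
    (hΩ : 8 * Δ / a + D * (l + B + 2 * e) ≤ Ω) : S ≤ q * Ω / 2 := by
  have h1 : k₃ / q * S ≤ 1 / 4 * S := by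
    refine mul_le_mul_of_nonneg_right ?_ hS
    rw [div_le_div_iff₀ hq (by norm_num)]; linarith
  have h2 : S ≤ 4 / 3 * (q * (2 * Δ / a + 8 * Z * (l + 5 / 4 * B))) + 4 / 3 * k₂ := by linarith
  have h3 : (32 * Z + D') * (l + B + 2 * e) ≤ D * (l + B + 2 * e) := by gcongr
  have h4 : 0 ≤ D' * (l + B) := by positivity
  have h5 : 0 ≤ Z * l := by positivity
  have h6 : 0 ≤ Z * B := by positivity
  have h7 : 0 ≤ Z * e := by positivity
  have h8 : 0 ≤ Δ / a := by positivity
  -- Coefficientwise: `8/3 ≤ 4` for `Δ/a`, `32/3 ≤ 16` for `Z l`, `40/3 ≤ 16` for `Z B`, and `D' e`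
  -- is half of `D' · 2 e`.
  have h9 : 4 / 3 * (2 * Δ / a + 8 * Z * (l + 5 / 4 * B)) + D' * e ≤ Ω / 2 := by
    have e1 : 2 * Δ / a = 2 * (Δ / a) := by ring
    have e2 : 8 * Δ / a = 8 * (Δ / a) := by ring
    rw [e1]; rw [e2] at hΩ
    nlinarith
  have h10 := mul_le_mul_of_nonneg_left h9 hq.le
  linarith

/-- Only the term with `adamD₂` can be negative, and for large `T` it is at least `-A/4`. -/
theorem le_adamInner {d T : ℕ} {L a b c σ₀ σ₁ Δ D A : ℝ} {ν₀ : Fin d → ℝ}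
    {G₁ : EuclideanSpace ℝ (Fin d)} (hb : 0 < b)
    (hD₁ : 0 ≤ adamD₁ d L a b c σ₀ σ₁) (hD : 0 ≤ D)
    (hA : A = 2 * ∑ i, √(ν₀ i + 3 * b * σ₀ ^ 2)) (hT : 1 ≤ T)
    (hbig : 16 * |adamD₂ L a b c σ₀ σ₁ Δ ν₀| * σ₁ ^ 2 * b ≤ √T * A) :
    3 / 4 * A ≤ adamInner L a b c σ₀ σ₁ Δ ν₀ G₁ D T := by
  have hT0 : (0 : ℝ) < T := by exact_mod_cast hT
  have hq : 0 < √(T : ℝ) := Real.sqrt_pos.2 hT0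
  have h1 : -(A / 4) ≤ 4 * adamD₂ L a b c σ₀ σ₁ Δ ν₀ * σ₁ ^ 2 * b / √T := by
    rw [le_div_iff₀ hq]
    have : -|adamD₂ L a b c σ₀ σ₁ Δ ν₀| * (σ₁ ^ 2 * b) ≤
        adamD₂ L a b c σ₀ σ₁ Δ ν₀ * (σ₁ ^ 2 * b) :=
      mul_le_mul_of_nonneg_right (neg_abs_le _) (by positivity)
    linarith
  have h2 : 0 ≤ 256 * σ₁ ^ 2 * b / ((1 - c) ^ 2 * T) * adamInitTerm b σ₀ ν₀ G₁ T :=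
    mul_nonneg (by positivity) (Finset.sum_nonneg fun i _ => by positivity)
  have h3 : 0 ≤ Real.log (Real.exp 1 + 4 * D * σ₁ ^ 2 * b / √T) := by
    refine Real.log_nonneg ?_
    have h4 : 0 ≤ 4 * D * σ₁ ^ 2 * b / √T := by positivity
    have h5 : 1 ≤ Real.exp 1 := Real.one_le_exp zero_le_one
    linarith
  have h6 : 0 ≤ 16 * adamD₁ d L a b c σ₀ σ₁ * σ₁ ^ 2 * b / √T *
      Real.log (Real.exp 1 + 4 * D * σ₁ ^ 2 * b / √T) := by positivity
  rw [adamInner, ← hA]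
  linarith

theorem two_mul_log_four_thirds_le : 2 * Real.log (4 / 3) ≤ Real.log 2 := by
  rw [← Real.log_rpow (by norm_num)]
  exact Real.log_le_log (by positivity) (by norm_num)

theorem le_adamBound {d T : ℕ} {L a b c σ₀ σ₁ Δ D A Ω : ℝ} {ν₀ : Fin d → ℝ}
    {G₁ : EuclideanSpace ℝ (Fin d)} (hb : 0 < b)
    (hD₁ : 0 ≤ adamD₁ d L a b c σ₀ σ₁) (hD : 0 ≤ D) (hA0 : 0 < A)
    (hA : A = 2 * ∑ i, √(ν₀ i + 3 * b * σ₀ ^ 2)) (hT : 1 ≤ T)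
    (hbig : 16 * |adamD₂ L a b c σ₀ σ₁ Δ ν₀| * σ₁ ^ 2 * b ≤ √T * A)
    (hΩ : Ω = 2 * adamD₁ d L a b c σ₀ σ₁ * (d * Real.log A) + adamD₂ L a b c σ₀ σ₁ Δ ν₀)
    (hΩ' : adamD₁ d L a b c σ₀ σ₁ * (d * (2 * Real.log 2)) ≤ Ω) :
    √(3 / 4 * A) * √(Ω / (2 * √T)) ≤ adamBound L a b c σ₀ σ₁ Δ ν₀ G₁ D T := by
  have hT0 : (0 : ℝ) < T := by exact_mod_cast hT
  have hq : 0 < √(T : ℝ) := Real.sqrt_pos.2 hT0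
  have h1 := le_adamInner (G₁ := G₁) hb hD₁ hD hA hT hbig
  rw [adamBound]
  set I := adamInner L a b c σ₀ σ₁ Δ ν₀ G₁ D T
  set D₁ := adamD₁ d L a b c σ₀ σ₁
  refine mul_le_mul (Real.sqrt_le_sqrt h1) (Real.sqrt_le_sqrt ?_) (Real.sqrt_nonneg _)
    (Real.sqrt_nonneg _)
  have h2 : 0 ≤ 64 / ((1 - c) ^ 2 * T) * adamInitTerm b σ₀ ν₀ G₁ T :=
    mul_nonneg (by positivity) (Finset.sum_nonneg fun i _ => by positivity)
  have h3 : Real.log A - Real.log (4 / 3) ≤ Real.log I := by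
    rw [← Real.log_div hA0.ne' (by norm_num)]
    exact Real.log_le_log (by positivity) (by linarith)
  have h4 : Ω / 2 ≤ 2 * D₁ * (d * Real.log I) + adamD₂ L a b c σ₀ σ₁ Δ ν₀ := by
    have h5 : 2 * D₁ * (d * (Real.log A - Real.log (4 / 3))) ≤ 2 * D₁ * (d * Real.log I) := by
      gcongr
    -- Replacing `A` by `3 A / 4` inside the logarithm loses at most `Ω / 2`.
    have h6 : D₁ * (d * (2 * (2 * Real.log (4 / 3)))) ≤ D₁ * (d * (2 * Real.log 2)) := by
      gcongr
      exact two_mul_log_four_thirds_le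
    linarith
  rw [Finset.sum_const, Finset.card_univ, Fintype.card_fin, nsmul_eq_mul]
  have h7 : Ω / (2 * √T) = Ω / 2 / √T := by rw [div_div]
  have h8 : 2 * D₁ / √T * (d * Real.log I) + adamD₂ L a b c σ₀ σ₁ Δ ν₀ / √T =
      (2 * D₁ * (d * Real.log I) + adamD₂ L a b c σ₀ σ₁ Δ ν₀) / √T := by ring
  have h9 : Ω / 2 / √T ≤ (2 * D₁ * (d * Real.log I) + adamD₂ L a b c σ₀ σ₁ Δ ν₀) / √T := by
    gcongr
  rw [h7]
  linarith

end Constants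

/-! ### The rate and the iteration complexity -/

section Main

theorem adamExpectedGradNorm_dim_zero {Z : Type u} [MeasurableSpace Z] (P : Measure Z)
    [IsProbabilityMeasure P] (f : EuclideanSpace ℝ (Fin 0) → ℝ)
    (O : EuclideanSpace ℝ (Fin 0) → Z → EuclideanSpace ℝ (Fin 0)) (η β₁ β₂ : ℝ)
    (w₁ : EuclideanSpace ℝ (Fin 0)) (m₀ ν₀ : Fin 0 → ℝ) (T : ℕ) :
    adamExpectedGradNorm P f O η β₁ β₂ w₁ m₀ ν₀ T = 0 := by
  have h : ∀ w, gradient f w = 0 := fun w => Subsingleton.elim _ _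
  simp [adamExpectedGradNorm, h]

/-- The rate for oracles with coordinate-wise affine variance. -/
theorem adam_rate_affine (d : ℕ) (L σ₀ σ₁ a b c Δ : ℝ) (m₀ ν₀ : Fin d → ℝ)
    (hL : 0 ≤ L) (hσ₀ : 0 < σ₀) (ha : 0 < a) (hb : 0 < b) (hc : 0 ≤ c) (hc' : c < 1)
    (hν₀ : ∀ i, 0 < ν₀ i) :
    ∃ (T₀ : ℕ) (K : ℝ), ∀ T : ℕ, T₀ ≤ T → ∀ (Z : Type u) [MeasurableSpace Z] (P : Measure Z)
      [IsProbabilityMeasure P] (f : EuclideanSpace ℝ (Fin d) → ℝ)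
      (O : EuclideanSpace ℝ (Fin d) → Z → EuclideanSpace ℝ (Fin d))
      (w₁ : EuclideanSpace ℝ (Fin d)),
      IsSmoothObjective L f → IsAffineVarianceOracle σ₀ σ₁ P f O → f w₁ = Δ →
      (∀ D : ℝ, 0 ≤ D →
        adamExpectedGradNorm P f O (a / √T) (c * √(1 - b / T)) (1 - b / T) w₁ m₀ ν₀ T
          ≤ ENNReal.ofReal (adamBound L a b c σ₀ σ₁ (f w₁) ν₀ (gradient f w₁) D T)) ∧
      adamExpectedGradNorm P f O (a / √T) (c * √(1 - b / T)) (1 - b / T) w₁ m₀ ν₀ T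
        ≤ ENNReal.ofReal (K / (T : ℝ) ^ (1 / 4 : ℝ)) := by
  -- In dimension 0 the constant `A` vanishes, but so does every gradient.
  rcases Nat.eq_zero_or_pos d with rfl | hd
  · exact ⟨0, 0, fun T _ Z _ P _ f O w₁ _ _ _ => by simp [adamExpectedGradNorm_dim_zero]⟩
  have hc1 : 0 < 1 - c := by linarith
  have hd0 : (0 : ℝ) < d := by exact_mod_cast hd
  obtain ⟨T₁, k₂, k₃, hS⟩ := exists_weightedSum_le.{u} d L σ₀ σ₁ a b c Δ m₀ ν₀ hL hσ₀ ha hb hc hc' hν₀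
  obtain ⟨A, hA⟩ : ∃ A, A = 2 * ∑ i, √(ν₀ i + 3 * b * σ₀ ^ 2) := ⟨_, rfl⟩
  have hA0 : 0 < A := by
    rw [hA]
    have : Nonempty (Fin d) := ⟨⟨0, hd⟩⟩
    refine mul_pos two_pos (Finset.sum_pos (fun i _ => Real.sqrt_pos.2 ?_) Finset.univ_nonempty)
    have := hν₀ i
    positivity
  have hD := le_adamD₁ (d := d) (σ₁ := σ₁) hL hσ₀ ha hb hc hc'
  have hZ0 : 0 ≤ L * a / b * ((1 + c) ^ 2 / (1 - c) ^ 2) := by positivity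
  have hD'0 : 0 < 32 * σ₀ / (√b * (1 - c) ^ 3) := by positivity
  have hΩ1 := le_limit_coeff (Δ := Δ) (a := a) hb hν₀
    (by linarith : 0 ≤ adamD₁ d L a b c σ₀ σ₁) hA
  obtain ⟨D₂, hD₂⟩ : ∃ D₂, D₂ = adamD₂ L a b c σ₀ σ₁ Δ ν₀ := ⟨_, rfl⟩
  obtain ⟨Ω, hΩ⟩ : ∃ Ω, Ω = 2 * adamD₁ d L a b c σ₀ σ₁ * (d * Real.log A)
    + adamD₂ L a b c σ₀ σ₁ Δ ν₀ := ⟨_, rfl⟩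
  rw [← hΩ] at hΩ1
  have hD₁0 : 0 < adamD₁ d L a b c σ₀ σ₁ := by linarith
  set D₁ := adamD₁ d L a b c σ₀ σ₁
  set Z₀ := L * a / b * ((1 + c) ^ 2 / (1 - c) ^ 2)
  set D' := 32 * σ₀ / (√b * (1 - c) ^ 3)
  have hlog2 : 0 < Real.log 2 := Real.log_pos (by norm_num)
  have hgap : 0 < D' * (d * Real.log 2) := by positivity
  -- Threshold for `√T`: absorb `k₃`, absorb `k₂`, make the excess of the expected roots at most
  -- `A/4`, and keep the `adamD₂` term above `-A/4`.
  obtain ⟨x, hx⟩ : ∃ x, x = max 1 (max (4 * k₃) (max (4 / 3 * k₂ / (D' * (d * Real.log 2)))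
    (max (b * σ₁ ^ 2 * Ω / A) (16 * |D₂| * σ₁ ^ 2 * b / A)))) := ⟨_, rfl⟩
  obtain ⟨T₂, hT₂⟩ := exists_nat_ge (max (5 * b) (x ^ 2))
  refine ⟨max T₁ T₂, √(3 / 4 * A) * √(Ω / 2), ?_⟩
  intro T hT Z _ P _ f O w₁ hf hO hΔ
  have hTr : (T₂ : ℝ) ≤ T := by exact_mod_cast (le_max_right _ _).trans hT
  have hbig := hT₂.trans hTr
  simp only [max_le_iff] at hbig
  have hq := Real.le_sqrt_of_sq_le hbig.2
  rw [hx] at hq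
  simp only [max_le_iff] at hq
  obtain ⟨hq1, hqk₃, hqk₂, hqΩ, hqD⟩ := hq
  have hq0 : 0 < √(T : ℝ) := by linarith
  have hT0 : (0 : ℝ) < T := Real.sqrt_pos.1 hq0
  have hT1 : 1 ≤ T := by exact_mod_cast hT0
  have hqq : √(T : ℝ) ^ 2 = T := Real.sq_sqrt hT0.le
  have hΔ0 : 0 ≤ Δ := by rw [← hΔ]; exact hf.nonneg _
  have hl0 := adamLogSum_nonneg (σ₀ := σ₀) hb hν₀
  rw [div_le_iff₀ hgap] at hqk₂
  rw [div_le_iff₀ hA0] at hqΩ hqD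
  have hS1 := hS T ((le_max_left _ _).trans hT) Z P f O w₁ hf hO hΔ
  have hSi := adamWeightedSum_nonneg P f O (a / √T) c (1 - b / T) w₁ m₀ ν₀ T
  have hS0 := Finset.sum_nonneg fun i (_ : i ∈ Finset.univ) => hSi i
  have hS2 : ∑ i, adamWeightedSum P f O (a / √T) c (1 - b / T) w₁ m₀ ν₀ T i ≤ √T * Ω / 2 :=
    absorb_lower_order (e := d * Real.log 2) (B := d * b) ha hq0 hS0 hΔ0 hZ0 hl0 (by positivity)
      (by positivity) hS1 hqk₃ hqk₂ hD'0.le hD (by linarith)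
  have hΩ' : D₁ * (d * (2 * Real.log 2)) ≤ Ω := by
    have h1 : 0 ≤ 8 * Δ / a := by positivity
    have h2 : 0 ≤ D₁ * (adamLogSum b σ₀ ν₀ + d * b) := by positivity
    linarith
  have hΩ0 : 0 < Ω := lt_of_lt_of_le (by positivity) hΩ'
  have hτ0 : 0 < b / T := by positivity
  have hτ1 : b / T ≤ 1 / 5 := by rw [div_le_div_iff₀ hT0 (by norm_num)]; linarith
  have hτ : 1 - (1 - b / (T : ℝ)) = b / T := by ring
  have hmain : adamExpectedGradNorm P f O (a / √T) (c * √(1 - b / T)) (1 - b / T) w₁ m₀ ν₀ T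
      ≤ ENNReal.ofReal (√(3 / 4 * A) * √(Ω / (2 * √T))) := by
    -- Used with `Ω/(2√T)` for the mean weighted square and `3A/4` for the sum of roots: `A/2` from
    -- the noise level and `A/4` from the gradients.
    refine adamExpectedGradNorm_le hO hf hL (by positivity) (by linarith) (by linarith) hc hc' hν₀
      hT1 (by positivity) (by positivity) (hS2.trans (le_of_eq ?_))
      fun n hn => ?_
    · nth_rewrite 3 [← hqq]; field_simp
    · have hroot := fun i => (integral_sqrt_conditioner_le (w₁ := w₁) (m₀ := m₀) (η := a / √T)
        (β₂ := 1 - b / T) hO hf hL (by positivity) (by linarith) (by linarith) hc hc' hν₀ n i).2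
      have hstep : ∀ i, ∫ z, √((adamState O (a / √T) (c * √(1 - b / T)) (1 - b / T) w₁ m₀ ν₀ z n).ν i)
          ∂(Measure.infinitePi fun _ : ℕ => P) ≤ √(ν₀ i + 3 * b * σ₀ ^ 2) + b / T / 2 * σ₁ ^ 2 *
            adamWeightedSum P f O (a / √T) c (1 - b / T) w₁ m₀ ν₀ T i := by
        intro i
        refine (hroot i).trans ?_
        rw [hτ]
        have hmono := adamWeightedSum_mono P f O (a / √T) c (1 - b / T) w₁ m₀ ν₀ hn.le i
        have h1 : (n : ℝ) * (b / T) ≤ b := by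
          have : (n : ℝ) ≤ T := by exact_mod_cast hn.le
          calc (n : ℝ) * (b / T) ≤ T * (b / T) := by gcongr
            _ = b := by field_simp
        have h2 : ν₀ i + n * (b / T) * σ₀ ^ 2 ≤ ν₀ i + 3 * b * σ₀ ^ 2 := by
          have : (n : ℝ) * (b / T) ≤ 3 * b := by linarith
          gcongr
        exact add_le_add (Real.sqrt_le_sqrt h2) (mul_le_mul_of_nonneg_left hmono (by positivity))
      refine (Finset.sum_le_sum fun i _ => hstep i).trans ?_
      rw [Finset.sum_add_distrib, ← Finset.mul_sum]
      have h3 : b / T / 2 * σ₁ ^ 2 *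
          ∑ i, adamWeightedSum P f O (a / √T) c (1 - b / T) w₁ m₀ ν₀ T i ≤ A / 4 := by
        calc _ ≤ b / T / 2 * σ₁ ^ 2 * (√T * Ω / 2) := by gcongr
          _ = b * σ₁ ^ 2 * Ω / (4 * √T) := by
            nth_rewrite 1 [← hqq]; field_simp; ring
          _ ≤ _ := by
            rw [div_le_div_iff₀ (by positivity) (by norm_num)]; linarith
      linarith
  refine ⟨fun D hD0 => hmain.trans (ENNReal.ofReal_le_ofReal ?_), hmain.trans (le_of_eq ?_)⟩
  · rw [hΔ]
    exact le_adamBound hb hD₁0.le hD0 hA0 hA hT1 (by rw [← hD₂]; exact hqD) hΩ hΩ'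
  · congr 1
    have h1 : (T : ℝ) ^ (1 / 4 : ℝ) = √(√T) := by
      rw [Real.sqrt_eq_rpow, Real.sqrt_eq_rpow, ← Real.rpow_mul hT0.le]; norm_num
    rw [h1, ← div_div, Real.sqrt_div (by positivity)]
    ring

/-- Coordinatewise, the second moment is the variance plus the squared mean, and a coordinate's
variance is at most the total one. -/
theorem IsBoundedVarianceOracle.toAffine {d : ℕ} {Z : Type u} [MeasurableSpace Z] {P : Measure Z}
    {σ : ℝ} {f : EuclideanSpace ℝ (Fin d) → ℝ}
    {O : EuclideanSpace ℝ (Fin d) → Z → EuclideanSpace ℝ (Fin d)}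
    (hO : IsBoundedVarianceOracle σ P f O) : IsAffineVarianceOracle σ 1 P f O := by
  have := hO.isProbability
  have hm : ∀ w i, Measurable fun z => O w z i := fun w i =>
    (EuclideanSpace.proj (𝕜 := ℝ) i).continuous.measurable.comp
      (hO.measurable.comp measurable_prodMk_left)
  have hi : ∀ w i, Integrable (fun z => O w z i) P := fun w i =>
    (EuclideanSpace.proj (𝕜 := ℝ) i).integrable_comp (hO.integrable w)
  have hcoord : ∀ w z i, (O w z i - gradient f w i) ^ 2 ≤ ‖O w z - gradient f w‖ ^ 2 := by
    intro w z i
    rw [← sq_abs]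
    exact pow_le_pow_left₀ (abs_nonneg _) (PiLp.norm_apply_le (O w z - gradient f w) i) 2
  have hdev : ∀ w i, Integrable (fun z => (O w z i - gradient f w i) ^ 2) P := fun w i =>
    (hO.sq_integrable w).mono' (((hm w i).sub_const _).pow_const 2).aestronglyMeasurable
      (Filter.Eventually.of_forall fun z => by
        rw [Real.norm_of_nonneg (sq_nonneg _)]; exact hcoord w z i)
  have hexp : ∀ w i, (fun z => O w z i ^ 2) = fun z => (O w z i - gradient f w i) ^ 2
      + (2 * gradient f w i * O w z i - gradient f w i ^ 2) := fun w i => by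
    funext z; ring
  have hlin : ∀ w i, Integrable (fun z => 2 * gradient f w i * O w z i - gradient f w i ^ 2) P :=
    fun w i => ((hi w i).const_mul _).sub (integrable_const _)
  refine ⟨hO.toIsUnbiasedOracle, fun w i => ?_, fun w i => ?_⟩
  · rw [hexp]
    exact (hdev w i).add (hlin w i)
  · have hmean : ∫ z, O w z i ∂P = gradient f w i := by
      rw [← hO.unbiased w]
      exact (EuclideanSpace.proj (𝕜 := ℝ) i).integral_comp_comm (hO.integrable w)
    rw [hexp, integral_add (hdev w i) (hlin w i),
      integral_sub ((hi w i).const_mul _) (integrable_const _), integral_const_mul, hmean]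
    have h1 := (integral_mono (hdev w i) (hO.sq_integrable w) fun z => hcoord w z i).trans
      (hO.variance_le w)
    simp only [integral_const, probReal_univ, smul_eq_mul, one_mul]
    linarith

theorem adamComplexity_le {d : ℕ} {L σ a b c Δ : ℝ} {m₀ ν₀ : Fin d → ℝ} (ha : 0 < a) (hb : 0 < b)
    (hc : 0 ≤ c) (hc' : c < 1) {T₀ : ℕ} {K : ℝ}
    (h : ∀ T : ℕ, T₀ ≤ T → ∀ (Z : Type u) [MeasurableSpace Z] (P : Measure Z)
      [IsProbabilityMeasure P] (f : EuclideanSpace ℝ (Fin d) → ℝ)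
      (O : EuclideanSpace ℝ (Fin d) → Z → EuclideanSpace ℝ (Fin d))
      (w₁ : EuclideanSpace ℝ (Fin d)),
      IsSmoothObjective L f → IsBoundedVarianceOracle σ P f O → f w₁ = Δ →
      adamExpectedGradNorm P f O (a / √T) (c * √(1 - b / T)) (1 - b / T) w₁ m₀ ν₀ T
        ≤ ENNReal.ofReal (K / (T : ℝ) ^ (1 / 4 : ℝ))) :
    ∃ K' : ℝ, ∀ ε : ℝ, 0 < ε → ε ≤ 1 →
      ((adamComplexity.{u} m₀ ν₀ ε Δ L σ : ℕ∞) : ENNReal) ≤ ENNReal.ofReal (K' / ε ^ 4) := by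
  -- `T > b` keeps `β₂` positive, so that the hyperparameters are admissible.
  obtain ⟨T₁, hT₁⟩ := exists_nat_gt (max 1 b)
  refine ⟨(T₀ + T₁ : ℕ) + K ^ 4 + 1, fun ε hε hε1 => ?_⟩
  set T := T₀ + T₁ + ⌈(K / ε) ^ 4⌉₊ with hT
  have hTr : ((T₀ + T₁ : ℕ) : ℝ) + (K / ε) ^ 4 ≤ T := by
    rw [hT, Nat.cast_add (T₀ + T₁)]
    gcongr
    exact Nat.le_ceil _
  have hK4 : 0 ≤ (K / ε) ^ 4 := by positivity
  have hTb : max 1 b < T := by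
    refine hT₁.trans_le (le_trans ?_ (le_trans (le_add_of_nonneg_right hK4) hTr))
    exact_mod_cast Nat.le_add_left _ _
  have hT1 : (1 : ℝ) < T := (le_max_left _ _).trans_lt hTb
  have hTb' : b < T := (le_max_right _ _).trans_lt hTb
  have hT0 : (0 : ℝ) < T := by linarith
  have hle : adamComplexity.{u} m₀ ν₀ ε Δ L σ ≤ (T : ℕ∞) := by
    refine iSup_le fun Z => iSup_le fun _ => iSup_le fun P => iSup_le fun hP => iSup_le fun f =>
      iSup_le fun O => iSup_le fun w₁ => iSup_le fun hf => iSup_le fun hO => iSup_le fun hΔ => ?_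
    have hbT : b / T < 1 := by rwa [div_lt_one hT0]
    have hbT0 : 0 < b / T := by positivity
    have hs : √(1 - b / T) ≤ 1 := Real.sqrt_le_one.2 (by linarith)
    refine iInf_le_of_le T (iInf_le_of_le (a / √T) (iInf_le_of_le (c * √(1 - b / T))
      (iInf_le_of_le (1 - b / T) (iInf_le_of_le ⟨?_, ?_, ?_, ?_, ?_, ?_, ?_⟩ le_rfl))))
    · exact_mod_cast hT1.le
    · positivity
    · positivity
    · exact (mul_le_of_le_one_right hc hs).trans_lt hc'
    · linarith
    · linarith
    · refine (h T (by omega) Z P f O w₁ hf hO hΔ).trans (ENNReal.ofReal_le_ofReal ?_)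
      have hp : 0 < (T : ℝ) ^ (1 / 4 : ℝ) := Real.rpow_pos_of_pos hT0 _
      have hp4 : ((T : ℝ) ^ (1 / 4 : ℝ)) ^ 4 = T := by
        rw [← Real.rpow_natCast, ← Real.rpow_mul hT0.le]; norm_num
      rw [div_le_iff₀ hp, mul_comm, ← div_le_iff₀ hε]
      -- Fourth powers are compared by contradiction, so the sign of `K` plays no role.
      by_contra! hlt
      have hlt4 := pow_lt_pow_left₀ hlt hp.le (by norm_num : (4 : ℕ) ≠ 0)
      have : (0 : ℝ) ≤ (T₀ + T₁ : ℕ) := Nat.cast_nonneg _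
      linarith
  refine (ENat.toENNReal_le.2 hle).trans ?_
  rw [ENat.toENNReal_coe, ← ENNReal.ofReal_natCast]
  refine ENNReal.ofReal_le_ofReal ?_
  have h1 : (T : ℝ) ≤ (T₀ + T₁ : ℕ) + ((K / ε) ^ 4 + 1) := by
    rw [hT, Nat.cast_add (T₀ + T₁)]
    gcongr
    exact (Nat.ceil_lt_add_one hK4).le
  refine h1.trans ?_
  rw [le_div_iff₀ (by positivity)]
  -- For `ε ≤ 1` the additive constants are also of order `1/ε⁴`.
  have h2 : ε ^ 4 ≤ 1 := pow_le_one₀ hε.le hε1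
  have h3 : (K / ε) ^ 4 * ε ^ 4 = K ^ 4 := by field_simp
  have h4 : (0 : ℝ) ≤ (T₀ + T₁ : ℕ) := Nat.cast_nonneg _
  nlinarith [pow_pos hε 4]

end Main
theorem theorem2 (d : ℕ) (L σ a b c Δ : ℝ) (m₀ ν₀ : Fin d → ℝ)
    (hL : 0 ≤ L) (hσ : 0 < σ) (ha : 0 < a) (hb : 0 < b) (hc : 0 ≤ c) (hc' : c < 1)
    (hν₀ : ∀ i, 0 < ν₀ i) :
    -- the bound for oracles with bounded variance, where `σ₀ = σ` and `σ₁ = 1`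
    (∃ (T₀ : ℕ) (K : ℝ), ∀ T : ℕ, T₀ ≤ T → ∀ (Z : Type u) [MeasurableSpace Z] (P : Measure Z)
      [IsProbabilityMeasure P] (f : EuclideanSpace ℝ (Fin d) → ℝ)
      (O : EuclideanSpace ℝ (Fin d) → Z → EuclideanSpace ℝ (Fin d))
      (w₁ : EuclideanSpace ℝ (Fin d)),
      IsSmoothObjective L f → IsBoundedVarianceOracle σ P f O → f w₁ = Δ →
      (∀ D : ℝ, 0 ≤ D →
        adamExpectedGradNorm P f O (a / Real.sqrt T) (c * Real.sqrt (1 - b / T)) (1 - b / T)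
            w₁ m₀ ν₀ T
          ≤ ENNReal.ofReal (adamBound L a b c σ 1 (f w₁) ν₀ (gradient f w₁) D T)) ∧
      adamExpectedGradNorm P f O (a / Real.sqrt T) (c * Real.sqrt (1 - b / T)) (1 - b / T)
          w₁ m₀ ν₀ T
        ≤ ENNReal.ofReal (K / (T : ℝ) ^ (1 / 4 : ℝ))) ∧
    -- the same for oracles with coordinate-wise affine variance
    (∀ σ₀ σ₁ : ℝ, 0 < σ₀ → 0 ≤ σ₁ →
      ∃ (T₀ : ℕ) (K : ℝ), ∀ T : ℕ, T₀ ≤ T → ∀ (Z : Type u) [MeasurableSpace Z] (P : Measure Z)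
      [IsProbabilityMeasure P] (f : EuclideanSpace ℝ (Fin d) → ℝ)
      (O : EuclideanSpace ℝ (Fin d) → Z → EuclideanSpace ℝ (Fin d))
      (w₁ : EuclideanSpace ℝ (Fin d)),
      IsSmoothObjective L f → IsAffineVarianceOracle σ₀ σ₁ P f O → f w₁ = Δ →
      (∀ D : ℝ, 0 ≤ D →
        adamExpectedGradNorm P f O (a / Real.sqrt T) (c * Real.sqrt (1 - b / T)) (1 - b / T)
            w₁ m₀ ν₀ T
          ≤ ENNReal.ofReal (adamBound L a b c σ₀ σ₁ (f w₁) ν₀ (gradient f w₁) D T)) ∧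
      adamExpectedGradNorm P f O (a / Real.sqrt T) (c * Real.sqrt (1 - b / T)) (1 - b / T)
          w₁ m₀ ν₀ T
        ≤ ENNReal.ofReal (K / (T : ℝ) ^ (1 / 4 : ℝ))) ∧
    -- the iteration complexity is `O(1 / ε ^ 4)`
    (∃ K : ℝ, ∀ ε : ℝ, 0 < ε → ε ≤ 1 →
      ((adamComplexity.{u} m₀ ν₀ ε Δ L σ : ℕ∞) : ENNReal) ≤ ENNReal.ofReal (K / ε ^ 4)) := by

  have haff := fun σ₀ σ₁ (h : 0 < σ₀) =>
    adam_rate_affine.{u} d L σ₀ σ₁ a b c Δ m₀ ν₀ hL h ha hb hc hc' hν₀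
  obtain ⟨T₀, K, h⟩ := haff σ 1 hσ
  refine ⟨⟨T₀, K, fun T hT Z _ P _ f O w₁ hf hO => h T hT Z P f O w₁ hf hO.toAffine⟩,
    fun σ₀ σ₁ h₀ _ => haff σ₀ σ₁ h₀, ?_⟩
  exact adamComplexity_le ha hb hc hc' fun T hT Z _ P _ f O w₁ hf hO hΔ =>
    (h T hT Z P f O w₁ hf hO.toAffine hΔ).2
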